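/- **Setting.** Let $(X,Y,Z)$ be a random vector, $X\in\mathcal X$, $Z\in\mathcal Z$, with categorical $Y$ (taking values in a countable set; write $p(y\mid x,z)$ and $p(y\mid z)$ for its conditional probabilities). Let $|\mathcal Y|\in\{2,3,\dots\}\cup\{\infty\}$ be the number of categories of positive probability, with $1/\infty=0$, and let $$\mathrm{ETV}=\frac{1}{1-1/|\mathcal Y|}\,\mathbb E\big[\mathrm{TV}(\mathcal L(Y\mid X,Z),\mathcal L(Y\mid Z))\big],$$ where $\mathrm{TV}$ is half the $L^1$ distance of the probability mass functions. Fix $J\ge1$ (number of resamples), $k\ge1$ (number of folds, not depending on $n$), $\alpha\in(0,1)$ and $z_\alpha$ with $1-\Phi(z_\alpha)=\alpha$, $\Phi$ the standard normal distribution function. The observations $W_i=(X_i,X_i^{(1:J)},Y_i,Z_i)$, $i=1,\dots,n$, are i.i.d. copies of $W=(X,X^{(1:J)},Y,Z)$, where, given $(X,Y,Z)$, the $X^{(1)},\dots,X^{(J)}$ are i.i.d. from $\mathcal L(X\mid Z)$. For a measurable classifier $g:\mathcal X\times\mathcal Y\times\mathcal Z\to[0,1]$ let $$\ell(g;(x,x^{(1:J)},y,z))=|g(x,y,z)-1|+\frac1J\sum_{j=1}^J|g(x^{(j)},y,z)|.$$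 **Cross-validated floodgate bound.** Independently of the data, $\{1,\dots,n\}$ is partitioned uniformly at random into $k$ folds $B_1^c,\dots,B_k^c$ with sizes differing by at most one; $B_r$ is the complement of $B_r^c$. A training rule $f$ (measurable in the training data and the argument) produces from the data in $B_r$ a classifier $f_{B_r}$ with values in $[0,1]$. Let $\hat\mu_r$ and $\hat\sigma_r^2$ be the mean, and the mean of squares minus the squared mean, of $\ell(f_{B_r};W_i)$, $i\in B_r^c$; let $\hat\mu=\frac1k\sum_r\hat\mu_r$, $\hat\sigma^2=\frac1k\sum_r\hat\sigma^2_r$, and $$L_n^\alpha(f)=\max\Big(0,\frac{1-\hat\mu-z_\alpha\hat\sigma/\sqrt n}{1-1/|\mathcal Y|}\Big).$$ **Theorem.** For a training rule $f$ put $h_n(w;B_r)=\ell(f_{B_r};w)$, $\bar h_n(w)=\mathbb E_{B_1}[h_n(w;B_1)]$ and $\sigma_n=\sqrt{\mathrm{Var}(\bar h_n(W))}$. Assume that $\sigma_n>0$ for all large $n$ and that (a) the sequence $\big(\bar h_n(W)-\mathbb E[\bar h_n(W)]\big)/\sigma_n^2$ is uniformly integrable; (b) (asymptotic linearity) $$\frac{1}{\sigma_n\sqrt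 n}\sum_{r=1}^k\sum_{i\in B_r^c}\Big(h_n(W_i;B_r)-\mathbb E[h_n(W_i;B_r)\mid B_r]-\big(\bar h_n(W_i)-\mathbb E[\bar h_n(W)]\big)\Big)\to0\quad\text{in probability.}$$ Then $\liminf_{n\to\infty}\mathbb P(\mathrm{ETV}\ge L_n^\alpha(f))\ge1-\alpha$. Additionally, let $f_{\mathrm{oracle}}(x,y,z)=\mathbb I(p(y\mid x,z)>p(y\mid z))$, used as the constant training rule. If $\mathrm{Var}(\ell(f_{\mathrm{oracle}};W))>0$, then $\lim_{n\to\infty}\mathbb P(\mathrm{ETV}\ge L_n^\alpha(f_{\mathrm{oracle}}))=1-\alpha$. -/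

import Mathlib

open MeasureTheory ProbabilityTheory Filter Topology

namespace Floodgate

noncomputable section

variable {𝒳 𝒴 𝒵 : Type*} [MeasurableSpace 𝒳] [MeasurableSpace 𝒴] [MeasurableSpace 𝒵]

/-! ### The population: ETV

The joint law of `(X, Y, Z)` is given by the law `μZ` of `Z`, the conditional law `Q` of `X` given
`Z`, and the conditional law `R` of `Y` given `(Z, X)`. -/

/-- The conditional law of `Y` given `Z`: integrate `L(Y | X, Z)` against `L(X | Z)`. -/
def condYZ (Q : Kernel 𝒵 𝒳) (R : Kernel (𝒵 × 𝒳) 𝒴) : Kernel 𝒵 𝒴 := (Q ⊗ₖ R).snd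

/-- The marginal law of `Y`. -/
def lawY (μZ : Measure 𝒵) (Q : Kernel 𝒵 𝒳) (R : Kernel (𝒵 × 𝒳) 𝒴) : Measure 𝒴 :=
  μZ.bind (condYZ Q R)

/-- The support of the categorical variable `Y`: all categories of positive probability. -/
def supportY (μZ : Measure 𝒵) (Q : Kernel 𝒵 𝒳) (R : Kernel (𝒵 × 𝒳) 𝒴) : Set 𝒴 :=
  {y | lawY μZ Q R {y} ≠ 0}

/-- The normalizing constant `1 - 1/|𝒴|`, with `|𝒴|` the support size of `Y`. It is `1` when the
support is infinite, because then `Set.ncard` is `0` and `0⁻¹ = 0`. -/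
def normConst (μZ : Measure 𝒵) (Q : Kernel 𝒵 𝒳) (R : Kernel (𝒵 × 𝒳) 𝒴) : ℝ :=
  1 - ((supportY μZ Q R).ncard : ℝ)⁻¹

/-- Total variation distance of two probability measures on a countable discrete space: half the
`L¹` distance of the probability mass functions. -/
def tvDist (P P' : Measure 𝒴) : ℝ := (1 / 2) * ∑' y, |P.real {y} - P'.real {y}|

/-- The expected total variation
`(1 - 1/|𝒴|)⁻¹ * E[TV(L(Y | X, Z), L(Y | Z))]`. -/
def ETV (μZ : Measure 𝒵) (Q : Kernel 𝒵 𝒳) (R : Kernel (𝒵 × 𝒳) 𝒴) : ℝ :=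
  (∫ t, tvDist (R t) (condYZ Q R t.1) ∂(μZ ⊗ₘ Q)) / normConst μZ Q R

open Classical in
/-- The oracle classifier `𝟙(p(y | x, z) > p(y | z))`. -/
def oracle (Q : Kernel 𝒵 𝒳) (R : Kernel (𝒵 × 𝒳) 𝒴) (t : 𝒳 × 𝒴 × 𝒵) : ℝ :=
  if (condYZ Q R t.2.2).real {t.2.1} < (R (t.2.2, t.1)).real {t.2.1} then 1 else 0

/-! ### Observations together with the resampled covariates -/

/-- An observation with its `J` resamples: `(X, (X⁽¹⁾, …, X⁽ᴶ⁾), Y, Z)`. -/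
abbrev Obs (𝒳 𝒴 𝒵 : Type*) (J : ℕ) : Type _ := 𝒳 × (Fin J → 𝒳) × 𝒴 × 𝒵

/-- `J` i.i.d. draws from `L(X | Z = z)`. -/
def resample (Q : Kernel 𝒵 𝒳) [IsMarkovKernel Q] (J : ℕ) : Kernel 𝒵 (Fin J → 𝒳) where
  toFun z := Measure.pi fun _ => Q z
  measurable' := by
    refine Measurable.measure_of_isPiSystem_of_isProbabilityMeasure
      generateFrom_pi.symm isPiSystem_pi ?_
    rintro _ ⟨s, hs, rfl⟩
    simp only [Set.mem_univ_pi, Set.mem_ofPred_eq] at hs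
    simp only [Measure.pi_pi]
    exact Finset.measurable_prod _ fun i _ => Q.measurable_coe (hs i)

/-- The law of `(X, X⁽¹⁾, …, X⁽ᴶ⁾, Y, Z)`: `Z ~ μZ`, `X | Z ~ Q`, `Y | (Z, X) ~ R`, and given
`(X, Y, Z)` the resamples are i.i.d. from `L(X | Z)`. -/
def obsLaw (μZ : Measure 𝒵) (Q : Kernel 𝒵 𝒳) [IsMarkovKernel Q] (R : Kernel (𝒵 × 𝒳) 𝒴)
    (J : ℕ) : Measure (Obs 𝒳 𝒴 𝒵 J) :=
  (μZ ⊗ₘ ((Q ⊗ₖ R) ×ₖ resample Q J)).map fun t => (t.2.1.1, t.2.2, t.2.1.2, t.1)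

/-- The loss of a classifier `g` at an observation:
`|g(x, y, z) - 1| + (1/J) ∑ⱼ |g(x⁽ʲ⁾, y, z)|`. -/
def loss {J : ℕ} (g : 𝒳 × 𝒴 × 𝒵 → ℝ) (w : Obs 𝒳 𝒴 𝒵 J) : ℝ :=
  |g (w.1, w.2.2.1, w.2.2.2) - 1| + (1 / (J : ℝ)) * ∑ j, |g (w.2.1 j, w.2.2.1, w.2.2.2)|

/-! ### Cross-validation -/

/-- The `r`-th evaluation fold of a fold assignment. -/
def fold {n k : ℕ} (a : Fin n → Fin k) (r : Fin k) : Finset (Fin n) :=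
  Finset.univ.filter fun i => a i = r

/-- The indices of the `r`-th training set: the complement of the `r`-th evaluation fold. -/
def trainIdx {n k : ℕ} (a : Fin n → Fin k) (r : Fin k) : Finset (Fin n) :=
  Finset.univ.filter fun i => a i ≠ r

/-- The fold assignments whose fold sizes differ by at most one. -/
def balanced (n k : ℕ) : Set (Fin n → Fin k) :=
  {a | ∀ r s, (fold a r).card ≤ (fold a s).card + 1}

/-- A sample of size `n` with a partition of it into `k` folds. -/
abbrev Sample (𝒳 𝒴 𝒵 : Type*) (J n k : ℕ) : Type _ := (Fin n → Obs 𝒳 𝒴 𝒵 J) × (Fin n → Fin k)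

/-- `n` i.i.d. observations and, independently, a uniformly random partition of the indices into
`k` folds with sizes differing by at most one. -/
def sampleLaw (μZ : Measure 𝒵) (Q : Kernel 𝒵 𝒳) [IsMarkovKernel Q] (R : Kernel (𝒵 × 𝒳) 𝒴)
    (J k n : ℕ) : Measure (Sample 𝒳 𝒴 𝒵 J n k) :=
  (Measure.pi fun _ : Fin n => obsLaw μZ Q R J).prod (uniformOn (balanced n k))

/-- A classifier training rule: for every training set (of any size) a classifier. -/
abbrev Rule (𝒳 𝒴 𝒵 : Type*) (J : ℕ) : Type _ :=
  (N : ℕ) → (Fin N → Obs 𝒳 𝒴 𝒵 J) → 𝒳 × 𝒴 × 𝒵 → ℝ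

/-- The rule is jointly measurable and its classifiers take values in `[0, 1]`. -/
structure IsRule {J : ℕ} (f : Rule 𝒳 𝒴 𝒵 J) : Prop where
  measurable : ∀ N, Measurable fun p : (Fin N → Obs 𝒳 𝒴 𝒵 J) × (𝒳 × 𝒴 × 𝒵) => f N p.1 p.2
  mem_Icc : ∀ N d t, f N d t ∈ Set.Icc (0 : ℝ) 1

variable {J n k : ℕ}

/-- The classifier trained on the `r`-th training set (listed in increasing order of index). -/
def trained (f : Rule 𝒳 𝒴 𝒵 J) (ω : Sample 𝒳 𝒴 𝒵 J n k) (r : Fin k) : 𝒳 × 𝒴 × 𝒵 → ℝ :=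
  f (trainIdx ω.2 r).card fun j => ω.1 ((trainIdx ω.2 r).orderEmbOfFin rfl j)

/-- Sample mean of the losses over the `r`-th evaluation fold. -/
def foldMean (f : Rule 𝒳 𝒴 𝒵 J) (ω : Sample 𝒳 𝒴 𝒵 J n k) (r : Fin k) : ℝ :=
  (∑ i ∈ fold ω.2 r, loss (trained f ω r) (ω.1 i)) / (fold ω.2 r).card

/-- Sample variance of the losses over the `r`-th evaluation fold
(mean of the squares minus square of the mean). -/
def foldVar (f : Rule 𝒳 𝒴 𝒵 J) (ω : Sample 𝒳 𝒴 𝒵 J n k) (r : Fin k) : ℝ :=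
  (∑ i ∈ fold ω.2 r, loss (trained f ω r) (ω.1 i) ^ 2) / (fold ω.2 r).card - foldMean f ω r ^ 2

/-- The cross-validated floodgate lower confidence bound
`max(0, (1 - μ̂ - z σ̂ / √n) / (1 - 1/|𝒴|))`; the argument `c` is `1 - 1/|𝒴|`. -/
def lowerBound (c z : ℝ) (f : Rule 𝒳 𝒴 𝒵 J) (ω : Sample 𝒳 𝒴 𝒵 J n k) : ℝ :=
  max 0 ((1 - (∑ r, foldMean f ω r) / k - z * √((∑ r, foldVar f ω r) / k) / √(n : ℝ)) / c)

/-! ### The quantities in the assumptions -/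

/-- The averaged loss `h̄ₙ(w) = E_{B₁}[hₙ(w; B₁)]`. -/
def avgLoss (μZ : Measure 𝒵) (Q : Kernel 𝒵 𝒳) [IsMarkovKernel Q] (R : Kernel (𝒵 × 𝒳) 𝒴)
    (k : ℕ) [NeZero k] (f : Rule 𝒳 𝒴 𝒵 J) (n : ℕ) (w : Obs 𝒳 𝒴 𝒵 J) : ℝ :=
  ∫ ω, loss (trained f ω 0) w ∂(sampleLaw μZ Q R J k n)

/-- The centered averaged loss `h̄ₙ(w) - E[h̄ₙ(W)]`. -/
def centeredAvgLoss (μZ : Measure 𝒵) (Q : Kernel 𝒵 𝒳) [IsMarkovKernel Q]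
    (R : Kernel (𝒵 × 𝒳) 𝒴) (k : ℕ) [NeZero k] (f : Rule 𝒳 𝒴 𝒵 J) (n : ℕ)
    (w : Obs 𝒳 𝒴 𝒵 J) : ℝ :=
  avgLoss μZ Q R k f n w - ∫ w', avgLoss μZ Q R k f n w' ∂(obsLaw μZ Q R J)

/-- `σₙ`, the standard deviation of `h̄ₙ(W)`. -/
def sigma (μZ : Measure 𝒵) (Q : Kernel 𝒵 𝒳) [IsMarkovKernel Q] (R : Kernel (𝒵 × 𝒳) 𝒴)
    (k : ℕ) [NeZero k] (f : Rule 𝒳 𝒴 𝒵 J) (n : ℕ) : ℝ :=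
  √(variance (avgLoss μZ Q R k f n) (obsLaw μZ Q R J))

/-- The remainder in the asymptotic linearity condition:
`(σₙ √n)⁻¹ ∑ᵣ ∑_{i ∈ fold r} (hₙ(Wᵢ; Bᵣ) - E[hₙ(Wᵢ; Bᵣ) | Bᵣ] - (h̄ₙ(Wᵢ) - E[h̄ₙ(Wᵢ)]))`.
As `Wᵢ` is independent of the training set `Bᵣ`, the conditional expectation is the integral of
`hₙ(·; Bᵣ)` against the law of one observation. -/
def linearityRemainder (μZ : Measure 𝒵) (Q : Kernel 𝒵 𝒳) [IsMarkovKernel Q]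
    (R : Kernel (𝒵 × 𝒳) 𝒴) [NeZero k] (f : Rule 𝒳 𝒴 𝒵 J) (ω : Sample 𝒳 𝒴 𝒵 J n k) : ℝ :=
  1 / (sigma μZ Q R k f n * √(n : ℝ)) * ∑ r, ∑ i ∈ fold ω.2 r,
    (loss (trained f ω r) (ω.1 i) - ∫ w, loss (trained f ω r) w ∂(obsLaw μZ Q R J)
      - centeredAvgLoss μZ Q R k f n (ω.1 i))

end

end Floodgate

/-!
# Coverage of the cross-validated floodgate lower confidence bound

**Population.** Given `(Z, X)`, one minus the risk of a classifier is the difference of its means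
under `L(Y | X, Z)` and `L(Y | Z)`, because given `Z` a resample is independent of `Y`. Hence it is
at most the expected total variation, with equality for the oracle (`one_sub_integral_loss_le`,
`one_sub_integral_loss_oracle`). So `ETV` is covered as soon as the upper confidence bound for the
risk exceeds the average risk of the `k` trained classifiers, and for the oracle these two events
are the same.

**Normal approximation.** Up to the effect of unequal fold sizes, `√n` times the deviation of the
cross-validated risk from the average risk is `n^{-1/2} ∑ᵢ c(Wᵢ)`, with `c` the centered averaged
loss, plus the remainder of the asymptotic linearity condition (`LossFamily.l2_deviation_sub_le`).
The losses are bounded, so uniform integrability keeps `σₙ` away from zero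
(`exists_pos_le_of_uniformIntegrable`). The central limit theorem for bounded triangular arrays
(`tendsto_sumLaw`) and Slutsky's lemma (`tendsto_tail_add`) then reduce the claim to the consistency
of the variance estimate, which requires that the residuals `D_B(w) = ℓ(f_B; w) - E ℓ(f_B; W) - c(w)`
tend to zero in mean square (`LossFamily.integral_abs_evalVar_sub_le`).

**Stability.** This stability of the training is not an assumption; it is derived from asymptotic
linearity (`exists_stability_threshold`, `tendsto_integral_sq_l2`). By bounds on fourth moments, the
normalized sum `S = n^{-1/2} ∑ᵣ ∑_{i ∈ fold r} D_{Bᵣ}(Wᵢ)` tends to zero in `L²`. This does not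
settle the matter, since the sums over different folds could cancel. To exclude this, the
conditional expectation of `D_{Bᵣ}` given a set `T` of training observations is considered.

* If `T` is contained in one other fold, conditioning on two folds isolates two sums that nearly
  cancel. As the second sum is additive over blocks of its own fold, so is nearly the kernel of the
  first. But a bounded function that is nearly a sum over `L` i.i.d. blocks has blocks of variance
  `O(L⁻²)`, as a comparison of exponential moments shows, while cancellation requires variance of
  order `L⁻¹` unless the kernels are small (`exists_twoFold_threshold`).
* For larger `T`, testing `S` against the sum over fold `r` shows that the conditional expectation
  is small if it is small for sets which lack half of the part of `T` in one of the folds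
  (`CenteredFamily.card_mul_sq_l2_kcexp_le`). Averaged over the random partition, only the size of
  `T` matters, and finitely many such steps, in number depending on `k` only, reach the complete
  training set (`exists_energy_le_of_card_add_le`).

For `k = 1` the training set is empty and there are no residuals.
-/

set_option linter.unusedSectionVars false

namespace Floodgate

/-! ### Bounded measurable functions and their `L²` norms -/

/-- Bounded measurable real functions: a class closed under all operations used below, on which
every integral against a finite measure converges. -/
structure BddMeas {α : Type*} [MeasurableSpace α] (G : α → ℝ) : Prop where
  measurable : Measurable G
  bdd : ∃ C, ∀ x, |G x| ≤ C

namespace BddMeas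

variable {α β : Type*} [MeasurableSpace α] [MeasurableSpace β] {G K : α → ℝ}

lemma const (c : ℝ) : BddMeas fun _ : α => c := ⟨measurable_const, |c|, fun _ => le_rfl⟩

lemma add (hG : BddMeas G) (hK : BddMeas K) : BddMeas fun x => G x + K x := by
  obtain ⟨hG, C, hC⟩ := hG
  obtain ⟨hK, C', hC'⟩ := hK
  exact ⟨hG.add hK, C + C', fun x => (abs_add_le _ _).trans (add_le_add (hC x) (hC' x))⟩

lemma mul (hG : BddMeas G) (hK : BddMeas K) : BddMeas fun x => G x * K x := by
  obtain ⟨hG, C, hC⟩ := hG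
  obtain ⟨hK, C', hC'⟩ := hK
  refine ⟨hG.mul hK, C * C', fun x => ?_⟩
  rw [abs_mul]
  exact mul_le_mul (hC x) (hC' x) (abs_nonneg _) ((abs_nonneg _).trans (hC x))

lemma const_mul (hG : BddMeas G) (c : ℝ) : BddMeas fun x => c * G x := (const c).mul hG

lemma neg (hG : BddMeas G) : BddMeas fun x => - G x := by
  simpa using hG.const_mul (-1)

lemma sub (hG : BddMeas G) (hK : BddMeas K) : BddMeas fun x => G x - K x := by
  simpa [sub_eq_add_neg] using hG.add hK.neg

lemma pow (hG : BddMeas G) (m : ℕ) : BddMeas fun x => G x ^ m := by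
  induction m with
  | zero => simpa using const (α := α) 1
  | succ m ih => simpa [pow_succ] using ih.mul hG

lemma abs (hG : BddMeas G) : BddMeas fun x => |G x| := by
  obtain ⟨hG, C, hC⟩ := hG
  exact ⟨hG.abs, C, fun x => by simpa using hC x⟩

lemma sum {κ : Type*} (s : Finset κ) {F : κ → α → ℝ} (hF : ∀ i ∈ s, BddMeas (F i)) :
    BddMeas fun x => ∑ i ∈ s, F i x := by
  classical
  induction s using Finset.induction_on with
  | empty => simpa using const (α := α) 0
  | insert i s hi ih =>
    simp_rw [Finset.sum_insert hi]
    exact (hF i (by simp)).add (ih fun j hj => hF j (by simp [hj]))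

lemma comp (hG : BddMeas G) {φ : β → α} (hφ : Measurable φ) : BddMeas fun x => G (φ x) := by
  obtain ⟨hG, C, hC⟩ := hG
  exact ⟨hG.comp hφ, C, fun x => hC _⟩

lemma exp (hG : BddMeas G) : BddMeas fun x => Real.exp (G x) := by
  obtain ⟨hG, C, hC⟩ := hG
  refine ⟨hG.exp, Real.exp C, fun x => ?_⟩
  rw [abs_of_pos (Real.exp_pos _)]
  exact Real.exp_le_exp.2 ((le_abs_self _).trans (hC x))

lemma integrable (hG : BddMeas G) (μ : Measure α) [IsFiniteMeasure μ] : Integrable G μ := by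
  obtain ⟨hG, C, hC⟩ := hG
  exact Integrable.of_bound hG.aestronglyMeasurable C (ae_of_all _ hC)

/-- Integrating out one variable keeps a function bounded and measurable. -/
lemma integral_right {F : α × β → ℝ} (hF : BddMeas F) (ν : Measure β) [IsProbabilityMeasure ν] :
    BddMeas fun x => ∫ y, F (x, y) ∂ν := by
  obtain ⟨hF, C, hC⟩ := hF
  refine ⟨(hF.stronglyMeasurable.integral_prod_right' (ν := ν)).measurable, C, fun x => ?_⟩
  simpa using norm_integral_le_of_norm_le_const (μ := ν) (f := fun y => F (x, y))
    (ae_of_all _ fun y => hC (x, y))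

lemma integral_left {F : α × β → ℝ} (hF : BddMeas F) (μ : Measure α) [IsProbabilityMeasure μ] :
    BddMeas fun y => ∫ x, F (x, y) ∂μ :=
  integral_right (hF.comp measurable_swap) μ

end BddMeas

lemma abs_integral_le_of_abs_le {α : Type*} [MeasurableSpace α] {μ : Measure α}
    [IsProbabilityMeasure μ] {G : α → ℝ} {C : ℝ} (h : ∀ x, |G x| ≤ C) : |∫ x, G x ∂μ| ≤ C := by
  simpa using norm_integral_le_of_norm_le_const (μ := μ) (f := G) (ae_of_all _ h)

section L2

variable {α β : Type*} [MeasurableSpace α] [MeasurableSpace β] {μ : Measure α}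
  {ν : Measure β} {G K : α → ℝ}

/-- The `L²` norm of a (bounded measurable) function. -/
noncomputable def l2 (μ : Measure α) (G : α → ℝ) : ℝ := √(∫ x, G x ^ 2 ∂μ)

lemma l2_nonneg : 0 ≤ l2 μ G := Real.sqrt_nonneg _

lemma l2_sq : l2 μ G ^ 2 = ∫ x, G x ^ 2 ∂μ :=
  Real.sq_sqrt (integral_nonneg fun _ => sq_nonneg _)

/-- **Cauchy-Schwarz inequality**. -/
lemma abs_integral_mul_le_l2 [IsFiniteMeasure μ] (hG : BddMeas G) (hK : BddMeas K) :
    |∫ x, G x * K x ∂μ| ≤ l2 μ G * l2 μ K := by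
  have key : ∀ t : ℝ, 0 ≤ (∫ x, G x ^ 2 ∂μ) * (t * t) + (2 * ∫ x, G x * K x ∂μ) * t
      + ∫ x, K x ^ 2 ∂μ := by
    intro t
    have h : ∫ x, (t * G x + K x) ^ 2 ∂μ = (∫ x, G x ^ 2 ∂μ) * (t * t)
        + (2 * ∫ x, G x * K x ∂μ) * t + ∫ x, K x ^ 2 ∂μ := by
      have e : ∀ x, (t * G x + K x) ^ 2 = (t * t) * G x ^ 2 + (2 * t) * (G x * K x) + K x ^ 2 :=
        fun x => by ring
      simp_rw [e]
      rw [integral_add ((((hG.pow 2).const_mul _).add ((hG.mul hK).const_mul _)).integrable μ)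
        ((hK.pow 2).integrable μ), integral_add (((hG.pow 2).const_mul _).integrable μ)
        (((hG.mul hK).const_mul _).integrable μ), integral_const_mul, integral_const_mul]
      ring
    rw [← h]
    exact integral_nonneg fun _ => sq_nonneg _
  have h := discrim_le_zero key
  rw [discrim] at h
  rw [l2, l2, ← Real.sqrt_mul (integral_nonneg fun _ => sq_nonneg _)]
  apply Real.abs_le_sqrt
  linarith

lemma l2_add_le [IsFiniteMeasure μ] (hG : BddMeas G) (hK : BddMeas K) :
    l2 μ (fun x => G x + K x) ≤ l2 μ G + l2 μ K := by
  apply abs_le_of_sq_le_sq' _ (add_nonneg l2_nonneg l2_nonneg) |>.2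
  have e : ∀ x, (G x + K x) ^ 2 = G x ^ 2 + 2 * (G x * K x) + K x ^ 2 := fun x => by ring
  rw [l2_sq]
  simp_rw [e]
  rw [integral_add (((hG.pow 2).add ((hG.mul hK).const_mul _)).integrable μ)
    ((hK.pow 2).integrable μ), integral_add ((hG.pow 2).integrable μ)
    (((hG.mul hK).const_mul _).integrable μ), integral_const_mul, ← l2_sq, ← l2_sq]
  nlinarith [le_abs_self (∫ x, G x * K x ∂μ), abs_integral_mul_le_l2 (μ := μ) hG hK]

lemma l2_const_mul (c : ℝ) : l2 μ (fun x => c * G x) = |c| * l2 μ G := by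
  simp_rw [l2, mul_pow]
  rw [integral_const_mul, Real.sqrt_mul (sq_nonneg c), Real.sqrt_sq_eq_abs]

lemma l2_neg : l2 μ (fun x => - G x) = l2 μ G := by simp [l2]

lemma l2_sub_le [IsFiniteMeasure μ] (hG : BddMeas G) (hK : BddMeas K) :
    l2 μ (fun x => G x - K x) ≤ l2 μ G + l2 μ K := by
  simpa [sub_eq_add_neg, l2_neg] using l2_add_le (μ := μ) hG hK.neg

lemma l2_sum_le [IsFiniteMeasure μ] {κ : Type*} (s : Finset κ) {F : κ → α → ℝ}
    (hF : ∀ i ∈ s, BddMeas (F i)) :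
    l2 μ (fun x => ∑ i ∈ s, F i x) ≤ ∑ i ∈ s, l2 μ (F i) := by
  classical
  induction s using Finset.induction_on with
  | empty => simp [l2]
  | insert i s hi ih =>
    simp_rw [Finset.sum_insert hi]
    have h := fun j hj => hF j (Finset.mem_insert_of_mem hj)
    exact (l2_add_le (hF i (by simp)) (BddMeas.sum s h)).trans (by gcongr; exact ih h)

lemma l2_le_of_abs_le [IsProbabilityMeasure μ] {C : ℝ} (h : ∀ x, |G x| ≤ C) : l2 μ G ≤ C := by
  obtain ⟨x⟩ : Nonempty α := by
    by_contra hne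
    rw [not_nonempty_iff] at hne
    exact IsProbabilityMeasure.ne_zero μ (Measure.eq_zero_of_isEmpty μ)
  have hC : 0 ≤ C := (abs_nonneg _).trans (h x)
  apply abs_le_of_sq_le_sq' _ hC |>.2
  rw [l2_sq]
  refine (le_abs_self _).trans (abs_integral_le_of_abs_le fun x => ?_)
  rw [abs_of_nonneg (sq_nonneg _), ← sq_abs]
  exact pow_le_pow_left₀ (abs_nonneg _) (h x) 2

/-- The `L¹` norm is at most the `L²` norm. -/
lemma integral_abs_le_l2 [IsProbabilityMeasure μ] (hG : BddMeas G) : ∫ x, |G x| ∂μ ≤ l2 μ G := by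
  have h := abs_integral_mul_le_l2 (μ := μ) hG.abs (BddMeas.const 1)
  have h1 : l2 μ (fun _ : α => (1 : ℝ)) = 1 := by simp [l2]
  have h2 : l2 μ (fun x => |G x|) = l2 μ G := by simp [l2]
  rw [h1, h2, mul_one] at h
  simpa using (le_abs_self _).trans h

lemma integral_comp_of_measurePreserving {φ : α → β} (hφ : MeasurePreserving φ μ ν) {F : β → ℝ}
    (hF : BddMeas F) : ∫ x, F (φ x) ∂μ = ∫ y, F y ∂ν := by
  rw [← hφ.map_eq, integral_map hφ.measurable.aemeasurable hF.measurable.aestronglyMeasurable]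

lemma l2_comp_of_measurePreserving {φ : α → β} (hφ : MeasurePreserving φ μ ν) {F : β → ℝ}
    (hF : BddMeas F) : l2 μ (fun x => F (φ x)) = l2 ν F := by
  rw [l2, l2, integral_comp_of_measurePreserving hφ (hF.pow 2)]

end L2

/-! ### Independent coordinates: splicing two samples and conditional expectations -/

section Pi

variable {Ω : Type*} [MeasurableSpace Ω] (P : Measure Ω) [IsProbabilityMeasure P]
  {ι : Type*} [Fintype ι] [DecidableEq ι]

/-- The law of an i.i.d. family indexed by `ι`. -/
noncomputable abbrev iid (P : Measure Ω) (ι : Type*) [Fintype ι] : Measure (ι → Ω) :=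
  Measure.pi fun _ : ι => P

lemma measurable_piecewise_prod (T : Finset ι) :
    Measurable fun p : (ι → Ω) × (ι → Ω) => T.piecewise p.1 p.2 := by
  refine measurable_pi_lambda _ fun i => ?_
  by_cases hi : i ∈ T
  · simpa [hi, Function.comp_def] using (measurable_pi_apply i).comp measurable_fst
  · simpa [hi, Function.comp_def] using (measurable_pi_apply i).comp measurable_snd

/-- Taking the coordinates in `T` from one sample and the others from an independent one gives
again an i.i.d. sample. -/
lemma measurePreserving_piecewise (T : Finset ι) :
    MeasurePreserving (fun p : (ι → Ω) × (ι → Ω) => T.piecewise p.1 p.2)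
      ((iid P ι).prod (iid P ι)) (iid P ι) := by
  refine ⟨measurable_piecewise_prod T, ?_⟩
  symm
  refine Measure.pi_eq fun s hs => ?_
  rw [Measure.map_apply (measurable_piecewise_prod T) (MeasurableSet.univ_pi hs)]
  have e : (fun p : (ι → Ω) × (ι → Ω) => T.piecewise p.1 p.2) ⁻¹' (Set.univ.pi s)
      = (Set.univ.pi fun i => if i ∈ T then s i else Set.univ) ×ˢ
        (Set.univ.pi fun i => if i ∈ T then Set.univ else s i) := by
    ext p
    simp only [Set.mem_preimage, Set.mem_pi, Set.mem_univ, true_imp_iff, Set.mem_prod]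
    rw [← forall_and]
    refine forall_congr' fun i => ?_
    by_cases hi : i ∈ T <;> simp [hi]
  rw [e, Measure.prod_prod, Measure.pi_pi, Measure.pi_pi, ← Finset.prod_mul_distrib]
  refine Finset.prod_congr rfl fun i _ => ?_
  by_cases hi : i ∈ T <;> simp [hi]

lemma measurable_update_prod (j : ι) :
    Measurable fun p : Ω × (ι → Ω) => Function.update p.2 j p.1 := by
  refine measurable_pi_lambda _ fun i => ?_
  by_cases hi : i = j
  · subst hi; simpa using measurable_fst
  · simpa [hi, Function.comp_def] using (measurable_pi_apply i).comp measurable_snd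

lemma measurePreserving_update (j : ι) :
    MeasurePreserving (fun p : Ω × (ι → Ω) => Function.update p.2 j p.1)
      (P.prod (iid P ι)) (iid P ι) := by
  refine ⟨measurable_update_prod j, ?_⟩
  symm
  refine Measure.pi_eq fun s hs => ?_
  rw [Measure.map_apply (measurable_update_prod j) (MeasurableSet.univ_pi hs)]
  have e : (fun p : Ω × (ι → Ω) => Function.update p.2 j p.1) ⁻¹' (Set.univ.pi s)
      = s j ×ˢ (Set.univ.pi fun i => if i = j then Set.univ else s i) := by
    ext p
    simp only [Set.mem_preimage, Set.mem_pi, Set.mem_univ, true_imp_iff, Set.mem_prod]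
    constructor
    · intro h
      refine ⟨by simpa using h j, fun i => ?_⟩
      by_cases hi : i = j
      · simp [hi]
      · simpa [hi] using h i
    · rintro ⟨h1, h2⟩ i
      by_cases hi : i = j
      · subst hi; simpa using h1
      · simpa [hi] using h2 i
  rw [e, Measure.prod_prod, Measure.pi_pi, ← Finset.mul_prod_erase _ _ (Finset.mem_univ j),
    ← Finset.mul_prod_erase _ (fun i => P (s i)) (Finset.mem_univ j)]
  simp only [if_true, measure_univ, one_mul]
  congr 1
  exact Finset.prod_congr rfl fun i hi => by rw [if_neg (Finset.ne_of_mem_erase hi)]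

/-- If `G w` does not depend on the `j`-th observation, that observation may be inserted for `w`:
it is independent of `G`. -/
lemma integral_insert_coord {G : Ω × (ι → Ω) → ℝ} (hG : BddMeas G) {B : Finset ι} {j : ι}
    (hB : ∀ w, DependsOn (fun W => G (w, W)) B) (hj : j ∉ B) :
    ∫ W, G (W j, W) ∂(iid P ι) = ∫ p, G p ∂(P.prod (iid P ι)) := by
  have hm : Measurable fun W : ι → Ω => (W j, W) := (measurable_pi_apply j).prodMk measurable_id
  rw [← integral_comp_of_measurePreserving (measurePreserving_update P j) (hG.comp hm)]
  refine integral_congr_ae (ae_of_all _ fun p => ?_)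
  simp only [Function.update_self]
  exact hB p.1 fun i hi => Function.update_of_ne (fun h => hj (by simpa [← h] using hi)) _ _

/-- The conditional expectation of a function of an i.i.d. sample given the coordinates in `T`:
the other coordinates are integrated out. -/
noncomputable def cexp (T : Finset ι) (G : (ι → Ω) → ℝ) (W : ι → Ω) : ℝ :=
  ∫ W', G (T.piecewise W W') ∂(iid P ι)

variable {P}
variable {G K : (ι → Ω) → ℝ} {S T : Finset ι}

lemma BddMeas.cexp (hG : BddMeas G) : BddMeas (cexp P T G) :=
  BddMeas.integral_right (F := fun p => G (T.piecewise p.1 p.2))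
    (hG.comp (measurable_piecewise_prod T)) (iid P ι)

lemma dependsOn_cexp : DependsOn (cexp P T G) T := by
  intro W W' h
  unfold cexp
  congr 1
  ext V
  congr 1
  ext i
  by_cases hi : i ∈ T
  · simp [hi, h i hi]
  · simp [hi]

lemma cexp_eq_self (hG : DependsOn G T) : cexp P T G = G := by
  ext W
  unfold cexp
  rw [integral_congr_ae (g := fun _ => G W)]
  · simp
  · refine ae_of_all _ fun W' => hG fun i hi => ?_
    simp [Finset.mem_coe.1 hi]

/-- The defining property of the conditional expectation. -/
lemma integral_mul_cexp (hG : BddMeas G) (hK : BddMeas K) (hKT : DependsOn K T) :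
    ∫ W, K W * cexp P T G W ∂(iid P ι) = ∫ W, K W * G W ∂(iid P ι) := by
  rw [← integral_comp_of_measurePreserving (measurePreserving_piecewise P T) (hK.mul hG),
    integral_prod]
  · refine integral_congr_ae (ae_of_all _ fun W => ?_)
    simp only [cexp]
    rw [← integral_const_mul]
    refine integral_congr_ae (ae_of_all _ fun W' => ?_)
    simp only
    congr 1
    exact hKT fun i hi => by simp [Finset.mem_coe.1 hi]
  · exact ((hK.mul hG).comp (measurable_piecewise_prod T)).integrable _

/-- Conditional expectation is a contraction of `L²`. -/
lemma l2_cexp_le (hG : BddMeas G) : l2 (iid P ι) (cexp P T G) ≤ l2 (iid P ι) G := by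
  have h := integral_mul_cexp (P := P) hG (hG.cexp (P := P) (T := T)) dependsOn_cexp
  simp_rw [← pow_two] at h
  rw [← l2_sq] at h
  have h2 := (le_abs_self _).trans
    (abs_integral_mul_le_l2 (μ := iid P ι) (hG.cexp (P := P) (T := T)) hG)
  rw [← h, pow_two] at h2
  rcases (l2_nonneg (μ := iid P ι) (G := cexp P T G)).eq_or_lt with h0 | h0
  · rw [← h0]; exact l2_nonneg
  · exact le_of_mul_le_mul_left h2 h0

/-- The tower property, for coordinate sets that need not be nested. -/
lemma cexp_cexp (hG : BddMeas G) : cexp P S (cexp P T G) = cexp P (S ∩ T) G := by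
  ext W
  have hmp := measurePreserving_piecewise (ι := ι) P T
  unfold cexp
  have hG' : BddMeas fun V : ι → Ω => G ((S ∩ T).piecewise W V) :=
    hG.comp ((measurable_piecewise_prod (S ∩ T)).comp measurable_prodMk_left)
  rw [← integral_comp_of_measurePreserving hmp hG', integral_prod]
  · refine integral_congr_ae (ae_of_all _ fun W' => integral_congr_ae (ae_of_all _ fun W'' => ?_))
    simp only
    congr 1
    ext i
    by_cases h1 : i ∈ S <;> by_cases h2 : i ∈ T <;> simp [h1, h2]
  · exact (hG'.comp hmp.measurable).integrable _

end Pi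

/-! ### Cross-validated sums of centered kernels -/

section Kernels

variable {Ω : Type*} [MeasurableSpace Ω] {P : Measure Ω} [IsProbabilityMeasure P]
  {ι : Type*} [Fintype ι] [DecidableEq ι]

/-- The conditional expectation of `D(w; W)` given the fresh point `w` and the coordinates `T`
of the sample `W`. -/
noncomputable def kcexp (P : Measure Ω) (T : Finset ι) (D : Ω × (ι → Ω) → ℝ)
    (p : Ω × (ι → Ω)) : ℝ :=
  cexp P T (fun W => D (p.1, W)) p.2

variable {D : Ω × (ι → Ω) → ℝ} {A B S T : Finset ι}

lemma BddMeas.kcexp (hD : BddMeas D) : BddMeas (kcexp P T D) := by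
  have h : Measurable fun q : (Ω × (ι → Ω)) × (ι → Ω) =>
      (q.1.1, T.piecewise q.1.2 q.2) :=
    (measurable_fst.comp measurable_fst).prodMk ((measurable_piecewise_prod T).comp
      ((measurable_snd.comp measurable_fst).prodMk measurable_snd))
  exact BddMeas.integral_right (F := fun q : (Ω × (ι → Ω)) × (ι → Ω) =>
    D (q.1.1, T.piecewise q.1.2 q.2)) (hD.comp h) (iid P ι)

lemma BddMeas.section_right (hD : BddMeas D) (w : Ω) : BddMeas fun W => D (w, W) :=
  hD.comp measurable_prodMk_left

lemma abs_kcexp_le {C : ℝ} (h : ∀ p, |D p| ≤ C) (p : Ω × (ι → Ω)) : |kcexp P T D p| ≤ C :=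
  abs_integral_le_of_abs_le fun _ => h _

lemma dependsOn_kcexp (w : Ω) : DependsOn (fun W => kcexp P T D (w, W)) T :=
  dependsOn_cexp (P := P) (T := T) (G := fun W => D (w, W))

lemma kcexp_eq_self (hB : ∀ w, DependsOn (fun W => D (w, W)) B) : kcexp P B D = D := by
  ext p
  exact congrFun (cexp_eq_self (P := P) (hB p.1)) p.2

lemma kcexp_kcexp (hD : BddMeas D) : kcexp P S (kcexp P T D) = kcexp P (S ∩ T) D := by
  ext p
  exact congrFun (cexp_cexp (P := P) (S := S) (T := T) (hD.section_right p.1)) p.2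

lemma integral_kcexp_eq_zero (hD : BddMeas D) (hc : ∀ W, ∫ w, D (w, W) ∂P = 0) (W : ι → Ω) :
    ∫ w, kcexp P T D (w, W) ∂P = 0 := by
  unfold kcexp cexp
  rw [integral_integral_swap]
  · simp [hc]
  · have h : Measurable fun q : Ω × (ι → Ω) => (q.1, T.piecewise W q.2) :=
      measurable_fst.prodMk ((measurable_piecewise_prod T).comp
        (measurable_const.prodMk measurable_snd))
    exact (hD.comp h).integrable _

lemma l2_kcexp_le (hD : BddMeas D) :
    l2 (P.prod (iid P ι)) (kcexp P T D) ≤ l2 (P.prod (iid P ι)) D := by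
  apply Real.sqrt_le_sqrt
  rw [integral_prod _ ((hD.kcexp.pow 2).integrable _), integral_prod _ ((hD.pow 2).integrable _)]
  refine integral_mono ((hD.kcexp.pow 2).integral_right _ |>.integrable _)
    ((hD.pow 2).integral_right _ |>.integrable _) fun w => ?_
  have h := pow_le_pow_left₀ l2_nonneg (l2_cexp_le (P := P) (T := T) (hD.section_right w)) 2
  rwa [l2_sq, l2_sq] at h

/-- More information means a larger conditional expectation in `L²`. -/
lemma l2_kcexp_mono (hD : BddMeas D) (hST : S ⊆ T) :
    l2 (P.prod (iid P ι)) (kcexp P S D) ≤ l2 (P.prod (iid P ι)) (kcexp P T D) := by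
  have h := l2_kcexp_le (P := P) (T := S) (hD.kcexp (P := P) (T := T))
  rwa [kcexp_kcexp hD, Finset.inter_eq_left.2 hST] at h

lemma measurable_coord_prod (j : ι) : Measurable fun W : ι → Ω => (W j, W) :=
  (measurable_pi_apply j).prodMk measurable_id

lemma BddMeas.sum_coord (hD : BddMeas D) (A : Finset ι) :
    BddMeas fun W : ι → Ω => ∑ i ∈ A, D (W i, W) :=
  BddMeas.sum A fun i _ => hD.comp (measurable_coord_prod i)

/-- A centered kernel evaluated at a fresh coordinate is orthogonal to everything that does not
involve this coordinate. -/
lemma integral_centered_mul_eq_zero (hD : BddMeas D) (hc : ∀ W, ∫ w, D (w, W) ∂P = 0)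
    (hB : ∀ w, DependsOn (fun W => D (w, W)) B) {j : ι} (hj : j ∉ B) {K : (ι → Ω) → ℝ}
    (hK : BddMeas K) (hKT : DependsOn K T) (hjT : j ∉ T) :
    ∫ W, D (W j, W) * K W ∂(iid P ι) = 0 := by
  have hG : BddMeas fun p : Ω × (ι → Ω) => D p * K p.2 := hD.mul (hK.comp measurable_snd)
  have h := integral_insert_coord P hG (B := B ∪ T) (j := j) (fun w V V' hV => by
    simp only
    rw [show D (w, V) = D (w, V') from hB w fun i hi => hV i (by
      simp only [Finset.coe_union, Set.mem_union]; exact Or.inl hi),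
      hKT fun i hi => hV i (by simp only [Finset.coe_union, Set.mem_union]; exact Or.inr hi)])
    (by simp [hj, hjT])
  rw [h, integral_prod_symm _ (hG.integrable _)]
  simp [integral_mul_const, hc]

/-- A sum of values of a centered kernel at fresh coordinates has the second moment of a sum of
i.i.d. centered random variables. -/
lemma l2_sum_coord (hD : BddMeas D) (hc : ∀ W, ∫ w, D (w, W) ∂P = 0)
    (hB : ∀ w, DependsOn (fun W => D (w, W)) B) (hAB : Disjoint A B) :
    l2 (iid P ι) (fun W => ∑ i ∈ A, D (W i, W))
      = √(A.card : ℝ) * l2 (P.prod (iid P ι)) D := by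
  rw [l2, l2, ← Real.sqrt_mul (by positivity)]
  congr 1
  have hcoord := fun i => hD.comp (measurable_coord_prod (Ω := Ω) (ι := ι) i)
  have e : ∀ W : ι → Ω, (∑ i ∈ A, D (W i, W)) ^ 2
      = ∑ i ∈ A, ∑ j ∈ A, D (W i, W) * D (W j, W) := fun W => by
    rw [pow_two, Finset.sum_mul_sum]
  simp_rw [e]
  rw [integral_finsetSum _ fun i _ =>
    (BddMeas.sum A fun j _ => (hcoord i).mul (hcoord j)).integrable _]
  have h : ∀ i ∈ A, ∫ W, ∑ j ∈ A, D (W i, W) * D (W j, W) ∂(iid P ι)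
      = ∫ p, D p ^ 2 ∂(P.prod (iid P ι)) := by
    intro i hi
    have hiB := Finset.disjoint_left.1 hAB hi
    rw [integral_finsetSum _ fun j _ => ((hcoord i).mul (hcoord j)).integrable _,
      Finset.sum_eq_single_of_mem i hi]
    · simp_rw [← pow_two]
      exact integral_insert_coord P (hD.pow 2) (B := B)
        (fun w V V' hV => congrArg (· ^ 2) (hB w hV)) hiB
    · intro j hj hji
      refine integral_centered_mul_eq_zero hD hc hB hiB (hcoord j) (T := insert j B) ?_ ?_
      · intro V V' hV
        simp only
        rw [hV j (by simp)]
        exact hB _ fun i hi => hV i (by simp only [Finset.coe_insert]; exact Or.inr hi)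
      · simp [hiB, Ne.symm hji]
  rw [Finset.sum_congr rfl h]
  simp

end Kernels

section Growth

variable {Ω : Type*} [MeasurableSpace Ω] {P : Measure Ω} [IsProbabilityMeasure P] {n k : ℕ}
  {C : ℝ}

/-- A family of uniformly bounded kernels `D B (w; W)`, one for every set `B` of training indices,
which depend on the sample `W` through the coordinates in `B` only and are centered in the
evaluation point `w`. -/
structure CenteredFamily (P : Measure Ω) (C : ℝ)
    (D : Finset (Fin n) → Ω × (Fin n → Ω) → ℝ) : Prop where
  measurable : ∀ B, Measurable (D B)
  abs_le : ∀ B p, |D B p| ≤ C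
  centered : ∀ B W, ∫ w, D B (w, W) ∂P = 0
  dependsOn : ∀ B w, DependsOn (fun W => D B (w, W)) B

variable {D : Finset (Fin n) → Ω × (Fin n → Ω) → ℝ}

lemma CenteredFamily.bddMeas (hD : CenteredFamily P C D) (B : Finset (Fin n)) :
    BddMeas (D B) :=
  ⟨hD.measurable B, C, hD.abs_le B⟩

/-- The sum over all folds of the kernel trained off the fold, evaluated on the fold. -/
def cvSum (D : Finset (Fin n) → Ω × (Fin n → Ω) → ℝ) (a : Fin n → Fin k) (W : Fin n → Ω) : ℝ :=
  ∑ r, ∑ i ∈ fold a r, D (trainIdx a r) (W i, W)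

lemma CenteredFamily.bddMeas_cvSum (hD : CenteredFamily P C D) (a : Fin n → Fin k) :
    BddMeas (cvSum D a) :=
  BddMeas.sum _ fun _ _ => (hD.bddMeas _).sum_coord _

lemma mem_fold {a : Fin n → Fin k} {r : Fin k} {i : Fin n} : i ∈ fold a r ↔ a i = r := by
  simp [fold]

lemma mem_trainIdx {a : Fin n → Fin k} {r : Fin k} {i : Fin n} :
    i ∈ trainIdx a r ↔ a i ≠ r := by
  simp [trainIdx]

lemma disjoint_fold_trainIdx (a : Fin n → Fin k) (r : Fin k) :
    Disjoint (fold a r) (trainIdx a r) := by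
  rw [Finset.disjoint_left]
  intro i
  simp [mem_fold, mem_trainIdx]

/-- Conditioning the `r`-th fold sum on the fold and a set `T` of training indices conditions
the kernel on `T`. -/
lemma cexp_sum_fold (hD : CenteredFamily P C D) {A B T : Finset (Fin n)}
    (hAB : Disjoint A B) :
    cexp P (A ∪ T) (fun W => ∑ i ∈ A, D B (W i, W))
      = fun W => ∑ i ∈ A, kcexp P T (D B) (W i, W) := by
  ext W
  unfold cexp kcexp cexp
  rw [integral_finsetSum]
  · refine Finset.sum_congr rfl fun i hi => integral_congr_ae (ae_of_all _ fun W' => ?_)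
    simp only
    rw [Finset.piecewise_eq_of_mem _ _ _ (Finset.mem_union_left T hi)]
    refine hD.dependsOn B (W i) fun j hj => ?_
    have hjA : j ∉ A := fun h => Finset.disjoint_left.1 hAB h (by simpa using hj)
    by_cases hjT : j ∈ T
    · simp [hjT]
    · simp [hjT, hjA]
  · intro i _
    have h1 : Measurable fun W' : Fin n → Ω => (A ∪ T).piecewise W W' :=
      (measurable_piecewise_prod _).comp measurable_prodMk_left
    exact (((hD.bddMeas B).comp (measurable_coord_prod i)).comp h1).integrable _

/-- The part of the kernel trained off fold `r` that depends on the training indices `T` only is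
controlled by the size of the cross-validated sum and by the parts that depend on smaller sets of
training indices, where one half `Q s` or `Q' s` of some other fold `s` is forgotten. Indeed, in
the sum over fold `s`, the terms evaluated on `Q s` do not involve `Q' s`, and conversely. -/
lemma CenteredFamily.card_mul_sq_l2_kcexp_le (hD : CenteredFamily P C D) (hC : 0 ≤ C)
    (a : Fin n → Fin k) (r : Fin k) {T : Finset (Fin n)} (hT : T ⊆ trainIdx a r)
    (Q Q' : Fin k → Finset (Fin n)) (hQ : ∀ s ≠ r, Disjoint (Q s) (Q' s))
    (hQT : ∀ s ≠ r, T ∩ fold a s = Q s ∪ Q' s) :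
    (fold a r).card * l2 (P.prod (iid P (Fin n))) (kcexp P T (D (trainIdx a r))) ^ 2
      ≤ C * √n * l2 (iid P (Fin n)) (cvSum D a) + C * n * ∑ s ∈ Finset.univ.erase r,
        (l2 (P.prod (iid P (Fin n))) (kcexp P (T \ Q s) (D (trainIdx a r)))
          + l2 (P.prod (iid P (Fin n))) (kcexp P (T \ Q' s) (D (trainIdx a r)))) := by
  classical
  set μ := iid P (Fin n) with hμ
  set φ : Finset (Fin n) → ℝ :=
    fun U => l2 (P.prod (iid P (Fin n))) (kcexp P U (D (trainIdx a r))) with hφ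
  set A := fold a r with hA
  set B := trainIdx a r with hB
  have hAB : Disjoint A B := disjoint_fold_trainIdx a r
  set Ψ : Finset (Fin n) → (Fin n → Ω) → ℝ :=
    fun U W => ∑ i ∈ A, kcexp P U (D B) (W i, W) with hΨ
  have hcard : ∀ U : Finset (Fin n), √(U.card : ℝ) ≤ √n := fun U =>
    Real.sqrt_le_sqrt (by exact_mod_cast (Finset.card_le_univ U).trans_eq (Fintype.card_fin n))
  have hDB := hD.bddMeas B
  have hΨb : ∀ U, BddMeas (Ψ U) := fun U => (hDB.kcexp).sum_coord A
  have hΨl : ∀ U, U ⊆ B → l2 μ (Ψ U) = √(A.card : ℝ) * φ U := fun U hU =>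
    l2_sum_coord (B := U) hDB.kcexp (integral_kcexp_eq_zero hDB (hD.centered B))
      dependsOn_kcexp (hAB.mono_right hU)
  have hφC : ∀ U, φ U ≤ C := fun U => l2_le_of_abs_le (abs_kcexp_le (hD.abs_le B))
  have hφ0 : ∀ U, 0 ≤ φ U := fun U => l2_nonneg
  have hΨdep : ∀ U, U ⊆ B → DependsOn (Ψ U) (A ∪ U : Finset (Fin n)) := fun U hU => by
    rw [hΨ]
    simp only
    rw [← cexp_sum_fold hD hAB]
    exact dependsOn_cexp
  have hF : BddMeas fun W => ∑ i ∈ A, D B (W i, W) := hDB.sum_coord A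
  -- the cross-validated sum is tested against `Ψ T`; fold `r` contributes the left-hand side
  have h1 : ∫ W, Ψ T W * ∑ i ∈ A, D B (W i, W) ∂μ = A.card * φ T ^ 2 := by
    rw [← integral_mul_cexp hF (hΨb T) (hΨdep T hT), cexp_sum_fold hD hAB]
    have : ∀ W, Ψ T W * ∑ i ∈ A, kcexp P T (D B) (W i, W) = Ψ T W ^ 2 := fun W => by
      rw [pow_two]
    simp_rw [this]
    rw [← l2_sq, hΨl T hT, mul_pow, Real.sq_sqrt (by positivity)]
  -- the sum of the terms with indices in `U` does not depend on the observations in `U'`, so that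
  -- conditioning on the complement of `U'` replaces `Ψ T` by `Ψ (T \ U')`
  have h2 : ∀ s ≠ r, ∀ U U' : Finset (Fin n), Disjoint U U' → T ∩ fold a s = U ∪ U' →
      |∑ j ∈ U, ∫ W, D (trainIdx a s) (W j, W) * Ψ T W ∂μ| ≤ C * n * φ (T \ U') := by
    intro s hs U U' hUU hTU
    have hUs : U ⊆ fold a s := fun j hj =>
      (Finset.mem_inter.1 (hTU ▸ Finset.mem_union_left U' hj)).2
    have hUs' : U' ⊆ fold a s := fun j hj =>
      (Finset.mem_inter.1 (hTU ▸ Finset.mem_union_right U hj)).2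
    set K : (Fin n → Ω) → ℝ := fun W => ∑ j ∈ U, D (trainIdx a s) (W j, W) with hK
    have hKb : BddMeas K := (hD.bddMeas _).sum_coord U
    have hKdep : DependsOn K (U'ᶜ : Finset (Fin n)) := by
      intro V V' hV
      refine Finset.sum_congr rfl fun j hj => ?_
      have hjU' : j ∉ U' := Finset.disjoint_left.1 hUU hj
      rw [hV j (by simpa using hjU')]
      refine hD.dependsOn _ _ fun i hi => hV i ?_
      have hi' := mem_trainIdx.1 (Finset.mem_coe.1 hi)
      simp only [Finset.coe_compl, Set.mem_compl_iff, Finset.mem_coe]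
      exact fun h => hi' (mem_fold.1 (hUs' h))
    have hsum : ∑ j ∈ U, ∫ W, D (trainIdx a s) (W j, W) * Ψ T W ∂μ
        = ∫ W, K W * Ψ (T \ U') W ∂μ := by
      rw [← integral_finsetSum _ fun j _ =>
        (((hD.bddMeas _).comp (measurable_coord_prod j)).mul (hΨb T)).integrable _]
      simp_rw [← Finset.sum_mul]
      rw [← integral_mul_cexp (hΨb T) hKb hKdep]
      have hset : (U'ᶜ : Finset (Fin n)) ∩ (A ∪ T) = A ∪ (T \ U') := by
        ext i
        simp only [Finset.mem_inter, Finset.mem_compl, Finset.mem_union, Finset.mem_sdiff]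
        constructor
        · tauto
        · rintro (h | h)
          · refine ⟨fun h' => hs ?_, Or.inl h⟩
            rw [← mem_fold.1 (hUs' h'), ← mem_fold.1 h]
          · tauto
      have : cexp P (U'ᶜ : Finset (Fin n)) (Ψ T) = Ψ (T \ U') := by
        rw [hΨ]
        simp only
        rw [← cexp_sum_fold hD hAB, cexp_cexp hF, hset,
          cexp_sum_fold hD hAB]
      rw [this]
    rw [hsum]
    refine (abs_integral_mul_le_l2 hKb (hΨb _)).trans ?_
    rw [hΨl _ (Finset.sdiff_subset.trans hT)]
    have hKl : l2 μ K ≤ √n * C := by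
      rw [hK, l2_sum_coord (hD.bddMeas _) (hD.centered _) (hD.dependsOn _)
        ((disjoint_fold_trainIdx a s).mono_left hUs)]
      exact mul_le_mul (hcard U) (l2_le_of_abs_le (hD.abs_le _)) l2_nonneg (Real.sqrt_nonneg _)
    calc l2 μ K * (√(A.card : ℝ) * φ (T \ U')) ≤ (√n * C) * (√n * φ (T \ U')) :=
          mul_le_mul hKl (mul_le_mul_of_nonneg_right (hcard A) (hφ0 _))
            (mul_nonneg (Real.sqrt_nonneg _) (hφ0 _)) (by positivity)
      _ = C * (√n * √n) * φ (T \ U') := by ring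
      _ = C * n * φ (T \ U') := by rw [Real.mul_self_sqrt (by positivity)]
  have h3 : ∀ s ≠ r, |∑ j ∈ fold a s, ∫ W, D (trainIdx a s) (W j, W) * Ψ T W ∂μ|
      ≤ C * n * (φ (T \ Q s) + φ (T \ Q' s)) := by
    intro s hs
    -- the terms with an index outside `T` are orthogonal to `Ψ T`
    have hzero : ∀ j ∈ fold a s, j ∉ T ∩ fold a s →
        ∫ W, D (trainIdx a s) (W j, W) * Ψ T W ∂μ = 0 := by
      intro j hj hjT
      refine integral_centered_mul_eq_zero (hD.bddMeas _) (hD.centered _) (hD.dependsOn _)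
        (fun h => mem_trainIdx.1 h (mem_fold.1 hj)) (hΨb T) (hΨdep T hT) ?_
      simp only [Finset.mem_union, not_or]
      refine ⟨fun h => hs ?_, fun h => hjT (Finset.mem_inter.2 ⟨h, hj⟩)⟩
      rw [← mem_fold.1 hj, ← mem_fold.1 h]
    rw [← Finset.sum_subset Finset.inter_subset_right hzero, hQT s hs,
      Finset.sum_union (hQ s hs)]
    have e1 := h2 s hs (Q s) (Q' s) (hQ s hs) (hQT s hs)
    have e2 := h2 s hs (Q' s) (Q s) (hQ s hs).symm ((hQT s hs).trans (Finset.union_comm _ _))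
    calc _ ≤ _ := abs_add_le _ _
      _ ≤ C * n * φ (T \ Q' s) + C * n * φ (T \ Q s) := add_le_add e1 e2
      _ = _ := by ring
  have h4 : ∫ W, cvSum D a W * Ψ T W ∂μ = A.card * φ T ^ 2 + ∑ s ∈ Finset.univ.erase r,
      ∑ j ∈ fold a s, ∫ W, D (trainIdx a s) (W j, W) * Ψ T W ∂μ := by
    have e : ∀ s, ∀ W, (∑ j ∈ fold a s, D (trainIdx a s) (W j, W)) * Ψ T W
        = ∑ j ∈ fold a s, D (trainIdx a s) (W j, W) * Ψ T W := fun s W => Finset.sum_mul _ _ _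
    unfold cvSum
    simp_rw [Finset.sum_mul]
    rw [integral_finsetSum _ fun s _ => (BddMeas.sum _ fun j _ =>
        ((hD.bddMeas _).comp (measurable_coord_prod j)).mul (hΨb T)).integrable _,
      ← Finset.add_sum_erase _ _ (Finset.mem_univ r)]
    congr 1
    · rw [← h1]
      simp_rw [← e, mul_comm (Ψ T _)]
      rfl
    · refine Finset.sum_congr rfl fun s _ => ?_
      rw [integral_finsetSum _ fun j _ =>
        (((hD.bddMeas _).comp (measurable_coord_prod j)).mul (hΨb T)).integrable _]
  have h5 : |∫ W, cvSum D a W * Ψ T W ∂μ| ≤ C * √n * l2 μ (cvSum D a) := by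
    refine (abs_integral_mul_le_l2 (hD.bddMeas_cvSum a) (hΨb T)).trans ?_
    rw [hΨl T hT]
    calc _ ≤ l2 μ (cvSum D a) * (√n * C) := by
          refine mul_le_mul_of_nonneg_left ?_ l2_nonneg
          exact mul_le_mul (hcard A) (hφC T) (hφ0 _) (Real.sqrt_nonneg _)
      _ = _ := by ring
  have h6 : |∑ s ∈ Finset.univ.erase r,
      ∑ j ∈ fold a s, ∫ W, D (trainIdx a s) (W j, W) * Ψ T W ∂μ|
      ≤ C * n * ∑ s ∈ Finset.univ.erase r, (φ (T \ Q s) + φ (T \ Q' s)) := by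
    rw [Finset.mul_sum]
    exact (Finset.abs_sum_le_sum_abs _ _).trans
      (Finset.sum_le_sum fun s hs => h3 s (Finset.ne_of_mem_erase hs))
  have := _root_.abs_le.1 h5
  have := _root_.abs_le.1 h6
  linarith

end Growth

/-! ### Two folds: bounded kernels whose fold sums cancel are small -/

section Blocks

variable {Ω : Type*} [MeasurableSpace Ω] {P : Measure Ω} [IsProbabilityMeasure P]
  {ι κ : Type*} [Fintype ι] [DecidableEq ι] [Fintype κ]

lemma measurable_extend_prod (e : κ → ι) :
    Measurable fun p : (κ → Ω) × (ι → Ω) => Function.extend e p.1 p.2 := by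
  classical
  refine measurable_pi_lambda _ fun i => ?_
  by_cases hi : ∃ c, e c = i
  · simp only [Function.extend_def, dif_pos hi]
    exact (measurable_pi_apply _).comp measurable_fst
  · simp only [Function.extend_def, dif_neg hi]
    exact (measurable_pi_apply _).comp measurable_snd

/-- Overwriting some coordinates of an i.i.d. sample by an independent i.i.d. sample gives again
an i.i.d. sample. -/
lemma measurePreserving_extend {e : κ → ι} (he : Function.Injective e) :
    MeasurePreserving (fun p : (κ → Ω) × (ι → Ω) => Function.extend e p.1 p.2)
      ((iid P κ).prod (iid P ι)) (iid P ι) := by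
  classical
  refine ⟨measurable_extend_prod e, ?_⟩
  symm
  refine Measure.pi_eq fun s hs => ?_
  rw [Measure.map_apply (measurable_extend_prod e) (MeasurableSet.univ_pi hs)]
  have e1 : (fun p : (κ → Ω) × (ι → Ω) => Function.extend e p.1 p.2) ⁻¹' (Set.univ.pi s)
      = (Set.univ.pi fun c => s (e c)) ×ˢ
        (Set.univ.pi fun i => if i ∈ Finset.univ.image e then Set.univ else s i) := by
    ext p
    simp only [Set.mem_preimage, Set.mem_pi, Set.mem_univ, true_imp_iff, Set.mem_prod]
    constructor
    · intro h
      refine ⟨fun c => by simpa [he.extend_apply] using h (e c), fun i => ?_⟩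
      by_cases hi : i ∈ Finset.univ.image e
      · rw [if_pos hi]; trivial
      · rw [if_neg hi]
        have := h i
        rwa [Function.extend_apply'] at this
        simpa using hi
    · rintro ⟨h1, h2⟩ i
      by_cases hi : ∃ c, e c = i
      · obtain ⟨c, rfl⟩ := hi
        rw [he.extend_apply]
        exact h1 c
      · rw [Function.extend_apply' _ _ _ hi]
        have := h2 i
        rwa [if_neg (by simpa using hi)] at this
  rw [e1, Measure.prod_prod, Measure.pi_pi, Measure.pi_pi,
    ← Finset.prod_mul_prod_compl (Finset.univ.image e) (fun i => P (s i)),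
    Finset.prod_image he.injOn]
  congr 1
  rw [← Finset.prod_mul_prod_compl (Finset.univ.image e), Finset.prod_eq_one, one_mul]
  · exact Finset.prod_congr rfl fun i hi => by rw [if_neg (Finset.mem_compl.1 hi)]
  · intro i hi
    rw [if_pos hi, measure_univ]

lemma measurePreserving_uncurry {l m : Type*} [Fintype l] [Fintype m] :
    MeasurePreserving (fun (β : l → m → Ω) (c : l × m) => β c.1 c.2)
      (iid (iid P m) l) (iid P (l × m)) := by
  have hm : Measurable fun (β : l → m → Ω) (c : l × m) => β c.1 c.2 := by
    refine measurable_pi_lambda _ fun c => ?_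
    exact (measurable_pi_apply c.2).comp (measurable_pi_apply c.1)
  refine ⟨hm, ?_⟩
  symm
  refine Measure.pi_eq fun s hs => ?_
  rw [Measure.map_apply hm (MeasurableSet.univ_pi hs)]
  have e1 : (fun (β : l → m → Ω) (c : l × m) => β c.1 c.2) ⁻¹' (Set.univ.pi s)
      = Set.univ.pi fun i => Set.univ.pi fun j => s (i, j) := by
    ext β
    simp [Set.mem_pi]
  rw [e1, Measure.pi_pi, Fintype.prod_prod_type]
  simp_rw [Measure.pi_pi]

variable {A B : Finset ι} {D g q : Ω × (ι → Ω) → ℝ}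

/-- `l2_sum_coord` for a kernel with an additional independent parameter. -/
lemma l2_sum_coord_param {X : Type*} [MeasurableSpace X] {ν : Measure X} [IsProbabilityMeasure ν]
    {F : X × (Ω × (ι → Ω)) → ℝ} (hF : BddMeas F) (hc : ∀ x W, ∫ w, F (x, (w, W)) ∂P = 0)
    (hB : ∀ x w, DependsOn (fun W => F (x, (w, W))) B) (hAB : Disjoint A B) :
    l2 (ν.prod (iid P ι)) (fun p => ∑ i ∈ A, F (p.1, (p.2 i, p.2)))
      = √(A.card : ℝ) * l2 (ν.prod (P.prod (iid P ι))) F := by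
  have hm : ∀ i : ι, Measurable fun p : X × (ι → Ω) => (p.1, (p.2 i, p.2)) := fun i =>
    measurable_fst.prodMk (((measurable_pi_apply i).comp measurable_snd).prodMk measurable_snd)
  have hS : BddMeas fun p : X × (ι → Ω) => ∑ i ∈ A, F (p.1, (p.2 i, p.2)) :=
    BddMeas.sum A fun i _ => hF.comp (hm i)
  rw [l2, l2, ← Real.sqrt_mul (by positivity)]
  congr 1
  rw [integral_prod _ ((hS.pow 2).integrable _), integral_prod _ ((hF.pow 2).integrable _),
    ← integral_const_mul]
  refine integral_congr_ae (ae_of_all _ fun x => ?_)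
  have h := l2_sum_coord (P := P) (hF.comp (measurable_prodMk_left (x := x))) (hc x) (hB x) hAB
  have h2 := congrArg (· ^ 2) h
  simp only [mul_pow, l2_sq] at h2
  rw [Real.sq_sqrt (by positivity)] at h2
  exact h2

variable (g) in
/-- The change of `g (w, ·)` when the coordinates in the range of `e` change from `b.2` to
`b.1`. -/
noncomputable def blockDiff (e : κ → ι) (x : ((κ → Ω) × (κ → Ω)) × (Ω × (ι → Ω))) : ℝ :=
  g (x.2.1, Function.extend e x.1.1 x.2.2) - g (x.2.1, Function.extend e x.1.2 x.2.2)

lemma BddMeas.extend (hg : BddMeas g) (e : κ → ι) :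
    BddMeas fun x : (κ → Ω) × (Ω × (ι → Ω)) => g (x.2.1, Function.extend e x.1 x.2.2) :=
  hg.comp ((measurable_fst.comp measurable_snd).prodMk ((measurable_extend_prod e).comp
    (measurable_fst.prodMk (measurable_snd.comp measurable_snd))))

lemma BddMeas.blockDiff (hg : BddMeas g) (e : κ → ι) : BddMeas (blockDiff (Ω := Ω) g e) :=
  ((hg.extend e).comp ((measurable_fst.comp measurable_fst).prodMk measurable_snd)).sub
    ((hg.extend e).comp ((measurable_snd.comp measurable_fst).prodMk measurable_snd))

lemma integral_extend_eq_zero (hg : BddMeas g) (hc : ∀ W, ∫ w, g (w, W) ∂P = 0) (e : κ → ι)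
    (b : (κ → Ω) × (κ → Ω)) (W : ι → Ω) : ∫ w, blockDiff g e (b, (w, W)) ∂P = 0 := by
  unfold blockDiff
  rw [integral_sub]
  · simp [hc]
  · exact (hg.comp (measurable_prodMk_right (y := Function.extend e b.1 W))).integrable P
  · exact (hg.comp (measurable_prodMk_right (y := Function.extend e b.2 W))).integrable P

lemma dependsOn_extend (e : κ → ι) (hB : ∀ w, DependsOn (fun W => g (w, W)) B) (w : Ω)
    (b : κ → Ω) : DependsOn (fun W => g (w, Function.extend e b W)) B := by
  classical
  intro W W' h
  refine hB w fun i hi => ?_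
  by_cases hi' : ∃ c, e c = i
  · simp [Function.extend_def, hi']
  · simp [hi', h i hi]

/-- The sum of the two fold sums. -/
def twoFoldSum (A B : Finset ι) (g q : Ω × (ι → Ω) → ℝ) (W : ι → Ω) : ℝ :=
  ∑ i ∈ A, g (W i, W) + ∑ j ∈ B, q (W j, W)

/-- Overwriting observations of the fold `B` acts on the first fold sum through the kernel, and on
the second one additively. -/
lemma twoFoldSum_extend {e : κ → ι} (he : Function.Injective e) (heB : ∀ c, e c ∈ B)
    (hAB : Disjoint A B) (hq : ∀ w, DependsOn (fun W => q (w, W)) A) (x : κ → Ω) (W : ι → Ω) :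
    twoFoldSum A B g q (Function.extend e x W)
      = ∑ i ∈ A, g (W i, Function.extend e x W)
        + (∑ c, (q (x c, W) - q (W (e c), W)) + ∑ j ∈ B, q (W j, W)) := by
  classical
  have hA : ∀ i ∈ A, Function.extend e x W i = W i := fun i hi => by
    refine Function.extend_apply' _ _ _ ?_
    rintro ⟨c, rfl⟩
    exact Finset.disjoint_left.1 hAB hi (heB c)
  have hqx : ∀ w, q (w, Function.extend e x W) = q (w, W) := fun w =>
    hq w fun i hi => hA i hi
  unfold twoFoldSum
  congr 1
  · exact Finset.sum_congr rfl fun i hi => by rw [hA i hi]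
  · simp_rw [hqx]
    rw [← sub_eq_iff_eq_add, ← Finset.sum_sub_distrib,
      ← Finset.sum_subset (s₁ := Finset.univ.image e), Finset.sum_image he.injOn]
    · simp [he.extend_apply]
    · intro j hj
      obtain ⟨c, -, rfl⟩ := Finset.mem_image.1 hj
      exact heB c
    · intro j _ hj
      rw [Function.extend_apply', sub_self]
      simpa using hj

lemma one_add_sq_div_two_le_cosh (x : ℝ) : 1 + x ^ 2 / 2 ≤ Real.cosh x := by
  have h : Real.cosh x = 1 + 2 * Real.sinh (x / 2) ^ 2 := by
    have := Real.cosh_two_mul (x / 2)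
    rw [mul_div_cancel₀ _ two_ne_zero] at this
    rw [this, Real.cosh_sq]
    ring
  have h2 : (x / 2) ^ 2 ≤ Real.sinh (x / 2) ^ 2 := by
    rw [sq_le_sq]
    rcases le_total 0 (x / 2) with h0 | h0
    · rw [abs_of_nonneg h0, abs_of_nonneg (Real.sinh_nonneg_iff.2 h0)]
      exact Real.self_le_sinh_iff.2 h0
    · rw [abs_of_nonpos h0, abs_of_nonpos (Real.sinh_nonpos_iff.2 h0)]
      exact neg_le_neg (Real.sinh_le_self_iff.2 h0)
  rw [h]
  linarith

/-- The exponential moment of a difference of i.i.d. bounded variables is at least the one of a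
Gaussian to second order. -/
lemma one_add_le_integral_exp_sub {X : Type*} [MeasurableSpace X] {ν : Measure X}
    [IsProbabilityMeasure ν] {y : X → ℝ} (hy : BddMeas y) (t : ℝ) :
    1 + t ^ 2 / 2 * ∫ p, (y p.1 - y p.2) ^ 2 ∂(ν.prod ν)
      ≤ ∫ p, Real.exp (t * (y p.1 - y p.2)) ∂(ν.prod ν) := by
  have hY : BddMeas fun p : X × X => y p.1 - y p.2 :=
    (hy.comp measurable_fst).sub (hy.comp measurable_snd)
  have hE := (hY.const_mul t).exp
  have hE' := (hY.const_mul (-t)).exp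
  have hsw : ∫ p, Real.exp (t * (y p.1 - y p.2)) ∂(ν.prod ν)
      = ∫ p, Real.exp (-t * (y p.1 - y p.2)) ∂(ν.prod ν) := by
    rw [← integral_prod_swap]
    refine integral_congr_ae (ae_of_all _ fun p => ?_)
    simp only [Prod.fst_swap, Prod.snd_swap]
    congr 1
    ring
  have hcosh : ∫ p, Real.exp (t * (y p.1 - y p.2)) ∂(ν.prod ν)
      = ∫ p, Real.cosh (t * (y p.1 - y p.2)) ∂(ν.prod ν) := by
    simp_rw [Real.cosh_eq]
    rw [integral_div, integral_add (hE.integrable _)]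
    · simp_rw [← neg_mul]
      rw [← hsw]
      ring
    · simpa only [neg_mul] using hE'.integrable (ν.prod ν)
  have hone : 1 + t ^ 2 / 2 * ∫ p, (y p.1 - y p.2) ^ 2 ∂(ν.prod ν)
      = ∫ p, (1 + (t * (y p.1 - y p.2)) ^ 2 / 2) ∂(ν.prod ν) := by
    rw [integral_add (integrable_const _) ((((hY.const_mul t).pow 2).integrable _).div_const _),
      integral_div]
    simp_rw [mul_pow]
    rw [integral_const_mul]
    simp
    ring
  rw [hcosh, hone]
  refine integral_mono ?_ ?_ fun p => one_add_sq_div_two_le_cosh _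
  · exact (integrable_const _).add ((((hY.const_mul t).pow 2).integrable _).div_const _)
  · simp_rw [Real.cosh_eq]
    refine Integrable.div_const ((hE.integrable _).add ?_) _
    simpa only [neg_mul] using hE'.integrable (ν.prod ν)

end Blocks

section TwoFolds

variable {Ω : Type*} [MeasurableSpace Ω] {P : Measure Ω} [IsProbabilityMeasure P]
  {ι κ : Type*} [Fintype ι] [DecidableEq ι] [Fintype κ]
  {A B : Finset ι} {g q : Ω × (ι → Ω) → ℝ}

lemma BddMeas.twoFoldSum (hg : BddMeas g) (hq : BddMeas q) : BddMeas (twoFoldSum A B g q) :=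
  (hg.sum_coord A).add (hq.sum_coord B)

/-- The second moment of a difference of two independent copies of a centered sum. -/
lemma l2_sum_sub_sum (hq : BddMeas q) (hqc : ∀ W, ∫ w, q (w, W) ∂P = 0) :
    l2 (((iid P κ).prod (iid P κ)).prod (iid P ι))
        (fun p => ∑ c, (q (p.1.1 c, p.2) - q (p.1.2 c, p.2)))
      = √(2 * Fintype.card κ : ℝ) * l2 (P.prod (iid P ι)) q := by
  classical
  have hm1 : ∀ c : κ, Measurable fun p : ((κ → Ω) × (κ → Ω)) × (ι → Ω) => (p.1.1 c, p.2) :=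
    fun c => ((measurable_pi_apply c).comp (measurable_fst.comp measurable_fst)).prodMk
      measurable_snd
  have hm2 : ∀ c : κ, Measurable fun p : ((κ → Ω) × (κ → Ω)) × (ι → Ω) => (p.1.2 c, p.2) :=
    fun c => ((measurable_pi_apply c).comp (measurable_snd.comp measurable_fst)).prodMk
      measurable_snd
  have hR : BddMeas fun p : ((κ → Ω) × (κ → Ω)) × (ι → Ω) =>
      ∑ c, (q (p.1.1 c, p.2) - q (p.1.2 c, p.2)) :=
    BddMeas.sum _ fun c _ => (hq.comp (hm1 c)).sub (hq.comp (hm2 c))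
  rw [l2, l2, ← Real.sqrt_mul (by positivity)]
  congr 1
  rw [integral_prod_symm _ ((hR.pow 2).integrable _),
    integral_prod_symm _ ((hq.pow 2).integrable _), ← integral_const_mul]
  refine integral_congr_ae (ae_of_all _ fun W => ?_)
  simp only
  set S : (κ → Ω) → ℝ := fun b => ∑ c, q (b c, W) with hS
  have hqW : BddMeas fun w => q (w, W) := hq.comp measurable_prodMk_right
  have hSb : BddMeas S := BddMeas.sum _ fun c _ => hqW.comp (measurable_pi_apply c)
  have hS0 : ∫ b, S b ∂(iid P κ) = 0 := by
    rw [hS, integral_finsetSum _ fun c _ => (hqW.comp (measurable_pi_apply c)).integrable _]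
    refine Finset.sum_eq_zero fun c _ => ?_
    exact (integral_comp_of_measurePreserving (measurePreserving_eval (fun _ : κ => P) c)
      hqW).trans (hqc W)
  have hS2 : ∫ b, S b ^ 2 ∂(iid P κ) = Fintype.card κ * ∫ w, q (w, W) ^ 2 ∂P := by
    have h := l2_sum_coord (P := P) (ι := κ) (A := Finset.univ) (B := ∅)
      (D := fun p => q (p.1, W)) (hqW.comp measurable_fst) (fun _ => hqc W)
      (fun _ _ _ _ => rfl) (Finset.disjoint_empty_right _)
    have h2 := congrArg (· ^ 2) h
    simp only [mul_pow, l2_sq] at h2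
    rw [Real.sq_sqrt (by positivity), Finset.card_univ, integral_prod _
      (((hqW.comp measurable_fst).pow 2).integrable _)] at h2
    simpa using h2
  have e : ∀ p : (κ → Ω) × (κ → Ω), (∑ c, (q (p.1 c, W) - q (p.2 c, W))) ^ 2
      = S p.1 ^ 2 + S p.2 ^ 2 - 2 * (S p.1 * S p.2) := fun p => by
    rw [Finset.sum_sub_distrib]
    simp only [hS]
    ring
  have i1 : BddMeas fun p : (κ → Ω) × (κ → Ω) => S p.1 := hSb.comp measurable_fst
  have i2 : BddMeas fun p : (κ → Ω) × (κ → Ω) => S p.2 := hSb.comp measurable_snd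
  simp_rw [e]
  rw [integral_sub (((i1.pow 2).add (i2.pow 2)).integrable _)
      (((i1.mul i2).const_mul 2).integrable _),
    integral_add ((i1.pow 2).integrable _) ((i2.pow 2).integrable _), integral_const_mul,
    integral_prod_mul, hS0, integral_comp_of_measurePreserving measurePreserving_fst (hSb.pow 2),
    integral_comp_of_measurePreserving measurePreserving_snd (hSb.pow 2), hS2]
  ring

/-- If the sum of the two fold sums is small, then the influence of a block of observations of the
second fold on the kernel of the first fold is as large as the sum of the second kernel over the
block. -/
lemma sqrt_mul_l2_le_l2_blockDiff (hg : BddMeas g) (hgc : ∀ W, ∫ w, g (w, W) ∂P = 0)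
    (hgB : ∀ w, DependsOn (fun W => g (w, W)) B) (hq : BddMeas q)
    (hqc : ∀ W, ∫ w, q (w, W) ∂P = 0) (hqA : ∀ w, DependsOn (fun W => q (w, W)) A)
    (hAB : Disjoint A B) {e : κ → ι} (he : Function.Injective e) (heB : ∀ c, e c ∈ B) :
    √(2 * Fintype.card κ : ℝ) * l2 (P.prod (iid P ι)) q
      ≤ √(A.card : ℝ) * l2 (((iid P κ).prod (iid P κ)).prod (P.prod (iid P ι))) (blockDiff g e)
        + 2 * l2 (iid P ι) (twoFoldSum A B g q) := by
  have hH := hg.twoFoldSum (A := A) (B := B) hq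
  rw [← l2_sum_sub_sum hq hqc, ← l2_sum_coord_param (hg.blockDiff e)
    (fun b W => integral_extend_eq_zero hg hgc e b W) (fun b w W W' h => by
      have h1 := dependsOn_extend e hgB w b.1 h
      have h2 := dependsOn_extend e hgB w b.2 h
      simp only [blockDiff] at h1 h2 ⊢
      rw [h1, h2]) hAB]
  have m1 : MeasurePreserving (fun p : ((κ → Ω) × (κ → Ω)) × (ι → Ω) =>
      Function.extend e p.1.1 p.2) (((iid P κ).prod (iid P κ)).prod (iid P ι)) (iid P ι) :=
    (measurePreserving_extend he).comp (measurePreserving_fst.prod (MeasurePreserving.id _))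
  have m2 : MeasurePreserving (fun p : ((κ → Ω) × (κ → Ω)) × (ι → Ω) =>
      Function.extend e p.1.2 p.2) (((iid P κ).prod (iid P κ)).prod (iid P ι)) (iid P ι) :=
    (measurePreserving_extend he).comp (measurePreserving_snd.prod (MeasurePreserving.id _))
  have hD : BddMeas fun p : ((κ → Ω) × (κ → Ω)) × (ι → Ω) =>
      ∑ i ∈ A, blockDiff g e (p.1, (p.2 i, p.2)) :=
    BddMeas.sum A fun i _ => (hg.blockDiff e).comp
      (measurable_fst.prodMk (((measurable_pi_apply i).comp measurable_snd).prodMk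
        measurable_snd))
  have e1 : (fun p : ((κ → Ω) × (κ → Ω)) × (ι → Ω) =>
      ∑ c, (q (p.1.1 c, p.2) - q (p.1.2 c, p.2)))
      = fun p => (twoFoldSum A B g q (Function.extend e p.1.1 p.2)
        - twoFoldSum A B g q (Function.extend e p.1.2 p.2))
        - ∑ i ∈ A, blockDiff g e (p.1, (p.2 i, p.2)) := by
    ext p
    rw [twoFoldSum_extend he heB hAB hqA, twoFoldSum_extend he heB hAB hqA]
    simp only [blockDiff, Finset.sum_sub_distrib]
    ring
  rw [e1]
  refine (l2_sub_le ((hH.comp m1.measurable).sub (hH.comp m2.measurable)) hD).trans ?_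
  have h := l2_sub_le (μ := ((iid P κ).prod (iid P κ)).prod (iid P ι))
    (hH.comp m1.measurable) (hH.comp m2.measurable)
  rw [l2_comp_of_measurePreserving m1 hH, l2_comp_of_measurePreserving m2 hH] at h
  linarith

variable {L m : ℕ}

/-- The failure of additivity over blocks of the kernel `g (w, ·)`: the change when all blocks are
replaced, minus the sum over the blocks of the change when the content of this block is put into
the block `l₀`. -/
noncomputable def blockDefect (g : Ω × (ι → Ω) → ℝ) (e : Fin L × Fin m → ι) (l₀ : Fin L)
    (x : (Fin L → (Fin m → Ω) × (Fin m → Ω)) × (Ω × (ι → Ω))) : ℝ :=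
  blockDiff g e ((fun c => (x.1 c.1).1 c.2, fun c => (x.1 c.1).2 c.2), x.2)
    - ∑ l, blockDiff g (fun j => e (l₀, j)) (x.1 l, x.2)

lemma measurable_blocks_fst :
    Measurable fun (γ : Fin L → (Fin m → Ω) × (Fin m → Ω)) (c : Fin L × Fin m) =>
      (γ c.1).1 c.2 :=
  measurable_pi_lambda _ fun c => (measurable_pi_apply c.2).comp
    (measurable_fst.comp (measurable_pi_apply c.1))

lemma measurable_blocks_snd :
    Measurable fun (γ : Fin L → (Fin m → Ω) × (Fin m → Ω)) (c : Fin L × Fin m) =>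
      (γ c.1).2 c.2 :=
  measurable_pi_lambda _ fun c => (measurable_pi_apply c.2).comp
    (measurable_snd.comp (measurable_pi_apply c.1))

lemma BddMeas.blockDefect (hg : BddMeas g) (e : Fin L × Fin m → ι) (l₀ : Fin L) :
    BddMeas (blockDefect (Ω := Ω) g e l₀) :=
  ((hg.blockDiff e).comp (((measurable_blocks_fst.comp measurable_fst).prodMk
    (measurable_blocks_snd.comp measurable_fst)).prodMk measurable_snd)).sub
    (BddMeas.sum _ fun l _ => (hg.blockDiff _).comp
      (((measurable_pi_apply l).comp measurable_fst).prodMk measurable_snd))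

/-- The law of `L` independent pairs of blocks of `m` observations. -/
noncomputable abbrev blockLaw (P : Measure Ω) [IsProbabilityMeasure P] (L m : ℕ) :
    Measure (Fin L → (Fin m → Ω) × (Fin m → Ω)) :=
  Measure.pi fun _ => (iid P (Fin m)).prod (iid P (Fin m))

lemma measurePreserving_blocks_fst :
    MeasurePreserving (fun (γ : Fin L → (Fin m → Ω) × (Fin m → Ω)) (c : Fin L × Fin m) =>
      (γ c.1).1 c.2) (blockLaw P L m) (iid P (Fin L × Fin m)) :=
  measurePreserving_uncurry.comp (measurePreserving_pi (fun _ => (iid P (Fin m)).prod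
    (iid P (Fin m))) (fun _ => iid P (Fin m)) fun _ => measurePreserving_fst)

lemma measurePreserving_blocks_snd :
    MeasurePreserving (fun (γ : Fin L → (Fin m → Ω) × (Fin m → Ω)) (c : Fin L × Fin m) =>
      (γ c.1).2 c.2) (blockLaw P L m) (iid P (Fin L × Fin m)) :=
  measurePreserving_uncurry.comp (measurePreserving_pi (fun _ => (iid P (Fin m)).prod
    (iid P (Fin m))) (fun _ => iid P (Fin m)) fun _ => measurePreserving_snd)

/-- If the sum of the two fold sums is small, then the kernel of the first fold is nearly
additive over blocks of the second fold, since the second fold sum is exactly additive. -/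
lemma sqrt_mul_l2_blockDefect_le (hg : BddMeas g) (hgc : ∀ W, ∫ w, g (w, W) ∂P = 0)
    (hgB : ∀ w, DependsOn (fun W => g (w, W)) B) (hq : BddMeas q)
    (hqA : ∀ w, DependsOn (fun W => q (w, W)) A)
    (hAB : Disjoint A B) {e : Fin L × Fin m → ι} (he : Function.Injective e)
    (heB : ∀ c, e c ∈ B) (l₀ : Fin L) :
    √(A.card : ℝ) * l2 ((blockLaw P L m).prod (P.prod (iid P ι))) (blockDefect g e l₀)
      ≤ (2 + 2 * L) * l2 (iid P ι) (twoFoldSum A B g q) := by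
  have hH := hg.twoFoldSum (A := A) (B := B) hq
  set H := twoFoldSum A B g q with hHdef
  set e₀ : Fin m → ι := fun j => e (l₀, j) with he₀
  have he₀i : Function.Injective e₀ := fun i j h => by simpa using he h
  have he₀B : ∀ j, e₀ j ∈ B := fun j => heB _
  rw [← l2_sum_coord_param (hg.blockDefect e l₀) (fun γ W => by
      have hint : ∀ {κ : Type} [Fintype κ] (e' : κ → ι) (b : (κ → Ω) × (κ → Ω)),
          Integrable (fun w => blockDiff g e' (b, (w, W))) P := fun e' b =>
        ((hg.blockDiff e').comp
          (measurable_prodMk_left.comp (measurable_prodMk_right (y := W)))).integrable P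
      simp only [blockDefect]
      rw [integral_sub (hint _ _) (integrable_finsetSum _ fun l _ => hint _ _),
        integral_finsetSum _ fun l _ => hint _ _]
      simp [integral_extend_eq_zero hg hgc])
    (fun γ w W W' h => by
      have h1 := fun b => dependsOn_extend e hgB w b h
      have h2 := fun b => dependsOn_extend e₀ hgB w b h
      simp only [blockDefect, blockDiff] at h1 h2 ⊢
      rw [h1, h1]
      congr 1
      exact Finset.sum_congr rfl fun l _ => by rw [h2, h2]) hAB]
  have m1 : MeasurePreserving (fun p : (Fin L → (Fin m → Ω) × (Fin m → Ω)) × (ι → Ω) =>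
      Function.extend e (fun c => (p.1 c.1).1 c.2) p.2)
      ((blockLaw P L m).prod (iid P ι)) (iid P ι) :=
    (measurePreserving_extend he).comp
      (measurePreserving_blocks_fst.prod (MeasurePreserving.id _))
  have m2 : MeasurePreserving (fun p : (Fin L → (Fin m → Ω) × (Fin m → Ω)) × (ι → Ω) =>
      Function.extend e (fun c => (p.1 c.1).2 c.2) p.2)
      ((blockLaw P L m).prod (iid P ι)) (iid P ι) :=
    (measurePreserving_extend he).comp
      (measurePreserving_blocks_snd.prod (MeasurePreserving.id _))
  have m3 : ∀ l, MeasurePreserving (fun p : (Fin L → (Fin m → Ω) × (Fin m → Ω)) × (ι → Ω) =>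
      Function.extend e₀ (p.1 l).1 p.2)
      ((blockLaw P L m).prod (iid P ι)) (iid P ι) := fun l =>
    (measurePreserving_extend he₀i).comp ((measurePreserving_fst.comp
      (measurePreserving_eval (fun _ => (iid P (Fin m)).prod (iid P (Fin m))) l)).prod
        (MeasurePreserving.id _))
  have m4 : ∀ l, MeasurePreserving (fun p : (Fin L → (Fin m → Ω) × (Fin m → Ω)) × (ι → Ω) =>
      Function.extend e₀ (p.1 l).2 p.2)
      ((blockLaw P L m).prod (iid P ι)) (iid P ι) := fun l =>
    (measurePreserving_extend he₀i).comp ((measurePreserving_snd.comp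
      (measurePreserving_eval (fun _ => (iid P (Fin m)).prod (iid P (Fin m))) l)).prod
        (MeasurePreserving.id _))
  have e1 : (fun p : (Fin L → (Fin m → Ω) × (Fin m → Ω)) × (ι → Ω) =>
      ∑ i ∈ A, blockDefect g e l₀ (p.1, (p.2 i, p.2)))
      = fun p => (H (Function.extend e (fun c => (p.1 c.1).1 c.2) p.2)
          - H (Function.extend e (fun c => (p.1 c.1).2 c.2) p.2))
        - ∑ l, (H (Function.extend e₀ (p.1 l).1 p.2) - H (Function.extend e₀ (p.1 l).2 p.2)) := by
    ext p
    simp only [hHdef]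
    simp_rw [twoFoldSum_extend he heB hAB hqA, twoFoldSum_extend he₀i he₀B hAB hqA]
    simp only [blockDefect, blockDiff, Finset.sum_sub_distrib, Finset.sum_add_distrib,
      Fintype.sum_prod_type]
    rw [Finset.sum_comm (s := A)]
    rw [Finset.sum_comm (s := A)]
    ring
  rw [e1]
  have b1 := hH.comp m1.measurable
  have b2 := hH.comp m2.measurable
  have b3 := fun l => (hH.comp (m3 l).measurable).sub (hH.comp (m4 l).measurable)
  refine (l2_sub_le (b1.sub b2) (BddMeas.sum _ fun l _ => b3 l)).trans ?_
  have h1 := l2_sub_le (μ := (blockLaw P L m).prod (iid P ι)) b1 b2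
  rw [l2_comp_of_measurePreserving m1 hH, l2_comp_of_measurePreserving m2 hH] at h1
  have h2 := l2_sum_le (μ := (blockLaw P L m).prod (iid P ι)) Finset.univ fun l _ => b3 l
  have h3 : ∀ l, l2 ((blockLaw P L m).prod (iid P ι))
      (fun p => H (Function.extend e₀ (p.1 l).1 p.2) - H (Function.extend e₀ (p.1 l).2 p.2))
      ≤ 2 * l2 (iid P ι) H := fun l => by
    have h := l2_sub_le (μ := (blockLaw P L m).prod (iid P ι))
      (hH.comp (m3 l).measurable) (hH.comp (m4 l).measurable)
    rw [l2_comp_of_measurePreserving (m3 l) hH, l2_comp_of_measurePreserving (m4 l) hH] at h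
    linarith
  have h4 := h2.trans (Finset.sum_le_sum fun l _ => h3 l)
  simp only [Finset.sum_const, Finset.card_univ, Fintype.card_fin, nsmul_eq_mul] at h4
  linarith

/-- A bounded variable that is nearly a sum of `L` i.i.d. variables has a small variance: compare
exponential moments. -/
lemma one_add_pow_le (hg : BddMeas g) {C : ℝ} (hgC : ∀ p, |g p| ≤ C)
    (e : Fin L × Fin m → ι) (l₀ : Fin L) {t : ℝ} (ht : 0 ≤ t) :
    (1 + t ^ 2 / 2 * l2 (((iid P (Fin m)).prod (iid P (Fin m))).prod (P.prod (iid P ι)))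
        (blockDiff g fun j => e (l₀, j)) ^ 2) ^ L
      ≤ Real.exp (2 * C * t) * (1 + t * Real.exp (t * (2 * C + 2 * C * L))
        * l2 ((blockLaw P L m).prod (P.prod (iid P ι))) (blockDefect g e l₀)) := by
  set e₀ : Fin m → ι := fun j => e (l₀, j) with he₀
  set M := P.prod (iid P ι) with hM
  set ρ := (iid P (Fin m)).prod (iid P (Fin m)) with hρ
  have hY := hg.blockDiff (Ω := Ω) e₀
  have hΨ := hg.blockDefect e l₀
  have hYC : ∀ {κ : Type} [Fintype κ] (e' : κ → ι) x, |blockDiff g e' x| ≤ 2 * C :=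
    fun e' x => by
      refine (abs_sub _ _).trans ?_
      linarith [hgC (x.2.1, Function.extend e' x.1.1 x.2.2),
        hgC (x.2.1, Function.extend e' x.1.2 x.2.2)]
  have hΨC : ∀ x, |blockDefect g e l₀ x| ≤ 2 * C + 2 * C * L := fun x => by
    refine (abs_sub _ _).trans (add_le_add (hYC _ _) ?_)
    refine (Finset.abs_sum_le_sum_abs _ _).trans ((Finset.sum_le_sum fun l _ => hYC _ _).trans ?_)
    simp [mul_comm]
  set u : Ω × (ι → Ω) → ℝ := fun y => ∫ b, blockDiff g e₀ (b, y) ^ 2 ∂ρ with hu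
  have hub : BddMeas u := BddMeas.integral_left
    (F := fun x : ((Fin m → Ω) × (Fin m → Ω)) × (Ω × (ι → Ω)) => blockDiff g e₀ x ^ 2)
    (hY.pow 2) ρ
  have hu0 : ∀ y, 0 ≤ u y := fun y => integral_nonneg fun _ => sq_nonneg _
  have hv : ∫ y, u y ∂M = l2 (ρ.prod M) (blockDiff g e₀) ^ 2 := by
    rw [l2_sq, integral_prod_symm _ ((hY.pow 2).integrable _)]
  have hb1 : BddMeas fun y => 1 + t ^ 2 / 2 * u y := (BddMeas.const 1).add (hub.const_mul _)
  have hsum : BddMeas fun x : (Fin L → (Fin m → Ω) × (Fin m → Ω)) × (Ω × (ι → Ω)) =>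
      ∑ l, blockDiff g e₀ (x.1 l, x.2) := BddMeas.sum _ fun l _ => hY.comp
      (((measurable_pi_apply l).comp measurable_fst).prodMk measurable_snd)
  calc (1 + t ^ 2 / 2 * l2 (ρ.prod M) (blockDiff g e₀) ^ 2) ^ L
      = (∫ y, (1 + t ^ 2 / 2 * u y) ∂M) ^ L := by
        rw [integral_add (integrable_const _) ((hub.const_mul _).integrable _),
          integral_const_mul, hv]
        simp
    _ ≤ ∫ y, (1 + t ^ 2 / 2 * u y) ^ L ∂M := by
        -- Jensen's inequality over the evaluation point and the rest of the sample
        refine ConvexOn.map_integral_le (convexOn_pow L) (continuous_pow L).continuousOn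
          isClosed_Ici (ae_of_all _ fun y => ?_) (hb1.integrable _) ((hb1.pow L).integrable _)
        have := hu0 y
        exact Set.mem_Ici.2 (by positivity)
    _ ≤ ∫ y, ∫ γ, Real.exp (t * ∑ l, blockDiff g e₀ (γ l, y)) ∂(blockLaw P L m) ∂M := by
        refine integral_mono ((hb1.pow L).integrable _) ?_ fun y => ?_
        · exact ((hsum.const_mul t).exp.integral_left (blockLaw P L m)).integrable _
        · simp only
          have h1 : ∀ γ : Fin L → (Fin m → Ω) × (Fin m → Ω),
              Real.exp (t * ∑ l, blockDiff g e₀ (γ l, y))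
                = ∏ l, Real.exp (t * blockDiff g e₀ (γ l, y)) := fun γ => by
            rw [Finset.mul_sum, Real.exp_sum]
          simp_rw [h1]
          rw [integral_fintype_prod_eq_pow (μ := ρ)
            (fun b => Real.exp (t * blockDiff g e₀ (b, y))), Fintype.card_fin]
          have := hu0 y
          refine pow_le_pow_left₀ (by positivity) ?_ L
          exact one_add_le_integral_exp_sub (ν := iid P (Fin m))
            (y := fun b => g (y.1, Function.extend e₀ b y.2))
            ((hg.extend e₀).comp measurable_prodMk_right) t
    _ = ∫ x, Real.exp (t * ∑ l, blockDiff g e₀ (x.1 l, x.2)) ∂((blockLaw P L m).prod M) := by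
        rw [integral_prod_symm _ ((hsum.const_mul t).exp.integrable _)]
    _ ≤ ∫ x, Real.exp (2 * C * t) * (1 + t * Real.exp (t * (2 * C + 2 * C * L))
          * |blockDefect g e l₀ x|) ∂((blockLaw P L m).prod M) := by
        refine integral_mono ((hsum.const_mul t).exp.integrable _)
          (((BddMeas.const 1).add (hΨ.abs.const_mul _)).const_mul _ |>.integrable _) fun x => ?_
        simp only
        set ψ := |blockDefect g e l₀ x| with hψ
        have hψ0 : 0 ≤ ψ := abs_nonneg _
        -- the change when all blocks are replaced is at most `2 * C`, however many blocks there are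
        have h1 : ∑ l, blockDiff g e₀ (x.1 l, x.2) ≤ 2 * C + ψ := by
          have h2 : ∑ l, blockDiff g e₀ (x.1 l, x.2)
              = blockDiff g e ((fun c => (x.1 c.1).1 c.2, fun c => (x.1 c.1).2 c.2), x.2)
                - blockDefect g e l₀ x := by
            unfold blockDefect
            ring
          rw [h2]
          have h3 := (le_abs_self _).trans
            (hYC e ((fun c => (x.1 c.1).1 c.2, fun c => (x.1 c.1).2 c.2), x.2))
          have h4 := neg_abs_le (blockDefect g e l₀ x)
          linarith
        have h5 : Real.exp (t * ψ) ≤ 1 + t * ψ * Real.exp (t * ψ) := by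
          have h6 := Real.add_one_le_exp (-(t * ψ))
          have h7 : Real.exp (-(t * ψ)) * Real.exp (t * ψ) = 1 := by
            rw [← Real.exp_add]; simp
          nlinarith [Real.exp_pos (t * ψ)]
        have h8 : Real.exp (t * ψ) ≤ Real.exp (t * (2 * C + 2 * C * L)) :=
          Real.exp_le_exp.2 (mul_le_mul_of_nonneg_left (hΨC x) ht)
        calc Real.exp (t * ∑ l, blockDiff g e₀ (x.1 l, x.2))
            ≤ Real.exp (2 * C * t + t * ψ) := by
              refine Real.exp_le_exp.2 ?_
              nlinarith [mul_le_mul_of_nonneg_left h1 ht]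
          _ = Real.exp (2 * C * t) * Real.exp (t * ψ) := Real.exp_add _ _
          _ ≤ Real.exp (2 * C * t) * (1 + t * Real.exp (t * (2 * C + 2 * C * L)) * ψ) := by
              refine mul_le_mul_of_nonneg_left (h5.trans ?_) (Real.exp_pos _).le
              nlinarith [mul_le_mul_of_nonneg_left h8 (mul_nonneg ht hψ0)]
    _ = Real.exp (2 * C * t) * (1 + t * Real.exp (t * (2 * C + 2 * C * L))
          * ∫ x, |blockDefect g e l₀ x| ∂((blockLaw P L m).prod M)) := by
        rw [integral_const_mul, integral_add (integrable_const _)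
          ((hΨ.abs.const_mul _).integrable _), integral_const_mul]
        simp
    _ ≤ _ := by
        have := integral_abs_le_l2 (μ := (blockLaw P L m).prod M) hΨ
        gcongr

end TwoFolds

section TwoFoldThreshold

variable {Ω : Type*} [MeasurableSpace Ω] {P : Measure Ω} [IsProbabilityMeasure P]

/-- If two bounded kernels, each depending on the other fold, have fold sums that nearly cancel,
then the kernels are small. By cancellation the kernel of the first fold is nearly additive over
`L` exchangeable blocks of the second fold, and since it is bounded by `C`, each block contributes
only `O(C / L)`, hence a variance `O(C² / L²)`; but by cancellation again the block contributes
the share `1 / L` of the variance of the second kernel. -/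
lemma exists_twoFold_threshold (P : Measure Ω) [IsProbabilityMeasure P] (C : ℝ)
    {ε : ℝ} (hε : 0 < ε) :
    ∃ δ > 0, ∃ N : ℕ, ∀ {n : ℕ} {A B : Finset (Fin n)} {g q : Ω × (Fin n → Ω) → ℝ},
      BddMeas g → (∀ p, |g p| ≤ C) → (∀ W, ∫ w, g (w, W) ∂P = 0) →
      (∀ w, DependsOn (fun W => g (w, W)) B) →
      BddMeas q → (∀ W, ∫ w, q (w, W) ∂P = 0) → (∀ w, DependsOn (fun W => q (w, W)) A) →
      Disjoint A B → 0 < A.card → A.card ≤ 2 * B.card → N ≤ B.card →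
      l2 (iid P (Fin n)) (twoFoldSum A B g q) ≤ δ * √(A.card : ℝ) →
      l2 (P.prod (iid P (Fin n))) q ≤ ε := by
  obtain ⟨ℓ, hℓ⟩ := exists_nat_gt (32 * Real.exp (2 * C) / ε ^ 2)
  have hℓ0 : (0 : ℝ) < ℓ := lt_trans (by positivity) hℓ
  have hℓ1 : 0 < ℓ := by exact_mod_cast hℓ0
  -- exponential moments of order `t = ℓ` are compared for `L = ℓ²` blocks: a block has variance at
  -- least of order `ε² / L`, and `(1 + ε² / 16) ^ L` is incompatible with a bound `exp (2 * C * ℓ)`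
  set L : ℕ := ℓ ^ 2 with hL
  have hL0 : 0 < L := by positivity
  have hL0' : (0 : ℝ) < L := by exact_mod_cast hL0
  set K : ℝ := ℓ * Real.exp (ℓ * (2 * C + 2 * C * L)) * (2 + 2 * L) with hK
  have hK0 : 0 < K := by positivity
  refine ⟨min (√(1 / (2 * L)) * ε / 4) (1 / K), by positivity, L, ?_⟩
  intro n A B g q hg hgC hgc hgB hq hqc hqA hAB hA hAB2 hB hH
  set δ := min (√(1 / (2 * L)) * ε / 4) (1 / K) with hδ
  by_contra! hv
  set v := l2 (P.prod (iid P (Fin n))) q with hvdef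
  set m : ℕ := B.card / L with hm
  have hA' : (0 : ℝ) < A.card := by exact_mod_cast hA
  have hsA : 0 < √(A.card : ℝ) := Real.sqrt_pos.2 hA'
  -- `L` disjoint blocks of `m` indices in the second fold
  obtain ⟨e', he'⟩ : ∃ e : Fin L × Fin m ↪ B, True := by
    have : Nonempty (Fin L × Fin m ↪ B) := Function.Embedding.nonempty_of_card_le (by
      simpa using Nat.mul_div_le B.card L)
    exact ⟨this.some, trivial⟩
  set e : Fin L × Fin m → Fin n := fun c => (e' c : Fin n) with he
  have hei : Function.Injective e := Subtype.val_injective.comp e'.injective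
  have heB : ∀ c, e c ∈ B := fun c => (e' c).2
  set l₀ : Fin L := ⟨0, hL0⟩
  set e₀ : Fin m → Fin n := fun j => e (l₀, j) with he₀
  have he₀i : Function.Injective e₀ := fun i j h => by simpa using hei h
  have h1 := sqrt_mul_l2_le_l2_blockDiff (P := P) hg hgc hgB hq hqc hqA hAB he₀i
    (fun j => heB _)
  have h2 := sqrt_mul_l2_blockDefect_le (P := P) hg hgc hgB hq hqA hAB hei heB l₀
  have h3 := one_add_pow_le (P := P) hg hgC e l₀ hℓ0.le
  set y := l2 (((iid P (Fin m)).prod (iid P (Fin m))).prod (P.prod (iid P (Fin n))))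
    (blockDiff g e₀) with hy
  set ψ := l2 ((blockLaw P L m).prod (P.prod (iid P (Fin n)))) (blockDefect g e l₀) with hψ
  have hψ1 : ψ ≤ (2 + 2 * L) / K := by
    have h4 : √(A.card : ℝ) * ψ ≤ √(A.card : ℝ) * ((2 + 2 * L) / K) := by
      refine h2.trans ?_
      have h5 : δ ≤ 1 / K := min_le_right _ _
      calc (2 + 2 * (L : ℝ)) * l2 (iid P (Fin n)) (twoFoldSum A B g q)
          ≤ (2 + 2 * L) * (1 / K * √(A.card : ℝ)) := by gcongr; exact hH.trans (by gcongr)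
        _ = _ := by ring
    exact le_of_mul_le_mul_left h4 hsA
  have hmL : (B.card : ℝ) ≤ 2 * L * m := by
    have h4 : B.card < L * (m + 1) := Nat.lt_mul_div_succ _ hL0
    have h5 : 1 ≤ m := (Nat.one_le_div_iff hL0).2 hB
    have h6 : B.card ≤ 2 * L * m := by nlinarith
    exact_mod_cast h6
  have hy1 : √(1 / (2 * L)) * ε / 2 ≤ y := by
    have h4 : √(A.card : ℝ) * √(1 / (2 * L)) ≤ √(2 * Fintype.card (Fin m) : ℝ) := by
      rw [← Real.sqrt_mul hA'.le]
      refine Real.sqrt_le_sqrt ?_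
      rw [Fintype.card_fin, mul_one_div, div_le_iff₀ (by positivity)]
      have : (A.card : ℝ) ≤ 2 * B.card := by exact_mod_cast hAB2
      linarith
    have h5 : l2 (iid P (Fin n)) (twoFoldSum A B g q)
        ≤ (√(1 / (2 * L)) * ε / 4) * √(A.card : ℝ) :=
      hH.trans (by gcongr; exact min_le_left _ _)
    have h6 : √(A.card : ℝ) * √(1 / (2 * L)) * ε ≤ √(2 * Fintype.card (Fin m) : ℝ) * v :=
      mul_le_mul h4 hv.le hε.le (Real.sqrt_nonneg _)
    have h7 : √(A.card : ℝ) * (√(1 / (2 * L)) * ε / 2) ≤ √(A.card : ℝ) * y := by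
      linarith
    exact le_of_mul_le_mul_left h7 hsA
  have hy2 : ε ^ 2 / 16 ≤ (ℓ : ℝ) ^ 2 / 2 * y ^ 2 := by
    have h4 : (√(1 / (2 * L)) * ε / 2) ^ 2 ≤ y ^ 2 := pow_le_pow_left₀ (by positivity) hy1 2
    rw [div_pow, mul_pow, Real.sq_sqrt (by positivity)] at h4
    have h5 : (L : ℝ) = (ℓ : ℝ) ^ 2 := by rw [hL]; push_cast; ring
    calc ε ^ 2 / 16 = (ℓ : ℝ) ^ 2 / 2 * (1 / (2 * L) * ε ^ 2 / 2 ^ 2) := by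
          rw [h5]; field_simp; norm_num
      _ ≤ _ := by gcongr
  have h4 : (1 + ε ^ 2 / 16) ^ L ≤ Real.exp (2 * C * ℓ) * 2 := by
    refine (pow_le_pow_left₀ (by positivity) (add_le_add_right hy2 1) L).trans (h3.trans ?_)
    refine mul_le_mul_of_nonneg_left ?_ (Real.exp_pos _).le
    have h5 : ↑ℓ * Real.exp (ℓ * (2 * C + 2 * C * L)) * ψ ≤ 1 := by
      calc ↑ℓ * Real.exp (ℓ * (2 * C + 2 * C * L)) * ψ
          ≤ ↑ℓ * Real.exp (ℓ * (2 * C + 2 * C * L)) * ((2 + 2 * L) / K) := by gcongr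
        _ = K / K := by rw [hK]; ring
        _ = 1 := div_self hK0.ne'
    linarith
  have h5 : ((1 + ε ^ 2 / 16) ^ ℓ) ^ ℓ ≤ (2 * Real.exp (2 * C)) ^ ℓ := by
    rw [← pow_mul, ← pow_two, ← hL]
    refine h4.trans ?_
    rw [mul_pow, ← Real.exp_nat_mul, mul_comm, mul_comm (2 * C)]
    gcongr
    exact le_self_pow₀ one_le_two hℓ1.ne'
  have h6 : (1 + ε ^ 2 / 16) ^ ℓ ≤ 2 * Real.exp (2 * C) :=
    le_of_pow_le_pow_left₀ hℓ1.ne' (by positivity) h5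
  -- Bernoulli's inequality contradicts the choice of `ℓ`
  have h7 := one_add_mul_le_pow (a := ε ^ 2 / 16) (by nlinarith [sq_nonneg ε]) ℓ
  rw [div_lt_iff₀ (by positivity)] at hℓ
  linarith

end TwoFoldThreshold

section Folds

variable {Ω : Type*} [MeasurableSpace Ω] {P : Measure Ω} [IsProbabilityMeasure P] {n k : ℕ}
  {C : ℝ} {D : Finset (Fin n) → Ω × (Fin n → Ω) → ℝ}

/-- Conditioning the cross-validated sum on two folds leaves the sums over these folds, with the
kernels conditioned on the respective other fold. -/
lemma CenteredFamily.cexp_cvSum (hD : CenteredFamily P C D) (a : Fin n → Fin k) {r s : Fin k}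
    (hrs : r ≠ s) :
    cexp P (fold a r ∪ fold a s) (cvSum D a)
      = twoFoldSum (fold a r) (fold a s) (kcexp P (fold a s) (D (trainIdx a r)))
        (kcexp P (fold a r) (D (trainIdx a s))) := by
  classical
  ext W
  have hpw : Measurable fun W' : Fin n → Ω => (fold a r ∪ fold a s).piecewise W W' :=
    (measurable_piecewise_prod _).comp measurable_prodMk_left
  have hsplit : cexp P (fold a r ∪ fold a s) (cvSum D a) W
      = ∑ t, cexp P (fold a r ∪ fold a s)
        (fun W => ∑ i ∈ fold a t, D (trainIdx a t) (W i, W)) W := by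
    unfold cexp cvSum
    rw [integral_finsetSum _ fun t _ => (((hD.bddMeas _).sum_coord _).comp hpw).integrable _]
  have hzero : ∀ t, t ∉ ({r, s} : Finset (Fin k)) → cexp P (fold a r ∪ fold a s)
      (fun W => ∑ i ∈ fold a t, D (trainIdx a t) (W i, W)) W = 0 := by
    intro t ht
    simp only [Finset.mem_insert, Finset.mem_singleton, not_or] at ht
    unfold cexp
    rw [integral_finsetSum _ fun i _ =>
      (((hD.bddMeas _).comp (measurable_coord_prod i)).comp hpw).integrable _]
    refine Finset.sum_eq_zero fun i hi => ?_
    have hi' : i ∉ fold a r ∪ fold a s := by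
      rw [mem_fold] at hi
      simp [mem_fold, hi, ht.1, ht.2]
    simp only [Finset.piecewise_eq_of_notMem _ _ _ hi']
    have hG : BddMeas fun p : Ω × (Fin n → Ω) =>
        D (trainIdx a t) (p.1, (fold a r ∪ fold a s).piecewise W p.2) :=
      (hD.bddMeas _).comp (measurable_fst.prodMk (hpw.comp measurable_snd))
    rw [integral_insert_coord P hG (B := trainIdx a t) (fun w V V' h => hD.dependsOn _ w
        fun j hj => ?_) (fun h => mem_trainIdx.1 h (mem_fold.1 hi)),
      integral_prod_symm _ (hG.integrable _)]
    · simp [hD.centered]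
    · by_cases hj' : j ∈ fold a r ∪ fold a s
      · simp only [Finset.piecewise_eq_of_mem _ _ _ hj']
      · simp only [Finset.piecewise_eq_of_notMem _ _ _ hj', h j hj]
  rw [hsplit, ← Finset.sum_subset (Finset.subset_univ ({r, s} : Finset (Fin k)))
    fun t _ ht => hzero t ht, Finset.sum_pair hrs]
  unfold twoFoldSum
  congr 1
  · rw [cexp_sum_fold hD (disjoint_fold_trainIdx a r)]
  · rw [Finset.union_comm, cexp_sum_fold hD (disjoint_fold_trainIdx a s)]

lemma disjoint_fold (a : Fin n → Fin k) {r s : Fin k} (hrs : r ≠ s) :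
    Disjoint (fold a r) (fold a s) := by
  rw [Finset.disjoint_left]
  intro i hi hi'
  exact hrs ((mem_fold.1 hi).symm.trans (mem_fold.1 hi'))

end Folds

/-- `exists_twoFold_threshold` for two folds of a cross-validated sum. -/
lemma exists_fold_threshold {Ω : Type*} [MeasurableSpace Ω] (P : Measure Ω)
    [IsProbabilityMeasure P] (C : ℝ) {ε : ℝ} (hε : 0 < ε) :
    ∃ δ > 0, ∃ N : ℕ, ∀ {n k : ℕ} {D : Finset (Fin n) → Ω × (Fin n → Ω) → ℝ},
      CenteredFamily P C D → ∀ (a : Fin n → Fin k), a ∈ balanced n k → ∀ {r s : Fin k}, r ≠ s →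
      N ≤ (fold a r).card →
      l2 (iid P (Fin n)) (cvSum D a) ≤ δ * √((fold a s).card : ℝ) →
      l2 (P.prod (iid P (Fin n))) (kcexp P (fold a s) (D (trainIdx a r))) ≤ ε := by
  obtain ⟨δ, hδ, N, h⟩ := exists_twoFold_threshold P C hε
  refine ⟨δ, hδ, N + 2, ?_⟩
  intro n k D hD a ha r s hrs hN hS
  have h1 := ha r s
  have h2 := ha s r
  refine h (A := fold a s) (B := fold a r) (g := kcexp P (fold a r) (D (trainIdx a s)))
    (hD.bddMeas _).kcexp (abs_kcexp_le (hD.abs_le _))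
    (integral_kcexp_eq_zero (hD.bddMeas _) (hD.centered _)) dependsOn_kcexp
    (hD.bddMeas _).kcexp (integral_kcexp_eq_zero (hD.bddMeas _) (hD.centered _)) dependsOn_kcexp
    (disjoint_fold a hrs.symm) (by omega) (by omega) (by omega) ?_
  rw [← hD.cexp_cvSum a hrs.symm]
  exact (l2_cexp_le (hD.bddMeas_cvSum a)).trans hS

/-! ### Averages over permutations of the indices -/

section Perm

variable {n k : ℕ}

/-- The average over all permutations of the indices. -/
noncomputable def avgPerm (F : Equiv.Perm (Fin n) → ℝ) : ℝ :=
  (Fintype.card (Equiv.Perm (Fin n)) : ℝ)⁻¹ * ∑ σ, F σ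

lemma avgPerm_mono {F G : Equiv.Perm (Fin n) → ℝ} (h : ∀ σ, F σ ≤ G σ) :
    avgPerm F ≤ avgPerm G :=
  mul_le_mul_of_nonneg_left (Finset.sum_le_sum fun σ _ => h σ) (by positivity)

lemma avgPerm_const (c : ℝ) : avgPerm (fun _ : Equiv.Perm (Fin n) => c) = c := by
  have : (Fintype.card (Equiv.Perm (Fin n)) : ℝ) ≠ 0 := by
    exact_mod_cast Fintype.card_ne_zero
  simp only [avgPerm, Finset.sum_const, Finset.card_univ, nsmul_eq_mul]
  field_simp

lemma avgPerm_add (F G : Equiv.Perm (Fin n) → ℝ) :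
    avgPerm (fun σ => F σ + G σ) = avgPerm F + avgPerm G := by
  simp only [avgPerm, Finset.sum_add_distrib, mul_add]

lemma avgPerm_const_mul (c : ℝ) (F : Equiv.Perm (Fin n) → ℝ) :
    avgPerm (fun σ => c * F σ) = c * avgPerm F := by
  simp only [avgPerm, ← Finset.mul_sum]
  ring

lemma avgPerm_sum {κ : Type*} (s : Finset κ) (F : κ → Equiv.Perm (Fin n) → ℝ) :
    avgPerm (fun σ => ∑ i ∈ s, F i σ) = ∑ i ∈ s, avgPerm (F i) := by
  simp only [avgPerm]
  rw [Finset.sum_comm, Finset.mul_sum]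

lemma avgPerm_nonneg {F : Equiv.Perm (Fin n) → ℝ} (h : ∀ σ, 0 ≤ F σ) : 0 ≤ avgPerm F :=
  mul_nonneg (by positivity) (Finset.sum_nonneg fun σ _ => h σ)

lemma avgPerm_le_sqrt (F : Equiv.Perm (Fin n) → ℝ) :
    avgPerm F ≤ √(avgPerm fun σ => F σ ^ 2) := by
  apply Real.le_sqrt_of_sq_le
  have h := sq_sum_le_card_mul_sum_sq (s := (Finset.univ : Finset (Equiv.Perm (Fin n)))) (f := F)
  have h0 : (0 : ℝ) < Fintype.card (Equiv.Perm (Fin n)) := by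
    exact_mod_cast Fintype.card_pos
  rw [Finset.card_univ] at h
  simp only [avgPerm]
  rw [mul_pow, inv_pow, inv_mul_le_iff₀ (by positivity)]
  refine h.trans (le_of_eq ?_)
  field_simp

lemma avgPerm_mul_left (τ : Equiv.Perm (Fin n)) (F : Equiv.Perm (Fin n) → ℝ) :
    avgPerm (fun σ => F (τ * σ)) = avgPerm F := by
  simp only [avgPerm]
  congr 1
  exact Equiv.sum_comp (Equiv.mulLeft τ) F

/-- The preimage of a finite set under a permutation. -/
def pull (σ : Equiv.Perm (Fin n)) (T : Finset (Fin n)) : Finset (Fin n) :=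
  T.map σ.symm.toEmbedding

lemma mem_pull {σ : Equiv.Perm (Fin n)} {T : Finset (Fin n)} {i : Fin n} :
    i ∈ pull σ T ↔ σ i ∈ T := by
  simp [pull, Finset.mem_map_equiv]

lemma pull_pull (σ τ : Equiv.Perm (Fin n)) (T : Finset (Fin n)) :
    pull σ (pull τ T) = pull (τ * σ) T := by
  ext i
  simp [mem_pull]

lemma card_pull (σ : Equiv.Perm (Fin n)) (T : Finset (Fin n)) : (pull σ T).card = T.card :=
  Finset.card_map _

lemma fold_comp (a : Fin n → Fin k) (σ : Equiv.Perm (Fin n)) (r : Fin k) :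
    fold (a ∘ σ) r = pull σ (fold a r) := by
  ext i
  simp [mem_pull, mem_fold]

lemma trainIdx_comp (a : Fin n → Fin k) (σ : Equiv.Perm (Fin n)) (r : Fin k) :
    trainIdx (a ∘ σ) r = pull σ (trainIdx a r) := by
  ext i
  simp [mem_pull, mem_trainIdx]

lemma comp_mem_balanced {a : Fin n → Fin k} (ha : a ∈ balanced n k) (σ : Equiv.Perm (Fin n)) :
    a ∘ σ ∈ balanced n k := by
  intro r s
  rw [fold_comp, fold_comp, card_pull, card_pull]
  exact ha r s

/-- Two colorings with the same numbers of points of every color differ by a permutation. -/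
lemma exists_perm_comp_eq {c c' : Fin n → Fin 3}
    (h : ∀ y, Fintype.card {i // c' i = y} = Fintype.card {i // c i = y}) :
    ∃ τ : Equiv.Perm (Fin n), ∀ i, c (τ i) = c' i := by
  let E : ∀ y, {i // c' i = y} ≃ {i // c i = y} := fun y => Fintype.equivOfCardEq (h y)
  refine ⟨(Equiv.sigmaFiberEquiv c').symm.trans ((Equiv.sigmaCongrRight E).trans
    (Equiv.sigmaFiberEquiv c)), fun i => ?_⟩
  simp only [Equiv.trans_apply, Equiv.sigmaFiberEquiv, Equiv.coe_fn_symm_mk, Equiv.coe_fn_mk,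
    Equiv.sigmaCongrRight_apply]
  exact (E (c' i) ⟨i, rfl⟩).2

lemma exists_pull_eq {B T T' : Finset (Fin n)} (hT : T ⊆ B) (hT' : T' ⊆ B)
    (h : T.card = T'.card) : ∃ τ : Equiv.Perm (Fin n), pull τ B = B ∧ pull τ T = T' := by
  classical
  have hc : ∀ S ⊆ B, ∀ y : Fin 3,
      Fintype.card {i // (if i ∈ S then 0 else if i ∈ B then 1 else 2 : Fin 3) = y}
        = if y = 0 then S.card else if y = 1 then B.card - S.card else n - B.card := by
    intro S hS y
    rw [Fintype.card_subtype]
    have hS' : ∀ i, i ∈ S → i ∈ B := fun i hi => hS hi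
    have e : (Finset.univ.filter fun i =>
        (if i ∈ S then 0 else if i ∈ B then 1 else 2 : Fin 3) = y)
        = if y = 0 then S else if y = 1 then B \ S else Bᶜ := by
      ext i
      have := hS' i
      fin_cases y <;> by_cases h1 : i ∈ S <;> by_cases h2 : i ∈ B <;> simp_all
    rw [e]
    fin_cases y
    · simp
    · simp [Finset.card_sdiff_of_subset hS]
    · simp [Finset.card_compl]
  obtain ⟨τ, hτ⟩ := exists_perm_comp_eq
    (c := fun i => if i ∈ T then 0 else if i ∈ B then 1 else 2)
    (c' := fun i => if i ∈ T' then 0 else if i ∈ B then 1 else 2) (fun y => by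
      rw [hc T hT, hc T' hT', h])
  refine ⟨τ, ?_, ?_⟩
  · ext i
    have h1 := hτ i
    have h2 := @hT (τ i)
    have h3 := @hT' i
    rw [mem_pull]
    by_cases a1 : τ i ∈ T <;> by_cases a2 : τ i ∈ B <;> by_cases a3 : i ∈ T' <;>
      by_cases a4 : i ∈ B <;> simp_all
  · ext i
    have h1 := hτ i
    have h2 := @hT (τ i)
    have h3 := @hT' i
    rw [mem_pull]
    by_cases a1 : τ i ∈ T <;> by_cases a2 : τ i ∈ B <;> by_cases a3 : i ∈ T' <;>
      by_cases a4 : i ∈ B <;> simp_all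

lemma sum_card_fold (a : Fin n → Fin k) : ∑ r, (fold a r).card = n := by
  have h := Finset.card_eq_sum_card_fiberwise (f := a) (s := Finset.univ) (t := Finset.univ)
    (fun _ _ => by simp)
  simpa [fold] using h.symm

lemma le_two_mul_card_fold {a : Fin n → Fin k} (ha : a ∈ balanced n k) (hn : 2 * k ≤ n)
    (r : Fin k) : n ≤ 2 * k * (fold a r).card := by
  have h : n ≤ k * ((fold a r).card + 1) := by
    calc n = ∑ s, (fold a s).card := (sum_card_fold a).symm
      _ ≤ ∑ _s : Fin k, ((fold a r).card + 1) := Finset.sum_le_sum fun s _ => ha s r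
      _ = _ := by simp
  nlinarith

end Perm

/-! ### Asymptotic linearity forces stability of the trained kernels -/

section Stability

variable {Ω : Type*} [MeasurableSpace Ω] {P : Measure Ω} [IsProbabilityMeasure P] {n k : ℕ}
  {C : ℝ} {D : Finset (Fin n) → Ω × (Fin n → Ω) → ℝ}

/-- The mean square, over all permutations of the indices, of the part of the kernel trained off
fold `r` that depends on the training indices `T`. -/
noncomputable def energy (P : Measure Ω) [IsProbabilityMeasure P]
    (D : Finset (Fin n) → Ω × (Fin n → Ω) → ℝ) (a : Fin n → Fin k) (r : Fin k)
    (T : Finset (Fin n)) : ℝ :=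
  avgPerm fun σ =>
    l2 (P.prod (iid P (Fin n))) (kcexp P (pull σ T) (D (trainIdx (a ∘ σ) r))) ^ 2

/-- The mean square, over all permutations of the indices, of the normalized cross-validated
sum. -/
noncomputable def cvEnergy (P : Measure Ω) [IsProbabilityMeasure P]
    (D : Finset (Fin n) → Ω × (Fin n → Ω) → ℝ) (a : Fin n → Fin k) : ℝ :=
  avgPerm fun σ => l2 (iid P (Fin n)) (cvSum D (a ∘ σ)) ^ 2 / n

/-- By symmetry, only the number of training indices matters. -/
lemma energy_eq_of_card_eq (a : Fin n → Fin k) (r : Fin k) {T T' : Finset (Fin n)}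
    (hT : T ⊆ trainIdx a r) (hT' : T' ⊆ trainIdx a r) (h : T.card = T'.card) :
    energy P D a r T = energy P D a r T' := by
  obtain ⟨τ, hτB, hτT⟩ := exists_pull_eq hT hT' h
  unfold energy
  rw [← avgPerm_mul_left τ]
  congr 1
  ext σ
  have e1 : pull (τ * σ) T = pull σ T' := by rw [← pull_pull, hτT]
  have e2 : trainIdx (a ∘ ⇑(τ * σ)) r = trainIdx (a ∘ ⇑σ) r := by
    rw [trainIdx_comp, trainIdx_comp, ← pull_pull, hτB]
  rw [e1, e2]

lemma energy_mono (hD : CenteredFamily P C D) (a : Fin n → Fin k) (r : Fin k)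
    {T T' : Finset (Fin n)} (h : T ⊆ T') : energy P D a r T ≤ energy P D a r T' := by
  refine avgPerm_mono fun σ => pow_le_pow_left₀ l2_nonneg
    (l2_kcexp_mono (hD.bddMeas _) ?_) 2
  intro i hi
  rw [mem_pull] at hi ⊢
  exact h hi

/-- The averaged form of `CenteredFamily.card_mul_sq_l2_kcexp_le`. -/
lemma CenteredFamily.energy_le (hD : CenteredFamily P C D) (hC : 0 ≤ C) {a : Fin n → Fin k}
    (ha : a ∈ balanced n k) (hn : 2 * k ≤ n) (r : Fin k) {T : Finset (Fin n)}
    (hT : T ⊆ trainIdx a r) (Q Q' : Fin k → Finset (Fin n)) (hQ : ∀ s ≠ r, Disjoint (Q s) (Q' s))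
    (hQT : ∀ s ≠ r, T ∩ fold a s = Q s ∪ Q' s) :
    energy P D a r T ≤ 2 * k * C * (√(cvEnergy P D a) + ∑ s ∈ Finset.univ.erase r,
      (√(energy P D a r (T \ Q s)) + √(energy P D a r (T \ Q' s)))) := by
  have hk : 0 < k := Fin.pos r
  have hn0 : 0 < n := by omega
  have hn0' : (0 : ℝ) < n := by exact_mod_cast hn0
  have hsd : ∀ (σ : Equiv.Perm (Fin n)) (U V : Finset (Fin n)),
      pull σ U \ pull σ V = pull σ (U \ V) := fun σ U V => by
    ext i; simp [mem_pull]
  have hfold : (n : ℝ) ≤ 2 * k * (fold a r).card := by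
    exact_mod_cast le_two_mul_card_fold ha hn r
  have key : ∀ σ : Equiv.Perm (Fin n),
      l2 (P.prod (iid P (Fin n))) (kcexp P (pull σ T) (D (trainIdx (a ∘ σ) r))) ^ 2
      ≤ 2 * k * C * (l2 (iid P (Fin n)) (cvSum D (a ∘ σ)) / √n + ∑ s ∈ Finset.univ.erase r,
        (l2 (P.prod (iid P (Fin n))) (kcexp P (pull σ (T \ Q s)) (D (trainIdx (a ∘ σ) r)))
        + l2 (P.prod (iid P (Fin n)))
          (kcexp P (pull σ (T \ Q' s)) (D (trainIdx (a ∘ σ) r))))) := by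
    intro σ
    have h := hD.card_mul_sq_l2_kcexp_le hC (a ∘ σ) r (T := pull σ T) (by
        rw [trainIdx_comp]; intro i hi; rw [mem_pull] at hi ⊢; exact hT hi)
      (fun s => pull σ (Q s)) (fun s => pull σ (Q' s)) (fun s hs => by
        rw [Finset.disjoint_left]
        intro i hi hi'
        exact Finset.disjoint_left.1 (hQ s hs) (mem_pull.1 hi) (mem_pull.1 hi')) (fun s hs => by
        rw [fold_comp]
        ext i
        have := Finset.ext_iff.1 (hQT s hs) (σ i)
        simpa [mem_pull] using this)
    simp only [hsd] at h
    rw [fold_comp, card_pull] at h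
    set φ := l2 (P.prod (iid P (Fin n))) (kcexp P (pull σ T) (D (trainIdx (a ∘ σ) r))) ^ 2
    set X := l2 (iid P (Fin n)) (cvSum D (a ∘ σ))
    set S' := ∑ s ∈ Finset.univ.erase r,
        (l2 (P.prod (iid P (Fin n))) (kcexp P (pull σ (T \ Q s)) (D (trainIdx (a ∘ σ) r)))
        + l2 (P.prod (iid P (Fin n)))
          (kcexp P (pull σ (T \ Q' s)) (D (trainIdx (a ∘ σ) r))))
    have hφ : 0 ≤ φ := sq_nonneg _
    have e : X / √n * n = √n * X := by
      rw [div_mul_eq_mul_div, mul_comm X, mul_div_right_comm, Real.div_sqrt]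
    have h2 : n * φ ≤ n * (2 * k * C * (X / √n + S')) := by
      calc n * φ ≤ (2 * k * (fold a r).card) * φ := by gcongr
        _ = 2 * k * ((fold a r).card * φ) := by ring
        _ ≤ 2 * k * (C * √n * X + C * n * S') := by gcongr
        _ = 2 * k * C * (√n * X + n * S') := by ring
        _ = 2 * k * C * (X / √n * n + n * S') := by rw [e]
        _ = _ := by ring
    exact le_of_mul_le_mul_left h2 hn0'
  refine (avgPerm_mono key).trans ?_
  rw [avgPerm_const_mul, avgPerm_add, avgPerm_sum]
  refine mul_le_mul_of_nonneg_left ?_ (by positivity)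
  refine add_le_add ?_ (Finset.sum_le_sum fun s _ => ?_)
  · refine (avgPerm_le_sqrt _).trans (le_of_eq ?_)
    simp only [cvEnergy, div_pow, Real.sq_sqrt hn0'.le]
  · rw [avgPerm_add]
    exact add_le_add (avgPerm_le_sqrt _) (avgPerm_le_sqrt _)

/-- Sets of training indices that fit into one fold carry little energy. -/
lemma exists_energy_le_of_card_le (P : Measure Ω) [IsProbabilityMeasure P] (C : ℝ)
    {k : ℕ} (hk : 2 ≤ k) {ε : ℝ} (hε : 0 < ε) :
    ∃ δ > 0, ∃ N : ℕ, ∀ n ≥ N, ∀ {D : Finset (Fin n) → Ω × (Fin n → Ω) → ℝ},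
      CenteredFamily P C D → ∀ a ∈ balanced n k, cvEnergy P D a ≤ δ → ∀ r,
      ∀ T ⊆ trainIdx a r, 2 * k * T.card ≤ n → energy P D a r T ≤ ε := by
  have hk0 : (0 : ℝ) < k := by exact_mod_cast (by omega : 0 < k)
  obtain ⟨δ₀, hδ₀, N₀, h⟩ := exists_fold_threshold P C (ε := √(ε / 2)) (by positivity)
  refine ⟨ε / 2 * δ₀ ^ 2 / (2 * k * (C ^ 2 + 1)), by positivity, 2 * k * (N₀ + 1), ?_⟩
  intro n hn D hD a ha hS r T hT hTn
  have hn2 : 2 * k ≤ n := le_trans (by nlinarith) hn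
  have hn0 : (0 : ℝ) < n := by exact_mod_cast (by omega : 0 < n)
  have hcard := fun s => le_two_mul_card_fold ha hn2 s
  obtain ⟨s, hs⟩ : ∃ s : Fin k, s ≠ r := by
    have : Nontrivial (Fin k) := Fin.nontrivial_iff_two_le.2 hk
    exact exists_ne r
  have hsB : fold a s ⊆ trainIdx a r := fun i hi => mem_trainIdx.2 (by rw [mem_fold.1 hi]; exact hs)
  obtain ⟨T', hT's, hT'c⟩ := Finset.exists_subset_card_eq (s := fold a s) (n := T.card) (by
    have := hcard s
    by_contra! hlt
    have : 2 * k * ((fold a s).card + 1) ≤ 2 * k * T.card := Nat.mul_le_mul_left _ hlt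
    nlinarith)
  -- by symmetry the set may be placed inside another fold
  rw [energy_eq_of_card_eq a r hT (hT's.trans hsB) hT'c.symm]
  refine (energy_mono hD a r hT's).trans ?_
  have key : ∀ σ : Equiv.Perm (Fin n),
      l2 (P.prod (iid P (Fin n))) (kcexp P (pull σ (fold a s)) (D (trainIdx (a ∘ σ) r))) ^ 2
      ≤ ε / 2 + 2 * k * C ^ 2 / δ₀ ^ 2 * (l2 (iid P (Fin n)) (cvSum D (a ∘ σ)) ^ 2 / n) := by
    intro σ
    rw [← fold_comp]
    set X := l2 (iid P (Fin n)) (cvSum D (a ∘ σ)) with hX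
    have hcs : (n : ℝ) ≤ 2 * k * (fold (a ∘ σ) s).card := by
      rw [fold_comp, card_pull]; exact_mod_cast hcard s
    have hφ : l2 (P.prod (iid P (Fin n)))
        (kcexp P (fold (a ∘ σ) s) (D (trainIdx (a ∘ σ) r))) ≤ C :=
      l2_le_of_abs_le (abs_kcexp_le (hD.abs_le _))
    -- for permutations with a large cross-validated sum, Markov's inequality is used instead
    by_cases hXs : X ≤ δ₀ * √((fold (a ∘ σ) s).card : ℝ)
    · have h1 := h hD (a ∘ σ) (comp_mem_balanced ha σ) hs.symm (by
        rw [fold_comp, card_pull]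
        have := hcard r
        by_contra! hlt
        have : 2 * k * ((fold a r).card + 1) ≤ 2 * k * N₀ := Nat.mul_le_mul_left _ hlt
        nlinarith) hXs
      refine (pow_le_pow_left₀ l2_nonneg h1 2).trans ?_
      rw [Real.sq_sqrt (by positivity)]
      have : 0 ≤ 2 * k * C ^ 2 / δ₀ ^ 2 * (X ^ 2 / n) := by positivity
      linarith
    · push Not at hXs
      have h1 : δ₀ ^ 2 * (fold (a ∘ σ) s).card ≤ X ^ 2 := by
        have := pow_le_pow_left₀ (by positivity) hXs.le 2
        rwa [mul_pow, Real.sq_sqrt (by positivity)] at this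
      refine (pow_le_pow_left₀ l2_nonneg hφ 2).trans ?_
      have h2 : 1 ≤ 2 * k / δ₀ ^ 2 * (X ^ 2 / n) := by
        rw [div_mul_div_comm, le_div_iff₀ (by positivity), one_mul]
        nlinarith [sq_nonneg δ₀]
      have h3 : C ^ 2 * 1 ≤ C ^ 2 * (2 * k / δ₀ ^ 2 * (X ^ 2 / n)) :=
        mul_le_mul_of_nonneg_left h2 (sq_nonneg C)
      have h4 : C ^ 2 * (2 * k / δ₀ ^ 2 * (X ^ 2 / n))
          = 2 * k * C ^ 2 / δ₀ ^ 2 * (X ^ 2 / n) := by ring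
      linarith
  refine (avgPerm_mono key).trans ?_
  rw [avgPerm_add, avgPerm_const, avgPerm_const_mul]
  have h1 : 2 * k * C ^ 2 / δ₀ ^ 2 * cvEnergy P D a
      ≤ 2 * k * C ^ 2 / δ₀ ^ 2 * (ε / 2 * δ₀ ^ 2 / (2 * k * (C ^ 2 + 1))) := by gcongr
  have h2 : 2 * k * C ^ 2 / δ₀ ^ 2 * (ε / 2 * δ₀ ^ 2 / (2 * k * (C ^ 2 + 1)))
      = ε / 2 * (C ^ 2 / (C ^ 2 + 1)) := by field_simp
  have h3 : C ^ 2 / (C ^ 2 + 1) ≤ 1 := by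
    rw [div_le_one (by positivity)]; linarith
  have h4 : ε / 2 * (C ^ 2 / (C ^ 2 + 1)) ≤ ε / 2 := mul_le_of_le_one_right (by positivity) h3
  unfold cvEnergy at h1
  linarith

/-- Sets of training indices carry little energy, by induction on `d`: the larger `d`, the larger
sets are admitted, in steps of `n / (4 * k ^ 2)`. By symmetry, a set that is too large for one fold
may be moved so that it contains two disjoint sets of that size from every other fold; then
`CenteredFamily.energy_le` bounds its energy by the energies of sets that are smaller by one step.
For `d = 0` no set is admitted, and for `d = 8 * k ^ 2` all sets are. -/
lemma exists_energy_le_of_card_add_le (P : Measure Ω) [IsProbabilityMeasure P] {C : ℝ}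
    (hC : 0 ≤ C) {k : ℕ} (hk : 2 ≤ k) (d : ℕ) {ε : ℝ} (hε : 0 < ε) :
    ∃ δ > 0, ∃ N : ℕ, ∀ n ≥ N, ∀ {D : Finset (Fin n) → Ω × (Fin n → Ω) → ℝ},
      CenteredFamily P C D → ∀ a ∈ balanced n k, cvEnergy P D a ≤ δ → ∀ r,
      ∀ T ⊆ trainIdx a r, T.card + (8 * k ^ 2 - d) * (n / (4 * k ^ 2)) ≤ n →
      energy P D a r T ≤ ε := by
  classical
  have hk0 : (0 : ℝ) < k := by exact_mod_cast (by omega : 0 < k)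
  induction d generalizing ε with
  | zero =>
    refine ⟨1, one_pos, 8 * k ^ 2 + 1, ?_⟩
    intro n hn D hD a ha _ r T hT hcard
    exfalso
    set q := n / (4 * k ^ 2) with hq
    have hk2 : 0 < 4 * k ^ 2 := by positivity
    have h1 : n < 4 * k ^ 2 * (q + 1) := Nat.lt_mul_div_succ n hk2
    have h2 : 2 ≤ q := by
      rw [hq, Nat.le_div_iff_mul_le hk2]
      omega
    rw [Nat.sub_zero] at hcard
    nlinarith [Nat.mul_le_mul_left (4 * k ^ 2) h2]
  | succ d ih =>
    set ε' : ℝ := (ε / (2 * k * (C + 1) * (1 + 2 * k))) ^ 2 with hε'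
    obtain ⟨δ₁, hδ₁, N₁, h₁⟩ := ih (ε := ε') (by positivity)
    obtain ⟨δ₂, hδ₂, N₂, h₂⟩ := exists_energy_le_of_card_le P C hk hε
    refine ⟨min ε' (min δ₁ δ₂), by positivity, max (2 * k) (max N₁ N₂), ?_⟩
    intro n hn D hD a ha hS r T hT hcard
    have hn2 : 2 * k ≤ n := (le_max_left _ _).trans hn
    have hS0 := hS.trans (min_le_left _ _)
    have hS1 := (hS.trans (min_le_right _ _)).trans (min_le_left _ _)
    have hS2 := (hS.trans (min_le_right _ _)).trans (min_le_right _ _)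
    have hN1 : N₁ ≤ n := ((le_max_left _ _).trans (le_max_right _ _)).trans hn
    have hN2 : N₂ ≤ n := ((le_max_right _ _).trans (le_max_right _ _)).trans hn
    set q := n / (4 * k ^ 2) with hq
    by_cases hsmall : 2 * k * T.card ≤ n
    · exact h₂ n hN2 hD a ha hS2 r T hT hsmall
    push Not at hsmall
    have hq4 : 4 * k ^ 2 * q ≤ n := Nat.mul_div_le n _
    have hcardf := fun s => le_two_mul_card_fold ha hn2 s
    -- two disjoint sets of `q` indices in every fold
    have hR : ∀ s : Fin k, ∃ R R' : Finset (Fin n), R ⊆ fold a s ∧ R' ⊆ fold a s ∧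
        Disjoint R R' ∧ R.card = q ∧ R'.card = q := by
      intro s
      have h2q : 2 * q ≤ (fold a s).card := by
        have := hcardf s
        by_contra! hlt
        have : 2 * k * ((fold a s).card + 1) ≤ 2 * k * (2 * q) := Nat.mul_le_mul_left _ hlt
        nlinarith
      obtain ⟨U, hU, hUc⟩ := Finset.exists_subset_card_eq h2q
      obtain ⟨R, hRU, hRc⟩ := Finset.exists_subset_card_eq (s := U) (n := q) (by omega)
      refine ⟨R, U \ R, hRU.trans hU, Finset.sdiff_subset.trans hU, Finset.disjoint_sdiff, hRc, ?_⟩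
      rw [Finset.card_sdiff_of_subset hRU]
      omega
    choose R R' hRf hRf' hRR hRc hRc' using hR
    set V := (Finset.univ.erase r).biUnion fun s => R s ∪ R' s with hV
    have hVB : V ⊆ trainIdx a r := by
      intro i hi
      obtain ⟨s, hs, hi⟩ := Finset.mem_biUnion.1 hi
      refine mem_trainIdx.2 ?_
      have : a i = s := by
        rcases Finset.mem_union.1 hi with h | h
        · exact mem_fold.1 (hRf s h)
        · exact mem_fold.1 (hRf' s h)
      rw [this]
      exact Finset.ne_of_mem_erase hs
    have hVc : V.card ≤ T.card := by
      have h1 : V.card ≤ k * (2 * q) := by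
        refine Finset.card_biUnion_le.trans ((Finset.sum_le_card_nsmul _ _ (2 * q) ?_).trans ?_)
        · intro s _
          refine (Finset.card_union_le _ _).trans ?_
          rw [hRc, hRc']
          omega
        · rw [smul_eq_mul]
          refine Nat.mul_le_mul_right _ ?_
          exact (Finset.card_le_univ _).trans_eq (Fintype.card_fin k)
      by_contra! hlt
      have : 2 * k * (T.card + 1) ≤ 2 * k * (k * (2 * q)) := Nat.mul_le_mul_left _ (by omega)
      nlinarith
    obtain ⟨T', hVT', hT'B, hT'c⟩ :=
      Finset.exists_subsuperset_card_eq hVB hVc (Finset.card_le_card hT)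
    rw [energy_eq_of_card_eq a r hT hT'B hT'c.symm]
    have hRT : ∀ s ≠ r, R s ⊆ T' := fun s hs i hi =>
      hVT' (Finset.mem_biUnion.2 ⟨s, Finset.mem_erase.2 ⟨hs, Finset.mem_univ _⟩,
        Finset.mem_union_left _ hi⟩)
    have hRT' : ∀ s ≠ r, R' s ⊆ T' := fun s hs i hi =>
      hVT' (Finset.mem_biUnion.2 ⟨s, Finset.mem_erase.2 ⟨hs, Finset.mem_univ _⟩,
        Finset.mem_union_right _ hi⟩)
    have hbound : ∀ U ⊆ T', ∀ U' ⊆ U, q ≤ U'.card → √(energy P D a r (T' \ U))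
        ≤ ε / (2 * k * (C + 1) * (1 + 2 * k)) := by
      intro U hU U' hU' hqU'
      have hqU := hqU'.trans (Finset.card_le_card hU')
      rw [← Real.sqrt_sq (by positivity : (0 : ℝ) ≤ ε / (2 * k * (C + 1) * (1 + 2 * k)))]
      refine Real.sqrt_le_sqrt (h₁ n hN1 hD a ha hS1 r _ (Finset.sdiff_subset.trans hT'B) ?_)
      rw [Finset.card_sdiff_of_subset hU, hT'c, ← hq]
      have h1 : U.card ≤ T.card := hT'c ▸ Finset.card_le_card hU
      have h2 : (8 * k ^ 2 - d) * q ≤ (8 * k ^ 2 - (d + 1)) * q + q := by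
        rw [← Nat.succ_mul]
        exact Nat.mul_le_mul_right _ (by omega)
      omega
    refine (hD.energy_le hC ha hn2 r hT'B R (fun s => (T' ∩ fold a s) \ R s)
      (fun s _ => Finset.disjoint_sdiff) (fun s hs => ?_)).trans ?_
    · rw [Finset.union_sdiff_of_subset]
      exact Finset.subset_inter (hRT s hs) (hRf s)
    · set η := ε / (2 * k * (C + 1) * (1 + 2 * k)) with hη
      have hη0 : 0 ≤ η := by positivity
      have e0 : √(cvEnergy P D a) ≤ η := by
        rw [← Real.sqrt_sq hη0]
        exact Real.sqrt_le_sqrt hS0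
      have e1 : ∀ s ∈ Finset.univ.erase r, √(energy P D a r (T' \ R s))
          + √(energy P D a r (T' \ ((T' ∩ fold a s) \ R s))) ≤ 2 * η := by
        intro s hs
        have hs' := Finset.ne_of_mem_erase hs
        have h1 := hbound (R s) (hRT s hs') (R s) subset_rfl (hRc s).ge
        have h2 := hbound ((T' ∩ fold a s) \ R s)
          (Finset.sdiff_subset.trans Finset.inter_subset_left) (R' s) (fun i hi =>
            Finset.mem_sdiff.2 ⟨Finset.mem_inter.2 ⟨hRT' s hs' hi, hRf' s hi⟩,
              Finset.disjoint_right.1 (hRR s) hi⟩) (hRc' s).ge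
        linarith
      have e2 := Finset.sum_le_card_nsmul _ _ _ e1
      have e3 : ((Finset.univ.erase r).card • (2 * η) : ℝ) ≤ k * (2 * η) := by
        rw [nsmul_eq_mul]
        refine mul_le_mul_of_nonneg_right ?_ (by positivity)
        exact_mod_cast (Finset.card_le_univ _).trans_eq (Fintype.card_fin k)
      calc _ ≤ 2 * k * C * (η + k * (2 * η)) := by
            refine mul_le_mul_of_nonneg_left ?_ (by positivity)
            linarith
        _ ≤ 2 * k * (C + 1) * (η + k * (2 * η)) := by gcongr; linarith
        _ = ε := by rw [hη]; field_simp

/-- **Asymptotic linearity forces stability**: if the normalized cross-validated sums of a bounded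
family of centered kernels are small in mean square over all permutations of a balanced fold
assignment, then so are the trained kernels. -/
theorem exists_stability_threshold (P : Measure Ω) [IsProbabilityMeasure P] {C : ℝ}
    (hC : 0 ≤ C) {k : ℕ} (hk : 2 ≤ k) {ε : ℝ} (hε : 0 < ε) :
    ∃ δ > 0, ∃ N : ℕ, ∀ n ≥ N, ∀ {D : Finset (Fin n) → Ω × (Fin n → Ω) → ℝ},
      CenteredFamily P C D → ∀ a ∈ balanced n k, cvEnergy P D a ≤ δ → ∀ r,
      avgPerm (fun σ => l2 (P.prod (iid P (Fin n))) (D (trainIdx (a ∘ σ) r)) ^ 2) ≤ ε := by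
  obtain ⟨δ, hδ, N, h⟩ := exists_energy_le_of_card_add_le P hC hk (8 * k ^ 2) hε
  refine ⟨δ, hδ, N, fun n hn D hD a ha hS r => ?_⟩
  have h1 := h n hn hD a ha hS r _ subset_rfl (by
    simpa using (Finset.card_le_univ (trainIdx a r)).trans_eq (Fintype.card_fin n))
  unfold energy at h1
  simp_rw [← trainIdx_comp] at h1
  have e : ∀ B, kcexp P B (D B) = D B := fun B => kcexp_eq_self (hD.dependsOn B)
  simpa only [e] using h1

end Stability

/-! ### The central limit theorem for bounded triangular arrays -/

section CLT

variable {Ω : Type*} [MeasurableSpace Ω] {P : Measure Ω} [IsProbabilityMeasure P]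

/-- The second order expansion of the characteristic function of a bounded standardized random
variable, with a bound on the remainder that depends on the bound of the variable only. -/
lemma norm_integral_cexp_sub_le {U : Ω → ℝ} {M : ℝ} (hU : BddMeas U) (hM : ∀ w, |U w| ≤ M)
    (h0 : ∫ w, U w ∂P = 0) (h1 : ∫ w, U w ^ 2 ∂P = 1) {s : ℝ} (hs : |s| * M ≤ 1) :
    ‖∫ w, Complex.exp (s * U w * Complex.I) ∂P - (1 - (s : ℂ) ^ 2 / 2)‖ ≤ (|s| * M) ^ 3 := by
  have hpt : ∀ w, ‖Complex.exp (s * U w * Complex.I)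
      - (1 + s * U w * Complex.I - (s * U w : ℂ) ^ 2 / 2)‖ ≤ (|s| * M) ^ 3 := by
    intro w
    have hn : ‖(s * U w * Complex.I : ℂ)‖ = |s| * |U w| := by simp
    have hsU : |s| * |U w| ≤ |s| * M := mul_le_mul_of_nonneg_left (hM w) (abs_nonneg s)
    have h := Complex.exp_bound' (x := s * U w * Complex.I) (n := 3) (by
      rw [hn]
      push_cast
      linarith)
    have e : ∑ m ∈ Finset.range 3, (s * U w * Complex.I : ℂ) ^ m / (m.factorial : ℂ)
        = 1 + s * U w * Complex.I - (s * U w : ℂ) ^ 2 / 2 := by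
      simp [Finset.sum_range_succ, mul_pow]
      ring
    rw [e, hn] at h
    refine h.trans ?_
    have h3 : (|s| * |U w|) ^ 3 ≤ (|s| * M) ^ 3 := pow_le_pow_left₀ (by positivity) hsU 3
    have h4 : (0 : ℝ) ≤ (|s| * |U w|) ^ 3 := by positivity
    have h5 : ((3 : ℕ).factorial : ℝ) = 6 := by norm_num [Nat.factorial]
    rw [h5]
    linarith
  have hUi := hU.integrable P
  have hU2i := (hU.pow 2).integrable P
  have hUc : Integrable (fun w => (U w : ℂ)) P := hUi.ofReal
  have hU2c : Integrable (fun w => ((U w ^ 2 : ℝ) : ℂ)) P := hU2i.ofReal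
  have hexp : Integrable (fun w => Complex.exp (s * U w * Complex.I)) P := by
    refine Integrable.of_bound ?_ 1 (ae_of_all _ fun w => ?_)
    · have := hU.measurable
      exact (by fun_prop : Measurable fun w => Complex.exp (s * U w * Complex.I)).aestronglyMeasurable
    · rw [← Complex.ofReal_mul, Complex.norm_exp_ofReal_mul_I]
  have hpoly : Integrable (fun w => (1 + s * U w * Complex.I - (s * U w : ℂ) ^ 2 / 2)) P := by
    refine ((integrable_const _).add ((hUc.const_mul _).mul_const _)).sub ?_
    have : (fun w => (s * U w : ℂ) ^ 2 / 2)
        = fun w => (s : ℂ) ^ 2 / 2 * ((U w ^ 2 : ℝ) : ℂ) := by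
      ext w; push_cast; ring
    rw [this]
    exact hU2c.const_mul _
  have hval : ∫ w, (1 + s * U w * Complex.I - (s * U w : ℂ) ^ 2 / 2) ∂P = 1 - (s : ℂ) ^ 2 / 2 := by
    have e : ∀ w, (1 + s * U w * Complex.I - (s * U w : ℂ) ^ 2 / 2)
        = 1 + (s * Complex.I) * (U w : ℂ) - (s : ℂ) ^ 2 / 2 * ((U w ^ 2 : ℝ) : ℂ) := fun w => by
      push_cast; ring
    simp_rw [e]
    have i1 : ∫ w, (U w : ℂ) ∂P = 0 := by
      have : ∫ w, (U w : ℂ) ∂P = ((∫ w, U w ∂P : ℝ) : ℂ) := integral_ofReal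
      rw [this, h0, Complex.ofReal_zero]
    have i2 : ∫ w, ((U w ^ 2 : ℝ) : ℂ) ∂P = 1 := by
      have : ∫ w, ((U w ^ 2 : ℝ) : ℂ) ∂P = ((∫ w, U w ^ 2 ∂P : ℝ) : ℂ) := integral_ofReal
      rw [this, h1, Complex.ofReal_one]
    have hlin : Integrable (fun w => 1 + (s * Complex.I) * (U w : ℂ)) P :=
      (integrable_const _).add (hUc.const_mul _)
    rw [integral_sub hlin (hU2c.const_mul _),
      integral_add (integrable_const _) (hUc.const_mul _), integral_const_mul,
      integral_const_mul, i1, i2]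
    simp
  rw [← hval, ← integral_sub hexp hpoly]
  simpa using norm_integral_le_of_norm_le_const (μ := P) (ae_of_all _ hpt)

/-- The law of the normalized sum `n^{-1/2} ∑ᵢ U(Wᵢ)` of an i.i.d. sample. -/
noncomputable def sumLaw (P : Measure Ω) (U : Ω → ℝ) (n : ℕ) : Measure ℝ :=
  (iid P (Fin n)).map fun W => (√(n : ℝ))⁻¹ * ∑ i, U (W i)

lemma measurable_normalized_sum {U : Ω → ℝ} (hU : Measurable U) (n : ℕ) :
    Measurable fun W : Fin n → Ω => (√(n : ℝ))⁻¹ * ∑ i, U (W i) :=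
  (Finset.measurable_sum _ fun i _ => hU.comp (measurable_pi_apply i)).const_mul _

lemma charFun_sumLaw {U : Ω → ℝ} (hU : Measurable U) (n : ℕ) (t : ℝ) :
    charFun (sumLaw P U n) t
      = (∫ w, Complex.exp (((√(n : ℝ))⁻¹ * t : ℝ) * U w * Complex.I) ∂P) ^ n := by
  rw [charFun_apply_real, sumLaw, integral_map (measurable_normalized_sum hU n).aemeasurable]
  · have h := integral_fintype_prod_eq_pow (ι := Fin n) (μ := P)
      (fun w => Complex.exp (((√(n : ℝ))⁻¹ * t : ℝ) * U w * Complex.I))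
    rw [Fintype.card_fin] at h
    rw [← h]
    refine integral_congr_ae (ae_of_all _ fun W => ?_)
    simp only
    rw [← Complex.exp_sum]
    congr 1
    push_cast
    rw [Finset.mul_sum, Finset.mul_sum, Finset.sum_mul]
    exact Finset.sum_congr rfl fun i _ => by ring
  · exact (by fun_prop : Measurable fun x : ℝ =>
      Complex.exp (t * x * Complex.I)).aestronglyMeasurable

/-- The upper tail probabilities of the standard normal law. -/
noncomputable def gaussianTail (x : ℝ) : ℝ := (gaussianReal 0 1).real (Set.Ici x)

/-- The **central limit theorem** for triangular arrays whose rows are i.i.d., standardized and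
uniformly bounded. -/
theorem tendsto_sumLaw {U : ℕ → Ω → ℝ} {M : ℝ} (hU : ∀ n, Measurable (U n))
    (hM : ∀ᶠ n in atTop, ∀ w, |U n w| ≤ M) (h0 : ∀ᶠ n in atTop, ∫ w, U n w ∂P = 0)
    (h1 : ∀ᶠ n in atTop, ∫ w, U n w ^ 2 ∂P = 1) (x : ℝ) :
    Tendsto (fun n => (iid P (Fin n)).real {W | x ≤ (√(n : ℝ))⁻¹ * ∑ i, U n (W i)}) atTop
      (𝓝 (gaussianTail x)) := by
  have hprob : ∀ n, IsProbabilityMeasure (sumLaw P (U n) n) := fun n =>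
    Measure.isProbabilityMeasure_map (measurable_normalized_sum (hU n) n).aemeasurable
  let ν : ℕ → ProbabilityMeasure ℝ := fun n => ⟨sumLaw P (U n) n, hprob n⟩
  have hν : Tendsto ν atTop (𝓝 ⟨gaussianReal 0 1, inferInstance⟩) := by
    refine ProbabilityMeasure.tendsto_iff_tendsto_charFun.2 fun t => ?_
    have hlim : charFun (gaussianReal 0 1) t = Complex.exp (-(t : ℂ) ^ 2 / 2) := by
      simp [charFun_gaussianReal, neg_div]
    simp only [ProbabilityMeasure.coe_mk]
    rw [hlim]
    have e : (fun n => charFun (ν n : Measure ℝ) t) = fun n : ℕ =>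
        (∫ w, Complex.exp (((√(n : ℝ))⁻¹ * t : ℝ) * U n w * Complex.I) ∂P) ^ n := by
      ext n
      exact charFun_sumLaw (hU n) n t
    rw [e]
    apply Complex.tendsto_pow_exp_of_isLittleO_sub_add_div
    have hsq : Tendsto (fun n : ℕ => (√(n : ℝ))⁻¹) atTop (𝓝 0) :=
      tendsto_inv_atTop_zero.comp (Real.tendsto_sqrt_atTop.comp tendsto_natCast_atTop_atTop)
    have hsmall : Tendsto (fun n : ℕ => |(√(n : ℝ))⁻¹ * t| * M) atTop (𝓝 0) := by
      have := ((hsq.mul_const t).abs).mul_const M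
      simpa using this
    have hO : (fun n : ℕ => ∫ w, Complex.exp (((√(n : ℝ))⁻¹ * t : ℝ) * U n w * Complex.I) ∂P
        - (1 + -(t : ℂ) ^ 2 / 2 / n)) =O[atTop]
        fun n : ℕ => (√(n : ℝ))⁻¹ * (1 / (n : ℝ)) := by
      refine Asymptotics.IsBigO.of_bound ((|t| * M) ^ 3) ?_
      filter_upwards [hM, h0, h1, hsmall.eventually_le_const one_pos, eventually_gt_atTop 0]
        with n hMn h0n h1n hsn hn
      have hn' : (0 : ℝ) < n := by exact_mod_cast hn
      have h := norm_integral_cexp_sub_le (P := P) ⟨hU n, M, hMn⟩ hMn h0n h1n hsn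
      have e2 : (1 - (((√(n : ℝ))⁻¹ * t : ℝ) : ℂ) ^ 2 / 2) = (1 + -(t : ℂ) ^ 2 / 2 / n) := by
        rw [← Complex.ofReal_pow, mul_pow, inv_pow, Real.sq_sqrt hn'.le]
        push_cast
        field_simp
        ring
      rw [e2] at h
      refine h.trans (le_of_eq ?_)
      rw [Real.norm_of_nonneg (by positivity), abs_mul, abs_of_nonneg (by positivity)]
      have e3 : (√(n : ℝ))⁻¹ ^ 3 = (√(n : ℝ))⁻¹ * (1 / (n : ℝ)) := by
        rw [pow_succ', inv_pow, Real.sq_sqrt hn'.le, one_div]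
      rw [← e3]
      ring
    refine hO.trans_isLittleO ?_
    have hlo : (fun n : ℕ => (√(n : ℝ))⁻¹ * (1 / (n : ℝ))) =o[atTop]
        fun n : ℕ => (1 : ℝ) * (1 / (n : ℝ)) :=
      ((Asymptotics.isLittleO_one_iff ℝ).2 hsq).mul_isBigO (Asymptotics.isBigO_refl _ _)
    refine hlo.trans_le fun n => ?_
    simp
  have := nullSingletonClass_gaussianReal (μ := 0) (v := 1) one_ne_zero
  have h : Tendsto (fun n => (ν n : Measure ℝ) (Set.Ici x)) atTop
      (𝓝 (gaussianReal 0 1 (Set.Ici x))) :=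
    ProbabilityMeasure.tendsto_measure_of_null_frontier_of_tendsto' hν
      (by simp only [ProbabilityMeasure.coe_mk, frontier_Ici, measure_singleton])
  have h2 := (ENNReal.tendsto_toReal (measure_ne_top _ _)).comp h
  refine h2.congr fun n => ?_
  simp only [Function.comp_apply, ν, ProbabilityMeasure.coe_mk]
  rw [sumLaw, Measure.map_apply (measurable_normalized_sum (hU n) n) measurableSet_Ici]
  rfl

lemma gaussianTail_eq (x : ℝ) : gaussianTail x = 1 - cdf (gaussianReal 0 1) x := by
  have := nullSingletonClass_gaussianReal (μ := 0) (v := 1) one_ne_zero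
  have h := measureReal_compl (μ := gaussianReal 0 1) (s := Set.Iic x) measurableSet_Iic
  rw [probReal_univ, Set.compl_Iic] at h
  rw [gaussianTail, cdf_eq_real, ← h]
  exact measureReal_congr Ioi_ae_eq_Ici.symm

lemma continuous_gaussianTail : Continuous gaussianTail := by
  have := nullSingletonClass_gaussianReal (μ := 0) (v := 1) one_ne_zero
  have : gaussianTail = fun x => 1 - cdf (gaussianReal 0 1) x := funext gaussianTail_eq
  rw [this]
  refine continuous_const.sub (continuous_iff_continuousAt.2 fun x => ?_)
  have hm := (cdf (gaussianReal 0 1)).measure_singleton x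
  rw [measure_cdf, measure_singleton] at hm
  rw [(cdf (gaussianReal 0 1)).mono.continuousAt_iff_leftLim_eq_rightLim,
    StieltjesFunction.rightLim_eq]
  have h1 := ENNReal.ofReal_eq_zero.1 hm.symm
  have h2 := (cdf (gaussianReal 0 1)).mono.leftLim_le (le_refl x)
  linarith

lemma gaussianTail_neg (x : ℝ) : gaussianTail (-x) = cdf (gaussianReal 0 1) x := by
  have h : (gaussianReal 0 1).map (fun x => -x) = gaussianReal 0 1 := by
    rw [gaussianReal_map_neg, neg_zero]
  rw [gaussianTail, cdf_eq_real]
  conv_lhs => rw [← h]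
  rw [map_measureReal_apply measurable_neg measurableSet_Ici]
  congr 1
  ext y
  simp

/-- A form of Slutsky's lemma for tail probabilities on varying probability spaces. -/
lemma tendsto_tail_add {X : ℕ → Type*} [∀ n, MeasurableSpace (X n)] (μ : ∀ n, Measure (X n))
    [∀ n, IsProbabilityMeasure (μ n)] {Y R : ∀ n, X n → ℝ} {G : ℝ → ℝ} (hG : Continuous G)
    (hY : ∀ x, Tendsto (fun n => (μ n).real {w | x ≤ Y n w}) atTop (𝓝 (G x)))
    (hR : ∀ ε > 0, Tendsto (fun n => (μ n).real {w | ε ≤ |R n w|}) atTop (𝓝 0)) (x : ℝ) :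
    Tendsto (fun n => (μ n).real {w | x ≤ Y n w + R n w}) atTop (𝓝 (G x)) := by
  have key : ∀ ε > 0, ∀ n, (μ n).real {w | x + ε ≤ Y n w} - (μ n).real {w | ε ≤ |R n w|}
      ≤ (μ n).real {w | x ≤ Y n w + R n w} ∧ (μ n).real {w | x ≤ Y n w + R n w}
      ≤ (μ n).real {w | x - ε ≤ Y n w} + (μ n).real {w | ε ≤ |R n w|} := by
    intro ε hε n
    constructor
    · rw [sub_le_iff_le_add]
      refine (measureReal_mono ?_).trans (measureReal_union_le _ _)
      intro w hw
      simp only [Set.mem_union, Set.mem_ofPred_eq] at hw ⊢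
      by_contra! h
      have := neg_abs_le (R n w)
      linarith
    · refine (measureReal_mono ?_).trans (measureReal_union_le _ _)
      intro w hw
      simp only [Set.mem_union, Set.mem_ofPred_eq] at hw ⊢
      by_contra! h
      have := le_abs_self (R n w)
      linarith
  rw [Metric.tendsto_nhds]
  intro η hη
  obtain ⟨ε, hε, hGε⟩ := Metric.continuous_iff.1 hG x (η / 3) (by positivity)
  have hp := hGε (x + ε / 2) (by simp [abs_of_pos hε, hε])
  have hm := hGε (x - ε / 2) (by simp [abs_of_pos hε, hε])
  have h1 := Metric.tendsto_nhds.1 (hY (x + ε / 2)) (η / 3) (by positivity)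
  have h2 := Metric.tendsto_nhds.1 (hY (x - ε / 2)) (η / 3) (by positivity)
  have h3 := Metric.tendsto_nhds.1 (hR (ε / 2) (by positivity)) (η / 3) (by positivity)
  filter_upwards [h1, h2, h3] with n h1 h2 h3
  rw [Real.dist_eq, abs_lt] at *
  have := key (ε / 2) (by positivity) n
  constructor <;> linarith [this.1, this.2, h1.1, h1.2, h2.1, h2.2, h3.1, h3.2]

end CLT

/-! ### The classification loss and the expected total variation -/

section Population

variable {𝒳 𝒴 𝒵 : Type*} [MeasurableSpace 𝒳] [MeasurableSpace 𝒴] [MeasurableSpace 𝒵]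

section PointMass

variable [Countable 𝒴] [DiscreteMeasurableSpace 𝒴] (P P' : Measure 𝒴) [IsProbabilityMeasure P]
  [IsProbabilityMeasure P']

lemma hasSum_real_singleton_mul {φ : 𝒴 → ℝ} {C : ℝ} (hφ : ∀ y, |φ y| ≤ C) :
    HasSum (fun y => P.real {y} * φ y) (∫ y, φ y ∂P) := by
  have hi : Integrable φ P := Integrable.of_bound
    (measurable_of_countable φ).aestronglyMeasurable C (ae_of_all _ hφ)
  have h := hasSum_integral_iUnion (μ := P) (f := φ) (s := fun y : 𝒴 => {y})
    (fun y => measurableSet_singleton y)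
    (fun i j hij => Set.disjoint_singleton.2 hij) hi.integrableOn
  have hU : (⋃ y : 𝒴, {y}) = (Set.univ : Set 𝒴) := Set.iUnion_of_singleton 𝒴
  rw [hU, setIntegral_univ] at h
  simpa only [integral_singleton, smul_eq_mul] using h

/-- Both laws have total mass one, so subtracting `1/2` from the function has no effect. -/
lemma hasSum_integral_sub_integral {φ : 𝒴 → ℝ} (hφ : ∀ y, φ y ∈ Set.Icc (0 : ℝ) 1) :
    HasSum (fun y => (P.real {y} - P'.real {y}) * (φ y - 1 / 2)) (∫ y, φ y ∂P - ∫ y, φ y ∂P') := by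
  have hb : ∀ y, |φ y - 1 / 2| ≤ 1 := fun y => by
    rw [abs_le]; constructor <;> linarith [(hφ y).1, (hφ y).2]
  have h := (hasSum_real_singleton_mul P hb).sub (hasSum_real_singleton_mul P' hb)
  have hi : ∀ (ν : Measure 𝒴) [IsProbabilityMeasure ν], Integrable φ ν := fun ν _ =>
    Integrable.of_bound (measurable_of_countable φ).aestronglyMeasurable 1
      (ae_of_all _ fun y => by rw [Real.norm_eq_abs, abs_le]; constructor <;>
        linarith [(hφ y).1, (hφ y).2])
  rw [integral_sub (hi P) (integrable_const _), integral_sub (hi P') (integrable_const _)] at h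
  simp only [integral_const, probReal_univ, smul_eq_mul, sub_sub_sub_cancel_right] at h
  simpa only [← sub_mul] using h

lemma summable_abs_real_singleton_sub :
    Summable fun y => |P.real {y} - P'.real {y}| := by
  have h : ∀ (ν : Measure 𝒴) [IsProbabilityMeasure ν], Summable fun y => ν.real {y} := fun ν _ => by
    simpa using (hasSum_real_singleton_mul ν (φ := fun _ => 1) (C := 1) (by simp)).summable
  exact ((h P).sub (h P')).abs

/-- A function with values in `[0, 1]` separates two laws by at most their total variation
distance. -/
lemma integral_sub_integral_le_tvDist {φ : 𝒴 → ℝ} (hφ : ∀ y, φ y ∈ Set.Icc (0 : ℝ) 1) :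
    ∫ y, φ y ∂P - ∫ y, φ y ∂P' ≤ tvDist P P' := by
  have h := hasSum_integral_sub_integral P P' hφ
  refine hasSum_le (fun y => ?_) h
    ((summable_abs_real_singleton_sub P P').hasSum.mul_left (1 / 2))
  refine (le_abs_self _).trans ?_
  rw [abs_mul, mul_comm]
  refine mul_le_mul_of_nonneg_right ?_ (abs_nonneg _)
  rw [abs_le]; constructor <;> linarith [(hφ y).1, (hφ y).2]

open Classical in
/-- The total variation distance is attained by the indicator of the points at which the first
probability mass function is larger. -/
lemma tvDist_eq : tvDist P P' = ∫ y, (if P'.real {y} < P.real {y} then (1 : ℝ) else 0) ∂P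
    - ∫ y, (if P'.real {y} < P.real {y} then (1 : ℝ) else 0) ∂P' := by
  have h := hasSum_integral_sub_integral P P'
    (φ := fun y => if P'.real {y} < P.real {y} then (1 : ℝ) else 0)
    (fun y => by split_ifs <;> norm_num)
  refine HasSum.unique ((summable_abs_real_singleton_sub P P').hasSum.mul_left (1 / 2)) ?_
  refine h.congr_fun fun y => ?_
  split_ifs with hy
  · rw [abs_of_pos (sub_pos.2 hy)]; ring
  · rw [abs_of_nonpos (sub_nonpos.2 (not_lt.1 hy))]; ring

end PointMass

variable (μZ : Measure 𝒵) [IsProbabilityMeasure μZ] (Q : Kernel 𝒵 𝒳) [IsMarkovKernel Q]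
  (R : Kernel (𝒵 × 𝒳) 𝒴) [IsMarkovKernel R] {J : ℕ}

instance : IsMarkovKernel (condYZ Q R) := by
  unfold condYZ; infer_instance

instance : IsMarkovKernel (resample Q J) := ⟨fun z => by
  change IsProbabilityMeasure (Measure.pi fun _ => Q z); infer_instance⟩

lemma measurable_obs :
    Measurable fun t : 𝒵 × (𝒳 × 𝒴) × (Fin J → 𝒳) => (t.2.1.1, t.2.2, t.2.1.2, t.1) := by
  fun_prop

instance : IsProbabilityMeasure (obsLaw μZ Q R J) :=
  Measure.isProbabilityMeasure_map measurable_obs.aemeasurable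

lemma integral_obsLaw {F : Obs 𝒳 𝒴 𝒵 J → ℝ} (hF : BddMeas F) :
    ∫ w, F w ∂(obsLaw μZ Q R J)
      = ∫ z, ∫ p, F (p.1.1, p.2, p.1.2, z) ∂(((Q ⊗ₖ R) z).prod (resample Q J z)) ∂μZ := by
  rw [obsLaw, integral_map measurable_obs.aemeasurable hF.measurable.aestronglyMeasurable,
    Measure.integral_compProd ((hF.comp measurable_obs).integrable _)]
  simp only [Kernel.prod_apply]

lemma bddMeas_integral_kernel {α β : Type*} [MeasurableSpace α] [MeasurableSpace β]
    (κ : Kernel α β) [IsMarkovKernel κ] {F : α × β → ℝ} (hF : BddMeas F) :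
    BddMeas fun a => ∫ b, F (a, b) ∂(κ a) := by
  obtain ⟨hm, C, hC⟩ := hF
  exact ⟨(hm.stronglyMeasurable.integral_kernel_prod_right' (κ := κ)).measurable, C,
    fun a => abs_integral_le_of_abs_le fun b => hC _⟩

variable {g : 𝒳 × 𝒴 × 𝒵 → ℝ}

lemma bddMeas_integral_condXYZ (hg : BddMeas g) :
    BddMeas fun t : 𝒵 × 𝒳 => ∫ y, g (t.2, y, t.1) ∂(R t) :=
  bddMeas_integral_kernel R
    (hg.comp (φ := fun p : (𝒵 × 𝒳) × 𝒴 => (p.1.2, p.2, p.1.1)) (by fun_prop))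

lemma bddMeas_integral_condYZ (hg : BddMeas g) :
    BddMeas fun t : 𝒵 × 𝒳 => ∫ y, g (t.2, y, t.1) ∂(condYZ Q R t.1) :=
  bddMeas_integral_kernel ((condYZ Q R).comap Prod.fst measurable_fst)
    (hg.comp (φ := fun p : (𝒵 × 𝒳) × 𝒴 => (p.1.2, p.2, p.1.1)) (by fun_prop))

/-- The mean of a classifier over the joint law of `(X, Y, Z)`. -/
lemma integral_obsLaw_original (hg : BddMeas g) :
    ∫ w : Obs 𝒳 𝒴 𝒵 J, g (w.1, w.2.2.1, w.2.2.2) ∂(obsLaw μZ Q R J)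
      = ∫ t, ∫ y, g (t.2, y, t.1) ∂(R t) ∂(μZ ⊗ₘ Q) := by
  rw [integral_obsLaw μZ Q R (hg.comp (φ := fun w : Obs 𝒳 𝒴 𝒵 J => (w.1, w.2.2.1, w.2.2.2))
    (by fun_prop)), Measure.integral_compProd ((bddMeas_integral_condXYZ R hg).integrable _)]
  refine integral_congr_ae (ae_of_all _ fun z => ?_)
  simp only
  rw [integral_fun_fst (fun p : 𝒳 × 𝒴 => g (p.1, p.2, z)), probReal_univ, one_smul,
    ProbabilityTheory.integral_compProd ((hg.comp (φ := fun p : 𝒳 × 𝒴 => (p.1, p.2, z))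
      (by fun_prop)).integrable _)]

/-- The mean of a classifier over the law in which `X` is replaced by a resample: given `Z`, the
resample is independent of `Y`. -/
lemma integral_obsLaw_resample (hg : BddMeas g) (j : Fin J) :
    ∫ w : Obs 𝒳 𝒴 𝒵 J, g (w.2.1 j, w.2.2.1, w.2.2.2) ∂(obsLaw μZ Q R J)
      = ∫ t, ∫ y, g (t.2, y, t.1) ∂(condYZ Q R t.1) ∂(μZ ⊗ₘ Q) := by
  rw [integral_obsLaw μZ Q R (hg.comp (φ := fun w : Obs 𝒳 𝒴 𝒵 J => (w.2.1 j, w.2.2.1, w.2.2.2))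
    (by fun_prop)), Measure.integral_compProd ((bddMeas_integral_condYZ Q R hg).integrable _)]
  refine integral_congr_ae (ae_of_all _ fun z => ?_)
  simp only
  have hz : BddMeas fun p : 𝒳 × 𝒴 => g (p.1, p.2, z) :=
    hg.comp (φ := fun p : 𝒳 × 𝒴 => (p.1, p.2, z)) (by fun_prop)
  rw [integral_prod _ ((hz.comp (φ := fun p : (𝒳 × 𝒴) × (Fin J → 𝒳) => (p.2 j, p.1.2))
    (by fun_prop)).integrable _)]
  have h1 : ∀ p : 𝒳 × 𝒴, ∫ xs, g (xs j, p.2, z) ∂(resample Q J z) = ∫ x, g (x, p.2, z) ∂(Q z) :=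
    fun p => integral_comp_of_measurePreserving
      (measurePreserving_eval (fun _ : Fin J => Q z) j)
      (hz.comp (φ := fun x : 𝒳 => (x, p.2)) (by fun_prop))
  simp only [h1]
  have h2 : ∫ p : 𝒳 × 𝒴, ∫ x, g (x, p.2, z) ∂(Q z) ∂((Q ⊗ₖ R) z)
      = ∫ y, ∫ x, g (x, y, z) ∂(Q z) ∂(condYZ Q R z) := by
    rw [condYZ, Kernel.snd_apply, integral_map measurable_snd.aemeasurable
      (hz.integral_left (Q z)).measurable.aestronglyMeasurable]
  rw [h2]
  exact (integral_integral_swap (f := fun x y => g (x, y, z)) (hz.integrable _)).symm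

lemma bddMeas_of_mem_Icc {α : Type*} [MeasurableSpace α] {g : α → ℝ} (hg : Measurable g)
    (h : ∀ t, g t ∈ Set.Icc (0 : ℝ) 1) : BddMeas g :=
  ⟨hg, 1, fun t => abs_le.2 ⟨by linarith [(h t).1], (h t).2⟩⟩

/-- The advantage of a classifier given `(Z, X)`: the mean of the classifier under `L(Y | X, Z)` minus
its mean under `L(Y | Z)`. -/
noncomputable def gap (Q : Kernel 𝒵 𝒳) (R : Kernel (𝒵 × 𝒳) 𝒴) (g : 𝒳 × 𝒴 × 𝒵 → ℝ)
    (t : 𝒵 × 𝒳) : ℝ :=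
  ∫ y, g (t.2, y, t.1) ∂(R t) - ∫ y, g (t.2, y, t.1) ∂(condYZ Q R t.1)

lemma bddMeas_gap (hg : BddMeas g) : BddMeas (gap Q R g) :=
  (bddMeas_integral_condXYZ R hg).sub (bddMeas_integral_condYZ Q R hg)

/-- One minus the risk of a classifier is its mean advantage. -/
lemma one_sub_integral_loss (hJ : 1 ≤ J) (hg : Measurable g)
    (h01 : ∀ t, g t ∈ Set.Icc (0 : ℝ) 1) :
    1 - ∫ w : Obs 𝒳 𝒴 𝒵 J, loss g w ∂(obsLaw μZ Q R J) = ∫ t, gap Q R g t ∂(μZ ⊗ₘ Q) := by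
  have hb := bddMeas_of_mem_Icc hg h01
  have e : ∀ w : Obs 𝒳 𝒴 𝒵 J, loss g w = 1 - g (w.1, w.2.2.1, w.2.2.2)
      + (1 / (J : ℝ)) * ∑ j, g (w.2.1 j, w.2.2.1, w.2.2.2) := fun w => by
    rw [loss, abs_of_nonpos (by linarith [(h01 (w.1, w.2.2.1, w.2.2.2)).2]), neg_sub]
    simp only [abs_of_nonneg (h01 _).1]
  have b1 : BddMeas fun w : Obs 𝒳 𝒴 𝒵 J => g (w.1, w.2.2.1, w.2.2.2) :=
    hb.comp (φ := fun w : Obs 𝒳 𝒴 𝒵 J => (w.1, w.2.2.1, w.2.2.2)) (by fun_prop)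
  have b2 : ∀ j, BddMeas fun w : Obs 𝒳 𝒴 𝒵 J => g (w.2.1 j, w.2.2.1, w.2.2.2) := fun j =>
    hb.comp (φ := fun w : Obs 𝒳 𝒴 𝒵 J => (w.2.1 j, w.2.2.1, w.2.2.2)) (by fun_prop)
  have hJ' : (J : ℝ) ≠ 0 := by positivity
  simp_rw [e]
  rw [integral_add (((BddMeas.const 1).sub b1).integrable _)
    (((BddMeas.sum _ fun j _ => b2 j).const_mul _).integrable _),
    integral_sub (integrable_const _) (b1.integrable _), integral_const_mul,
    integral_finsetSum _ fun j _ => (b2 j).integrable _, integral_obsLaw_original μZ Q R hb]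
  simp_rw [integral_obsLaw_resample μZ Q R hb]
  unfold gap
  rw [integral_sub ((bddMeas_integral_condXYZ R hb).integrable _)
    ((bddMeas_integral_condYZ Q R hb).integrable _)]
  simp
  field_simp
  ring

variable [Countable 𝒴] [DiscreteMeasurableSpace 𝒴]

lemma measurable_oracle : Measurable (oracle Q R) := by
  classical
  have h1 : Measurable fun t : 𝒳 × 𝒴 × 𝒵 => (condYZ Q R t.2.2).real {t.2.1} := by
    have : Measurable fun p : (𝒳 × 𝒵) × 𝒴 => (condYZ Q R p.1.2).real {p.2} :=
      measurable_from_prod_countable_left fun y =>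
        (((condYZ Q R).measurable_coe (measurableSet_singleton y)).comp measurable_snd).ennreal_toReal
    exact this.comp (f := fun t : 𝒳 × 𝒴 × 𝒵 => ((t.1, t.2.2), t.2.1)) (by fun_prop)
  have h2 : Measurable fun t : 𝒳 × 𝒴 × 𝒵 => (R (t.2.2, t.1)).real {t.2.1} := by
    have : Measurable fun p : (𝒵 × 𝒳) × 𝒴 => (R p.1).real {p.2} :=
      measurable_from_prod_countable_left fun y =>
        (R.measurable_coe (measurableSet_singleton y)).ennreal_toReal
    exact this.comp (f := fun t : 𝒳 × 𝒴 × 𝒵 => ((t.2.2, t.1), t.2.1)) (by fun_prop)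
  exact Measurable.ite (measurableSet_lt h1 h2) measurable_const measurable_const

lemma oracle_mem_Icc (t : 𝒳 × 𝒴 × 𝒵) : oracle Q R t ∈ Set.Icc (0 : ℝ) 1 := by
  unfold oracle; split_ifs <;> norm_num

lemma tvDist_eq_gap_oracle (t : 𝒵 × 𝒳) :
    tvDist (R t) (condYZ Q R t.1) = gap Q R (oracle Q R) t := tvDist_eq _ _

lemma one_sub_integral_loss_oracle (hJ : 1 ≤ J) :
    1 - ∫ w : Obs 𝒳 𝒴 𝒵 J, loss (oracle Q R) w ∂(obsLaw μZ Q R J)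
      = ∫ t, tvDist (R t) (condYZ Q R t.1) ∂(μZ ⊗ₘ Q) := by
  rw [one_sub_integral_loss μZ Q R hJ (measurable_oracle Q R) (oracle_mem_Icc Q R)]
  simp only [tvDist_eq_gap_oracle]

/-- The population floodgate bound: one minus the risk of any classifier is at most the expected
total variation distance. -/
lemma one_sub_integral_loss_le (hJ : 1 ≤ J) (hg : Measurable g)
    (h01 : ∀ t, g t ∈ Set.Icc (0 : ℝ) 1) :
    1 - ∫ w : Obs 𝒳 𝒴 𝒵 J, loss g w ∂(obsLaw μZ Q R J)
      ≤ ∫ t, tvDist (R t) (condYZ Q R t.1) ∂(μZ ⊗ₘ Q) := by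
  rw [one_sub_integral_loss μZ Q R hJ hg h01]
  refine integral_mono ((bddMeas_gap Q R (bddMeas_of_mem_Icc hg h01)).integrable _) ?_ fun t =>
    integral_sub_integral_le_tvDist _ _ fun y => h01 _
  simp only [tvDist_eq_gap_oracle]
  exact (bddMeas_gap Q R (bddMeas_of_mem_Icc (measurable_oracle Q R)
    (oracle_mem_Icc Q R))).integrable _

lemma normConst_pos (hY : (supportY μZ Q R).Nontrivial) : 0 < normConst μZ Q R := by
  rw [normConst, sub_pos]
  by_cases hf : (supportY μZ Q R).Finite
  · have := hf.to_subtype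
    have h : 1 < (supportY μZ Q R).ncard := Set.one_lt_ncard_iff_nontrivial.2 hY
    exact inv_lt_one_of_one_lt₀ (by exact_mod_cast h)
  · rw [Set.Infinite.ncard hf]; simp

/-- The maximum with `0` in the lower bound does not affect coverage, as `ETV` is nonnegative. -/
lemma lowerBound_le_ETV_iff {n k : ℕ} (hY : (supportY μZ Q R).Nontrivial) (z : ℝ)
    (f : Rule 𝒳 𝒴 𝒵 J) (ω : Sample 𝒳 𝒴 𝒵 J n k) :
    lowerBound (normConst μZ Q R) z f ω ≤ ETV μZ Q R ↔
      1 - (∑ r, foldMean f ω r) / k - z * √((∑ r, foldVar f ω r) / k) / √(n : ℝ)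
        ≤ ∫ t, tvDist (R t) (condYZ Q R t.1) ∂(μZ ⊗ₘ Q) := by
  have hc := normConst_pos μZ Q R hY
  have h0 : 0 ≤ ETV μZ Q R := by
    refine div_nonneg (integral_nonneg fun t => ?_) hc.le
    exact mul_nonneg (by norm_num) (tsum_nonneg fun y => abs_nonneg _)
  rw [lowerBound, max_le_iff, ETV, div_le_div_iff_of_pos_right hc]
  exact ⟨fun h => h.2, fun h => ⟨h0, h⟩⟩

end Population

/-! ### Random balanced fold assignments -/

section Folds

variable {n k : ℕ}

/-- A new index may be put into a smallest fold. -/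
lemma balanced_nonempty (n k : ℕ) [NeZero k] : (balanced n k).Nonempty := by
  induction n with
  | zero => exact ⟨Fin.elim0, fun r s => by simp [fold]⟩
  | succ n ih =>
    obtain ⟨a, ha⟩ := ih
    obtain ⟨r₀, -, hr₀⟩ := Finset.exists_min_image Finset.univ (fun r => (fold a r).card)
      Finset.univ_nonempty
    have h : ∀ r, (fold (Fin.cons r₀ a : Fin (n + 1) → Fin k) r).card
        = (if r₀ = r then 1 else 0) + (fold a r).card := fun r => by
      simp only [fold, Finset.card_filter, Fin.sum_univ_succ, Fin.cons_zero, Fin.cons_succ]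
    refine ⟨Fin.cons r₀ a, fun r s => ?_⟩
    rw [h, h]
    by_cases hr : r₀ = r
    · subst hr
      have := hr₀ s (Finset.mem_univ _)
      rw [if_pos rfl]
      omega
    · have := ha r s
      rw [if_neg hr]
      omega

instance (n k : ℕ) [NeZero k] : IsProbabilityMeasure (uniformOn (balanced n k)) :=
  isProbabilityMeasure_uniformOn (Set.toFinite _) (balanced_nonempty n k)

lemma ae_mem_balanced (n k : ℕ) : ∀ᵐ a ∂(uniformOn (balanced n k)), a ∈ balanced n k := by
  rw [ae_iff]
  exact (uniformOn_eq_zero_iff (Set.toFinite _)).2 (by ext; simp)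

/-- The law of a random balanced fold assignment is invariant under permutations of the indices. -/
lemma measurePreserving_comp_perm (σ : Equiv.Perm (Fin n)) :
    MeasurePreserving (fun a : Fin n → Fin k => a ∘ σ) (uniformOn (balanced n k))
      (uniformOn (balanced n k)) := by
  classical
  refine ⟨Measurable.of_discrete, Measure.ext_of_singleton fun b => ?_⟩
  rw [Measure.map_apply Measurable.of_discrete (measurableSet_singleton b)]
  have e : (fun a : Fin n → Fin k => a ∘ σ) ⁻¹' {b} = {b ∘ σ.symm} := by
    ext a
    simp only [Set.mem_preimage, Set.mem_singleton_iff]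
    exact ⟨fun h => by rw [← h]; ext i; simp, fun h => by rw [h]; ext i; simp⟩
  rw [e, uniformOn, cond_apply (Set.toFinite _).measurableSet,
    cond_apply (Set.toFinite _).measurableSet]
  congr 1
  by_cases hb : b ∈ balanced n k
  · rw [Set.inter_eq_right.2 (Set.singleton_subset_iff.2 hb),
      Set.inter_eq_right.2 (Set.singleton_subset_iff.2 (comp_mem_balanced hb σ.symm))]
    simp
  · have hb' : b ∘ σ.symm ∉ balanced n k := fun h => hb (by
      have := comp_mem_balanced h σ
      rwa [Function.comp_assoc, Equiv.symm_comp_self, Function.comp_id] at this)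
    rw [Set.inter_singleton_eq_empty.2 hb, Set.inter_singleton_eq_empty.2 hb']

lemma bddMeas_of_finite {α : Type*} [MeasurableSpace α] [DiscreteMeasurableSpace α] [Finite α]
    (F : α → ℝ) : BddMeas F := by
  obtain ⟨M, hM⟩ := Set.Finite.bddAbove (Set.finite_range fun a => |F a|)
  exact ⟨Measurable.of_discrete, M, fun a => hM ⟨a, rfl⟩⟩

lemma integral_avgPerm [NeZero k] (F : (Fin n → Fin k) → ℝ) :
    ∫ a, avgPerm (fun σ => F (a ∘ σ)) ∂(uniformOn (balanced n k))
      = ∫ a, F a ∂(uniformOn (balanced n k)) := by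
  unfold avgPerm
  rw [integral_const_mul, integral_finsetSum _ fun σ _ => (bddMeas_of_finite _).integrable _]
  have h : ∀ σ : Equiv.Perm (Fin n), ∫ a, F (a ∘ σ) ∂(uniformOn (balanced n k))
      = ∫ a, F a ∂(uniformOn (balanced n k)) := fun σ =>
    integral_comp_of_measurePreserving (measurePreserving_comp_perm σ) (bddMeas_of_finite F)
  simp only [h]
  have : (Fintype.card (Equiv.Perm (Fin n)) : ℝ) ≠ 0 := by exact_mod_cast Fintype.card_ne_zero
  simp only [Finset.sum_const, Finset.card_univ, nsmul_eq_mul]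
  field_simp

end Folds

/-! ### Fourth moments of cross-validated sums -/

section Moments

variable {Ω : Type*} [MeasurableSpace Ω] {P : Measure Ω} [IsProbabilityMeasure P] {n k : ℕ} {C : ℝ}

/-- **Hoeffding's lemma**. -/
lemma integral_exp_le_of_abs_le {U : Ω → ℝ} (hU : Measurable U) (hC : ∀ w, |U w| ≤ C)
    (h0 : ∫ w, U w ∂P = 0) (t : ℝ) : ∫ w, Real.exp (t * U w) ∂P ≤ Real.exp (C ^ 2 * t ^ 2 / 2) := by
  have h := (hasSubgaussianMGF_of_mem_Icc_of_integral_eq_zero (μ := P) (a := -C) (b := C)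
    hU.aemeasurable (ae_of_all _ fun w => abs_le.1 (hC w)) h0).mgf_le t
  have e : (((‖C - -C‖₊ / 2) ^ 2 : NNReal) : ℝ) = C ^ 2 := by
    push_cast
    rw [Real.norm_eq_abs, div_pow, sq_abs]
    ring
  rwa [e] at h

/-- The exponential moments of a sum over a fold factorize into those of the summands, as the
kernel is independent of the evaluation points. -/
lemma integral_exp_sum_coord_le {D : Ω × (Fin n → Ω) → ℝ} (hD : Measurable D)
    (hC : ∀ p, |D p| ≤ C) (h0 : ∀ W, ∫ w, D (w, W) ∂P = 0) {A B : Finset (Fin n)}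
    (hB : ∀ w, DependsOn (fun W => D (w, W)) B) (hAB : Disjoint A B) (t : ℝ) :
    ∫ W, Real.exp (t * ∑ i ∈ A, D (W i, W)) ∂(iid P (Fin n))
      ≤ Real.exp (A.card * (C ^ 2 * t ^ 2 / 2)) := by
  classical
  have hb : BddMeas D := ⟨hD, C, hC⟩
  induction A using Finset.induction_on with
  | empty => simp
  | insert j A hj ih =>
    have hA : Disjoint A B := Finset.disjoint_of_subset_left (Finset.subset_insert _ _) hAB
    have hjB : j ∉ B := Finset.disjoint_left.1 hAB (Finset.mem_insert_self _ _)
    have hS : BddMeas fun W : Fin n → Ω => Real.exp (t * ∑ i ∈ A, D (W i, W)) :=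
      ((hb.sum_coord A).const_mul t).exp
    have hG : BddMeas fun p : Ω × (Fin n → Ω) =>
        Real.exp (t * D p) * Real.exp (t * ∑ i ∈ A, D (p.2 i, p.2)) :=
      (hb.const_mul t).exp.mul (hS.comp measurable_snd)
    have h := integral_insert_coord P hG (B := A ∪ B) (j := j) (fun w V V' hV => by
      have hVB : ∀ i ∈ (B : Set (Fin n)), V i = V' i := fun i hi => hV i (by
        rw [Finset.coe_union]; exact Or.inr hi)
      have hVA : ∀ i ∈ A, V i = V' i := fun i hi => hV i (by
        rw [Finset.coe_union]; exact Or.inl hi)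
      have hs : ∑ i ∈ A, D (V i, V) = ∑ i ∈ A, D (V' i, V') :=
        Finset.sum_congr rfl fun i hi => by rw [hVA i hi]; exact hB _ hVB
      have hd : D (w, V) = D (w, V') := hB w hVB
      simp only [hs, hd]) (by simp [hj, hjB])
    simp_rw [Finset.sum_insert hj, mul_add, Real.exp_add]
    rw [h, integral_prod_symm _ (hG.integrable _), Finset.card_insert_of_notMem hj]
    simp only [integral_mul_const]
    calc ∫ W, (∫ w, Real.exp (t * D (w, W)) ∂P) * Real.exp (t * ∑ i ∈ A, D (W i, W))
          ∂(iid P (Fin n))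
        ≤ ∫ W, Real.exp (C ^ 2 * t ^ 2 / 2) * Real.exp (t * ∑ i ∈ A, D (W i, W))
          ∂(iid P (Fin n)) := by
          refine integral_mono ((((hb.const_mul t).exp.integral_left P).mul hS).integrable _)
            ((hS.const_mul _).integrable _) fun W => ?_
          exact mul_le_mul_of_nonneg_right (integral_exp_le_of_abs_le
            (hD.comp measurable_prodMk_right) (fun w => hC _) (h0 W) t) (Real.exp_pos _).le
      _ ≤ Real.exp (C ^ 2 * t ^ 2 / 2) * Real.exp (A.card * (C ^ 2 * t ^ 2 / 2)) := by
          rw [integral_const_mul]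
          exact mul_le_mul_of_nonneg_left (ih hA) (Real.exp_pos _).le
      _ = _ := by
          rw [← Real.exp_add]
          push_cast
          congr 1
          ring

lemma pow_four_le_exp_add_exp (x : ℝ) : x ^ 4 ≤ 24 * (Real.exp x + Real.exp (-x)) := by
  have h := Real.pow_div_factorial_le_exp |x| (abs_nonneg x) 4
  have e : ((4 : ℕ).factorial : ℝ) = 24 := by norm_num [Nat.factorial]
  have e2 : |x| ^ 4 = x ^ 4 := by rw [show (4 : ℕ) = 2 * 2 from rfl, pow_mul, sq_abs, ← pow_mul]
  rw [e, e2, div_le_iff₀ (by norm_num)] at h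
  have h1 := Real.exp_abs_le x
  linarith

/-- The fourth moments of a normalized sum over a fold are bounded. -/
lemma integral_sum_coord_pow_four_le {D : Ω × (Fin n → Ω) → ℝ} (hD : Measurable D)
    (hC : ∀ p, |D p| ≤ C) (h0 : ∀ W, ∫ w, D (w, W) ∂P = 0) {A B : Finset (Fin n)}
    (hB : ∀ w, DependsOn (fun W => D (w, W)) B) (hAB : Disjoint A B) :
    ∫ W, ((√(n : ℝ))⁻¹ * ∑ i ∈ A, D (W i, W)) ^ 4 ∂(iid P (Fin n))
      ≤ 48 * Real.exp (C ^ 2 / 2) := by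
  have hb : BddMeas D := ⟨hD, C, hC⟩
  have hS := hb.sum_coord A
  have key : ∀ t : ℝ, t ^ 2 = (n : ℝ)⁻¹ →
      ∫ W, Real.exp (t * ∑ i ∈ A, D (W i, W)) ∂(iid P (Fin n)) ≤ Real.exp (C ^ 2 / 2) := by
    intro t ht
    refine (integral_exp_sum_coord_le hD hC h0 hB hAB t).trans (Real.exp_le_exp.2 ?_)
    have hA : (A.card : ℝ) ≤ n := by
      exact_mod_cast (Finset.card_le_univ A).trans (by simp)
    rw [ht]
    have h1 : (A.card : ℝ) * (n : ℝ)⁻¹ ≤ 1 := by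
      rw [← div_eq_mul_inv]
      exact div_le_one_of_le₀ hA (by positivity)
    calc (A.card : ℝ) * (C ^ 2 * (n : ℝ)⁻¹ / 2) = (A.card * (n : ℝ)⁻¹) * (C ^ 2 / 2) := by ring
      _ ≤ 1 * (C ^ 2 / 2) := mul_le_mul_of_nonneg_right h1 (by positivity)
      _ = _ := one_mul _
  have hsq : (√(n : ℝ))⁻¹ ^ 2 = (n : ℝ)⁻¹ := by rw [inv_pow, Real.sq_sqrt (by positivity)]
  have k1 := key _ hsq
  have k2 := key (-(√(n : ℝ))⁻¹) (by rw [neg_sq, hsq])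
  calc ∫ W, ((√(n : ℝ))⁻¹ * ∑ i ∈ A, D (W i, W)) ^ 4 ∂(iid P (Fin n))
      ≤ ∫ W, 24 * (Real.exp ((√(n : ℝ))⁻¹ * ∑ i ∈ A, D (W i, W))
        + Real.exp (-(√(n : ℝ))⁻¹ * ∑ i ∈ A, D (W i, W))) ∂(iid P (Fin n)) := by
        refine integral_mono (((hS.const_mul _).pow 4).integrable _)
          ((((hS.const_mul _).exp.add (hS.const_mul _).exp).const_mul _).integrable _) fun W => ?_
        simp only [neg_mul]
        exact pow_four_le_exp_add_exp _
    _ ≤ 48 * Real.exp (C ^ 2 / 2) := by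
        rw [integral_const_mul, integral_add ((hS.const_mul _).exp.integrable _)
          ((hS.const_mul _).exp.integrable _)]
        linarith

lemma sum_pow_four_le (x : Fin k → ℝ) : (∑ r, x r) ^ 4 ≤ (k : ℝ) ^ 3 * ∑ r, x r ^ 4 := by
  have h1 := sq_sum_le_card_mul_sum_sq (s := Finset.univ) (f := x)
  have h2 := sq_sum_le_card_mul_sum_sq (s := Finset.univ) (f := fun r => x r ^ 2)
  simp only [Finset.card_univ, Fintype.card_fin, ← pow_mul] at h1 h2
  calc (∑ r, x r) ^ 4 = ((∑ r, x r) ^ 2) ^ 2 := by rw [← pow_mul]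
    _ ≤ (k * ∑ r, x r ^ 2) ^ 2 := pow_le_pow_left₀ (sq_nonneg _) h1 2
    _ = k ^ 2 * (∑ r, x r ^ 2) ^ 2 := mul_pow _ _ _
    _ ≤ k ^ 2 * (k * ∑ r, x r ^ 4) := mul_le_mul_of_nonneg_left h2 (by positivity)
    _ = _ := by ring

lemma integral_cvSum_pow_four_le {D : Finset (Fin n) → Ω × (Fin n → Ω) → ℝ}
    (hD : CenteredFamily P C D) (a : Fin n → Fin k) :
    ∫ W, ((√(n : ℝ))⁻¹ * cvSum D a W) ^ 4 ∂(iid P (Fin n))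
      ≤ k ^ 4 * (48 * Real.exp (C ^ 2 / 2)) := by
  have hb : ∀ r, BddMeas fun W : Fin n → Ω =>
      ((√(n : ℝ))⁻¹ * ∑ i ∈ fold a r, D (trainIdx a r) (W i, W)) ^ 4 := fun r =>
    (((hD.bddMeas _).sum_coord _).const_mul _).pow 4
  calc ∫ W, ((√(n : ℝ))⁻¹ * cvSum D a W) ^ 4 ∂(iid P (Fin n))
      ≤ ∫ W, (k : ℝ) ^ 3 * ∑ r, ((√(n : ℝ))⁻¹ * ∑ i ∈ fold a r, D (trainIdx a r) (W i, W)) ^ 4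
        ∂(iid P (Fin n)) := by
        refine integral_mono ((((hD.bddMeas_cvSum a).const_mul _).pow 4).integrable _)
          (((BddMeas.sum _ fun r _ => hb r).const_mul _).integrable _) fun W => ?_
        rw [cvSum, Finset.mul_sum]
        exact sum_pow_four_le _
    _ ≤ (k : ℝ) ^ 3 * ∑ _r : Fin k, 48 * Real.exp (C ^ 2 / 2) := by
        rw [integral_const_mul, integral_finsetSum _ fun r _ => (hb r).integrable _]
        refine mul_le_mul_of_nonneg_left (Finset.sum_le_sum fun r _ => ?_) (by positivity)
        exact integral_sum_coord_pow_four_le (hD.measurable _) (hD.abs_le _) (hD.centered _)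
          (hD.dependsOn _) (disjoint_fold_trainIdx a r)
    _ = _ := by simp; ring

end Moments

/-! ### Stability of the training under random fold assignments -/

section Stability

variable {Ω : Type*} [MeasurableSpace Ω] {P : Measure Ω} [IsProbabilityMeasure P] {k : ℕ} [NeZero k]
  {C : ℝ} {D : ∀ n, Finset (Fin n) → Ω × (Fin n → Ω) → ℝ}

lemma measurable_uncurry_of_finite {α β : Type*} [MeasurableSpace α] [MeasurableSpace β]
    [DiscreteMeasurableSpace β] [Countable β] {F : β → α → ℝ} (hF : ∀ b, Measurable (F b)) :
    Measurable fun p : α × β => F p.2 p.1 :=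
  measurable_from_prod_countable_left hF

lemma bddMeas_uncurry {α β : Type*} [MeasurableSpace α] [MeasurableSpace β]
    [DiscreteMeasurableSpace β] [Finite β] {F : β → α → ℝ} (hF : ∀ b, BddMeas (F b)) :
    BddMeas fun p : α × β => F p.2 p.1 := by
  choose M hM using fun b => (hF b).bdd
  obtain ⟨K, hK⟩ := Set.Finite.bddAbove (Set.finite_range M)
  exact ⟨measurable_uncurry_of_finite fun b => (hF b).measurable, K,
    fun p => (hM _ _).trans (hK ⟨_, rfl⟩)⟩

/-- As the fourth moments are bounded, convergence of the normalized cross-validated sums to zero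
in probability implies convergence in `L²`. -/
lemma tendsto_integral_cvEnergy (hD : ∀ n, CenteredFamily P C (D n))
    (h : ∀ ε > 0, Tendsto (fun n => ((iid P (Fin n)).prod (uniformOn (balanced n k))).real
      {ω | ε ≤ |(√(n : ℝ))⁻¹ * cvSum (D n) ω.2 ω.1|}) atTop (𝓝 0)) :
    Tendsto (fun n => ∫ a, cvEnergy P (D n) a ∂(uniformOn (balanced n k))) atTop (𝓝 0) := by
  have e : ∀ n, ∫ a, cvEnergy P (D n) a ∂(uniformOn (balanced n k))
      = ∫ ω, ((√(n : ℝ))⁻¹ * cvSum (D n) ω.2 ω.1) ^ 2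
        ∂((iid P (Fin n)).prod (uniformOn (balanced n k))) := by
    intro n
    unfold cvEnergy
    rw [integral_avgPerm (fun a => l2 (iid P (Fin n)) (cvSum (D n) a) ^ 2 / n),
      integral_prod_symm _ ((bddMeas_uncurry (F := fun a W => ((√(n : ℝ))⁻¹ * cvSum (D n) a W) ^ 2)
        fun a => (((hD n).bddMeas_cvSum a).const_mul _).pow 2).integrable _)]
    refine integral_congr_ae (ae_of_all _ fun a => ?_)
    simp only [mul_pow, inv_pow]
    rw [integral_const_mul, l2_sq, Real.sq_sqrt (by positivity)]
    ring
  simp only [e]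
  set K : ℝ := k ^ 4 * (48 * Real.exp (C ^ 2 / 2)) with hK
  have hKpos : 0 < K := by
    have : (0 : ℝ) < k := by exact_mod_cast Nat.pos_of_ne_zero (NeZero.ne k)
    positivity
  rw [Metric.tendsto_nhds]
  intro η hη
  -- `S² ≤ η / 4 + τ * S⁴ + τ⁻¹ * 1{S² ≥ η / 4}`, where `τ` makes the second term at most `η / 4`
  set τ : ℝ := η / (4 * K) with hτ
  have hτ0 : 0 < τ := by positivity
  have h1 := Metric.tendsto_nhds.1 (h (√(η / 4)) (by positivity)) (τ * (η / 4)) (by positivity)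
  filter_upwards [h1] with n hn
  rw [Real.dist_eq, sub_zero, abs_of_nonneg (by positivity)] at hn
  rw [Real.dist_eq, sub_zero, abs_of_nonneg (integral_nonneg fun _ => sq_nonneg _)]
  set μ := (iid P (Fin n)).prod (uniformOn (balanced n k)) with hμ
  set S : (Fin n → Ω) × (Fin n → Fin k) → ℝ := fun ω => (√(n : ℝ))⁻¹ * cvSum (D n) ω.2 ω.1 with hS
  have hSb : BddMeas S := bddMeas_uncurry (F := fun a W => (√(n : ℝ))⁻¹ * cvSum (D n) a W)
    fun a => ((hD n).bddMeas_cvSum a).const_mul _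
  have hset : MeasurableSet {ω | √(η / 4) ≤ |S ω|} :=
    measurableSet_le measurable_const hSb.abs.measurable
  have hind : BddMeas ({ω | √(η / 4) ≤ |S ω|}.indicator fun _ => (1 : ℝ)) := by
    refine ⟨measurable_const.indicator hset, 1, fun ω => ?_⟩
    by_cases hω : ω ∈ {ω | √(η / 4) ≤ |S ω|}
    · rw [Set.indicator_of_mem hω, abs_one]
    · rw [Set.indicator_of_notMem hω, abs_zero]
      exact zero_le_one
  have hpt : ∀ ω, S ω ^ 2 ≤ η / 4 + (τ * S ω ^ 4
      + τ⁻¹ * {ω | √(η / 4) ≤ |S ω|}.indicator (fun _ => (1 : ℝ)) ω) := by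
    intro ω
    by_cases hω : √(η / 4) ≤ |S ω|
    · rw [Set.indicator_of_mem (by exact hω)]
      have h2 : 0 ≤ τ * (S ω ^ 2 - τ⁻¹) ^ 2 := by positivity
      have h3 : τ * (S ω ^ 2 - τ⁻¹) ^ 2 = τ * S ω ^ 4 - 2 * S ω ^ 2 + τ⁻¹ := by
        field_simp
        ring
      nlinarith [sq_nonneg (S ω)]
    · rw [Set.indicator_of_notMem (by exact hω)]
      have h2 : S ω ^ 2 ≤ η / 4 := by
        have h4 := pow_le_pow_left₀ (abs_nonneg _) (not_le.1 hω).le 2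
        rwa [sq_abs, Real.sq_sqrt (by positivity)] at h4
      have : 0 ≤ τ * S ω ^ 4 := by positivity
      linarith
  have h4 : ∫ ω, S ω ^ 4 ∂μ ≤ K := by
    rw [hμ, integral_prod_symm _ ((hSb.pow 4).integrable _)]
    calc ∫ a, ∫ W, S (W, a) ^ 4 ∂(iid P (Fin n)) ∂(uniformOn (balanced n k))
        ≤ ∫ _a, K ∂(uniformOn (balanced n k)) :=
          integral_mono ((bddMeas_of_finite _).integrable _) (integrable_const _)
            fun a => integral_cvSum_pow_four_le (hD n) a
      _ = K := by simp
  calc ∫ ω, S ω ^ 2 ∂μ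
      ≤ ∫ ω, (η / 4 + (τ * S ω ^ 4
        + τ⁻¹ * {ω | √(η / 4) ≤ |S ω|}.indicator (fun _ => (1 : ℝ)) ω)) ∂μ :=
        integral_mono ((hSb.pow 2).integrable _) (((BddMeas.const _).add
          (((hSb.pow 4).const_mul _).add (hind.const_mul _))).integrable _) hpt
    _ = η / 4 + (τ * ∫ ω, S ω ^ 4 ∂μ + τ⁻¹ * μ.real {ω | √(η / 4) ≤ |S ω|}) := by
        rw [integral_add (integrable_const _)
          ((((hSb.pow 4).const_mul _).add (hind.const_mul _)).integrable _),
          integral_add (((hSb.pow 4).const_mul _).integrable _) ((hind.const_mul _).integrable _),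
          integral_const_mul, integral_const_mul, integral_indicator_const _ hset]
        simp
    _ < η := by
        have h5 : τ * ∫ ω, S ω ^ 4 ∂μ ≤ η / 4 := by
          calc τ * ∫ ω, S ω ^ 4 ∂μ ≤ τ * K := mul_le_mul_of_nonneg_left h4 hτ0.le
            _ = η / 4 := by rw [hτ]; field_simp
        have h6 : τ⁻¹ * μ.real {ω | √(η / 4) ≤ |S ω|} < η / 4 := by
          rw [inv_mul_lt_iff₀ hτ0]
          exact hn
        linarith

/-- If the normalized cross-validated sums of centered kernels tend to zero in probability, the
kernels themselves tend to zero in mean square. -/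
theorem tendsto_integral_sq_l2 (hk : 2 ≤ k) (hC : 0 ≤ C) (hD : ∀ n, CenteredFamily P C (D n))
    (h : ∀ ε > 0, Tendsto (fun n => ((iid P (Fin n)).prod (uniformOn (balanced n k))).real
      {ω | ε ≤ |(√(n : ℝ))⁻¹ * cvSum (D n) ω.2 ω.1|}) atTop (𝓝 0)) (r : Fin k) :
    Tendsto (fun n => ∫ a, l2 (P.prod (iid P (Fin n))) (D n (trainIdx a r)) ^ 2
      ∂(uniformOn (balanced n k))) atTop (𝓝 0) := by
  rw [Metric.tendsto_nhds]
  intro η hη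
  obtain ⟨δ, hδ, N, hN⟩ := exists_stability_threshold P hC hk (ε := η / 2) (by positivity)
  have h1 := Metric.tendsto_nhds.1 (tendsto_integral_cvEnergy hD h) (η / 2 / (C ^ 2 + 1) * δ)
    (by positivity)
  filter_upwards [h1, eventually_ge_atTop N] with n hn hnN
  have hE0 : ∀ a : Fin n → Fin k, 0 ≤ cvEnergy P (D n) a := fun a =>
    avgPerm_nonneg fun _ => by positivity
  rw [Real.dist_eq, sub_zero, abs_of_nonneg (integral_nonneg hE0)] at hn
  rw [Real.dist_eq, sub_zero, abs_of_nonneg (integral_nonneg fun _ => sq_nonneg _),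
    ← integral_avgPerm (fun a => l2 (P.prod (iid P (Fin n))) (D n (trainIdx a r)) ^ 2)]
  -- on the exceptional set of fold assignments of large energy, Markov's inequality is used
  have hb : ∀ᵐ a ∂(uniformOn (balanced n k)),
      avgPerm (fun σ => l2 (P.prod (iid P (Fin n))) (D n (trainIdx (a ∘ σ) r)) ^ 2)
        ≤ η / 2 + C ^ 2 / δ * cvEnergy P (D n) a := by
    filter_upwards [ae_mem_balanced n k] with a ha
    by_cases hs : cvEnergy P (D n) a ≤ δ
    · have := hN n hnN (hD n) a ha hs r
      have h2 : 0 ≤ C ^ 2 / δ * cvEnergy P (D n) a := mul_nonneg (by positivity) (hE0 a)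
      linarith
    · have h2 : avgPerm (fun σ => l2 (P.prod (iid P (Fin n))) (D n (trainIdx (a ∘ σ) r)) ^ 2)
          ≤ C ^ 2 := by
        rw [← avgPerm_const (n := n) (C ^ 2)]
        exact avgPerm_mono fun σ => pow_le_pow_left₀ l2_nonneg
          (l2_le_of_abs_le ((hD n).abs_le _)) 2
      have h3 : C ^ 2 * 1 ≤ C ^ 2 * (cvEnergy P (D n) a / δ) :=
        mul_le_mul_of_nonneg_left ((one_le_div hδ).2 (not_le.1 hs).le) (sq_nonneg C)
      have h4 : C ^ 2 / δ * cvEnergy P (D n) a = C ^ 2 * (cvEnergy P (D n) a / δ) := by ring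
      linarith
  calc _ ≤ ∫ a, (η / 2 + C ^ 2 / δ * cvEnergy P (D n) a) ∂(uniformOn (balanced n k)) :=
        integral_mono_ae ((bddMeas_of_finite _).integrable _) ((bddMeas_of_finite _).integrable _) hb
    _ = η / 2 + C ^ 2 / δ * ∫ a, cvEnergy P (D n) a ∂(uniformOn (balanced n k)) := by
        rw [integral_add (integrable_const _) ((bddMeas_of_finite _).integrable _),
          integral_const_mul]
        simp
    _ < η / 2 + η / 2 := by
        have h5 : C ^ 2 / δ * ∫ a, cvEnergy P (D n) a ∂(uniformOn (balanced n k))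
            ≤ C ^ 2 / δ * (η / 2 / (C ^ 2 + 1) * δ) :=
          mul_le_mul_of_nonneg_left hn.le (by positivity)
        have h6 : C ^ 2 / δ * (η / 2 / (C ^ 2 + 1) * δ) = η / 2 * (C ^ 2 / (C ^ 2 + 1)) := by
          field_simp
        have h7 : C ^ 2 / (C ^ 2 + 1) < 1 := by
          rw [div_lt_one (by positivity)]; linarith
        have h8 : η / 2 * (C ^ 2 / (C ^ 2 + 1)) < η / 2 * 1 :=
          mul_lt_mul_of_pos_left h7 (by positivity)
        linarith
    _ = η := by ring

end Stability

/-! ### Convergence to zero in probability on varying probability spaces -/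

section InProb

variable {X : ℕ → Type*} [∀ n, MeasurableSpace (X n)] {μ : ∀ n, Measure (X n)}
    [∀ n, IsProbabilityMeasure (μ n)] {Y Y' : ∀ n, X n → ℝ}

/-- Convergence to zero in probability of random variables on varying probability spaces. -/
def TendstoZeroInProb (μ : ∀ n, Measure (X n)) (Y : ∀ n, X n → ℝ) : Prop :=
  ∀ ε > 0, Tendsto (fun n => (μ n).real {w | ε ≤ |Y n w|}) atTop (𝓝 0)

lemma TendstoZeroInProb.add (hY : TendstoZeroInProb μ Y) (hY' : TendstoZeroInProb μ Y') :
    TendstoZeroInProb μ fun n w => Y n w + Y' n w := by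
  intro ε hε
  have h := (hY (ε / 2) (by positivity)).add (hY' (ε / 2) (by positivity))
  rw [add_zero] at h
  refine squeeze_zero (fun n => measureReal_nonneg) (fun n => ?_) h
  refine (measureReal_mono ?_).trans (measureReal_union_le _ _)
  intro w hw
  simp only [Set.mem_union, Set.mem_ofPred_eq] at hw ⊢
  by_contra! h
  have := abs_add_le (Y n w) (Y' n w)
  linarith

lemma TendstoZeroInProb.of_abs_le (hY : TendstoZeroInProb μ Y) {K : ℝ} (hK : 0 < K)
    (h : ∀ᶠ n in atTop, ∀ w, |Y' n w| ≤ K * |Y n w|) : TendstoZeroInProb μ Y' := by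
  intro ε hε
  refine squeeze_zero' (Eventually.of_forall fun n => measureReal_nonneg) ?_
    (hY (ε / K) (by positivity))
  filter_upwards [h] with n hn
  refine measureReal_mono fun w hw => ?_
  simp only [Set.mem_ofPred_eq] at hw ⊢
  rw [div_le_iff₀' hK]
  exact hw.trans (hn w)

lemma TendstoZeroInProb.of_integral (hb : ∀ n, BddMeas (Y n))
    (h : Tendsto (fun n => ∫ w, |Y n w| ∂(μ n)) atTop (𝓝 0)) : TendstoZeroInProb μ Y := by
  intro ε hε
  have h' := h.const_mul ε⁻¹
  rw [mul_zero] at h'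
  refine squeeze_zero (fun n => measureReal_nonneg) (fun n => ?_) h'
  rw [← div_eq_inv_mul, le_div_iff₀' hε]
  exact mul_meas_ge_le_integral_of_nonneg (ae_of_all _ fun w => abs_nonneg _)
    ((hb n).abs.integrable _) ε

end InProb

/-! ### The studentized cross-validated risk -/

section Studentized

variable {Ω : Type*} [MeasurableSpace Ω] {P : Measure Ω} [IsProbabilityMeasure P] {n k : ℕ}

/-- The losses `H B (w; W)` at `w` of classifiers trained on the observations `W i`, `i ∈ B`. -/
structure LossFamily (H : Finset (Fin n) → Ω × (Fin n → Ω) → ℝ) : Prop where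
  measurable : ∀ B, Measurable (H B)
  abs_le : ∀ B p, |H B p| ≤ 2
  dependsOn : ∀ B w, DependsOn (fun W => H B (w, W)) B

/-- The risk of the classifier trained on the observations in `B`. -/
noncomputable def risk (P : Measure Ω) (H : Finset (Fin n) → Ω × (Fin n → Ω) → ℝ)
    (B : Finset (Fin n)) (W : Fin n → Ω) : ℝ :=
  ∫ w, H B (w, W) ∂P

/-- The centered loss minus the function `c`, which in the application is the centered averaged
loss. -/
noncomputable def residual (P : Measure Ω) (H : Finset (Fin n) → Ω × (Fin n → Ω) → ℝ) (c : Ω → ℝ)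
    (B : Finset (Fin n)) (p : Ω × (Fin n → Ω)) : ℝ :=
  H B p - risk P H B p.2 - c p.1

/-- The mean of the losses over an evaluation fold. -/
noncomputable def evalMean (H : Finset (Fin n) → Ω × (Fin n → Ω) → ℝ) (a : Fin n → Fin k)
    (r : Fin k) (W : Fin n → Ω) : ℝ :=
  (∑ i ∈ fold a r, H (trainIdx a r) (W i, W)) / (fold a r).card

/-- The variance of the losses over an evaluation fold. -/
noncomputable def evalVar (H : Finset (Fin n) → Ω × (Fin n → Ω) → ℝ) (a : Fin n → Fin k)
    (r : Fin k) (W : Fin n → Ω) : ℝ :=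
  (∑ i ∈ fold a r, H (trainIdx a r) (W i, W) ^ 2) / (fold a r).card - evalMean H a r W ^ 2

variable {H : Finset (Fin n) → Ω × (Fin n → Ω) → ℝ} {c : Ω → ℝ}

lemma LossFamily.bddMeas (hH : LossFamily H) (B : Finset (Fin n)) : BddMeas (H B) :=
  ⟨hH.measurable B, 2, hH.abs_le B⟩

lemma LossFamily.bddMeas_risk (hH : LossFamily H) (B : Finset (Fin n)) : BddMeas (risk P H B) :=
  (hH.bddMeas B).integral_left P

lemma LossFamily.abs_risk_le (hH : LossFamily H) (B : Finset (Fin n)) (W : Fin n → Ω) :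
    |risk P H B W| ≤ 2 :=
  abs_integral_le_of_abs_le fun _ => hH.abs_le _ _

lemma LossFamily.risk_congr (hH : LossFamily H) {B : Finset (Fin n)} {V W : Fin n → Ω}
    (h : ∀ i ∈ (B : Set (Fin n)), V i = W i) : risk P H B V = risk P H B W :=
  integral_congr_ae (ae_of_all _ fun w => hH.dependsOn B w h)

lemma LossFamily.centeredFamily_residual (hH : LossFamily H) (hc : Measurable c)
    (hc2 : ∀ w, |c w| ≤ 2) (hc0 : ∫ w, c w ∂P = 0) : CenteredFamily P 6 (residual P H c) where
  measurable B := ((hH.measurable B).sub ((hH.bddMeas_risk B).measurable.comp measurable_snd)).sub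
    (hc.comp measurable_fst)
  abs_le B p := by
    have h1 := _root_.abs_le.1 (hH.abs_le B p)
    have h2 := _root_.abs_le.1 (hH.abs_risk_le (P := P) B p.2)
    have h3 := _root_.abs_le.1 (hc2 p.1)
    unfold residual
    rw [_root_.abs_le]
    constructor <;> linarith [h1.1, h1.2, h2.1, h2.2, h3.1, h3.2]
  centered B W := by
    have hb : BddMeas fun w => H B (w, W) := (hH.bddMeas B).comp measurable_prodMk_right
    have hcb : BddMeas c := ⟨hc, 2, hc2⟩
    simp only [residual]
    rw [integral_sub ((hb.sub (BddMeas.const _)).integrable P) (hcb.integrable P),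
      integral_sub (hb.integrable P) (integrable_const _), hc0]
    simp [risk]
  dependsOn B w V W h := by
    simp only [residual]
    have h1 : H B (w, V) = H B (w, W) := hH.dependsOn B w h
    rw [h1, hH.risk_congr h]

/-- The centered loss. -/
noncomputable def centeredLoss (P : Measure Ω) (H : Finset (Fin n) → Ω × (Fin n → Ω) → ℝ)
    (B : Finset (Fin n)) (p : Ω × (Fin n → Ω)) : ℝ :=
  H B p - risk P H B p.2

lemma LossFamily.centeredFamily_centeredLoss (hH : LossFamily H) :
    CenteredFamily P 4 (centeredLoss P H) where
  measurable B := (hH.measurable B).sub ((hH.bddMeas_risk B).measurable.comp measurable_snd)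
  abs_le B p := by
    have h1 := _root_.abs_le.1 (hH.abs_le B p)
    have h2 := _root_.abs_le.1 (hH.abs_risk_le (P := P) B p.2)
    unfold centeredLoss
    rw [_root_.abs_le]
    constructor <;> linarith [h1.1, h1.2, h2.1, h2.2]
  centered B W := by
    have hb : BddMeas fun w => H B (w, W) := (hH.bddMeas B).comp measurable_prodMk_right
    simp only [centeredLoss]
    rw [integral_sub (hb.integrable P) (integrable_const _)]
    simp [risk]
  dependsOn B w V W h := by
    simp only [centeredLoss]
    have h1 : H B (w, V) = H B (w, W) := hH.dependsOn B w h
    rw [h1, hH.risk_congr h]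

variable {a : Fin n → Fin k}

lemma evalMean_eq (r : Fin k) (hm : (fold a r).card ≠ 0) (W : Fin n → Ω) :
    evalMean H a r W = risk P H (trainIdx a r) W
      + (∑ i ∈ fold a r, centeredLoss P H (trainIdx a r) (W i, W)) / (fold a r).card := by
  have hm' : ((fold a r).card : ℝ) ≠ 0 := by exact_mod_cast hm
  simp only [evalMean, centeredLoss, Finset.sum_sub_distrib, Finset.sum_const, nsmul_eq_mul]
  field_simp
  ring

/-- The sample variance does not change when the risk is subtracted from the losses. -/
lemma evalVar_eq (r : Fin k) (hm : (fold a r).card ≠ 0) (W : Fin n → Ω) :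
    evalVar H a r W
      = (∑ i ∈ fold a r, centeredLoss P H (trainIdx a r) (W i, W) ^ 2) / (fold a r).card
        - ((∑ i ∈ fold a r, centeredLoss P H (trainIdx a r) (W i, W)) / (fold a r).card) ^ 2 := by
  have hm' : ((fold a r).card : ℝ) ≠ 0 := by exact_mod_cast hm
  have e : ∀ i, H (trainIdx a r) (W i, W) = centeredLoss P H (trainIdx a r) (W i, W)
      + risk P H (trainIdx a r) W := fun i => by simp [centeredLoss]
  simp only [evalVar, evalMean_eq (P := P) r hm, e, add_sq, Finset.sum_add_distrib,
    Finset.sum_const, nsmul_eq_mul, ← Finset.mul_sum, ← Finset.sum_mul]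
  field_simp
  ring

lemma LossFamily.bddMeas_evalMean (hH : LossFamily H) (a : Fin n → Fin k) (r : Fin k) :
    BddMeas (evalMean H a r) := by
  have := ((hH.bddMeas (trainIdx a r)).sum_coord (fold a r)).const_mul ((fold a r).card : ℝ)⁻¹
  unfold evalMean
  simpa only [div_eq_inv_mul] using this

lemma LossFamily.bddMeas_evalVar (hH : LossFamily H) (a : Fin n → Fin k) (r : Fin k) :
    BddMeas (evalVar H a r) := by
  have := (((hH.bddMeas (trainIdx a r)).pow 2).sum_coord (fold a r)).const_mul
    ((fold a r).card : ℝ)⁻¹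
  unfold evalVar
  simp only [div_eq_inv_mul]
  exact this.sub ((hH.bddMeas_evalMean a r).pow 2)

/-- The sample variance over a fold is close in mean to the variance of `c`, if the residual is
small. -/
lemma LossFamily.integral_abs_evalVar_sub_le (hH : LossFamily H) (hc : Measurable c)
    (hc2 : ∀ w, |c w| ≤ 2) (hc0 : ∫ w, c w ∂P = 0) (r : Fin k) (hm : (fold a r).card ≠ 0) :
    ∫ W, |evalVar H a r W - ∫ w, c w ^ 2 ∂P| ∂(iid P (Fin n))
      ≤ 20 / √((fold a r).card : ℝ)
        + 10 * l2 (P.prod (iid P (Fin n))) (residual P H c (trainIdx a r)) := by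
  set A := fold a r with hA
  set B := trainIdx a r with hB
  have hAB : Disjoint A B := disjoint_fold_trainIdx a r
  set s : ℝ := ∫ w, c w ^ 2 ∂P with hs
  have hR := hH.centeredFamily_residual hc hc2 hc0
  have hV := hH.centeredFamily_centeredLoss (P := P)
  have hcb : BddMeas c := ⟨hc, 2, hc2⟩
  have hm0 : (0 : ℝ) < A.card := by exact_mod_cast Nat.pos_of_ne_zero hm
  have hm1 : (1 : ℝ) ≤ A.card := by exact_mod_cast Nat.one_le_iff_ne_zero.2 hm
  have hsq1 : 1 ≤ √(A.card : ℝ) := Real.one_le_sqrt.2 hm1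
  have hsq : √(A.card : ℝ) * √(A.card : ℝ) = A.card := Real.mul_self_sqrt hm0.le
  have hc4 : ∀ w, c w ^ 2 ≤ 4 := fun w => by
    have := pow_le_pow_left₀ (abs_nonneg _) (hc2 w) 2
    rw [sq_abs] at this
    linarith
  have hs0 : 0 ≤ s := integral_nonneg fun _ => sq_nonneg _
  have hs4 : s ≤ 4 := (le_abs_self _).trans (abs_integral_le_of_abs_le fun w => by
    rw [abs_of_nonneg (sq_nonneg _)]; exact hc4 w)
  -- the fluctuations of the squares of `c`, the effect of the residual, and the squared mean
  set F₁ : (Fin n → Ω) → ℝ := fun W => ∑ i ∈ A, (c (W i) ^ 2 - s) with hF₁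
  set F₂ : (Fin n → Ω) → ℝ := fun W => ∑ i ∈ A, |residual P H c B (W i, W)| with hF₂
  set F₃ : (Fin n → Ω) → ℝ := fun W => ∑ i ∈ A, centeredLoss P H B (W i, W) with hF₃
  have b₀ : BddMeas fun p : Ω × (Fin n → Ω) => c p.1 ^ 2 - s :=
    ((hcb.comp measurable_fst).pow 2).sub (BddMeas.const s)
  have b₁ : BddMeas F₁ := b₀.sum_coord A
  have b₂ : BddMeas F₂ := (hR.bddMeas B).abs.sum_coord A
  have b₃ : BddMeas F₃ := (hV.bddMeas B).sum_coord A
  have hpt : ∀ W, |evalVar H a r W - s|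
      ≤ (A.card : ℝ)⁻¹ * |F₁ W| + ((A.card : ℝ)⁻¹ * 10) * F₂ W
        + ((A.card : ℝ)⁻¹ ^ 2) * F₃ W ^ 2 := by
    intro W
    have e1 : evalVar H a r W - s = (A.card : ℝ)⁻¹ * F₁ W
        + (A.card : ℝ)⁻¹ * ∑ i ∈ A, (centeredLoss P H B (W i, W) ^ 2 - c (W i) ^ 2)
        - ((A.card : ℝ)⁻¹ ^ 2) * F₃ W ^ 2 := by
      rw [evalVar_eq (P := P) r hm, ← hA, ← hB]
      simp only [hF₁, hF₃, Finset.sum_sub_distrib, Finset.sum_const, nsmul_eq_mul]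
      field_simp
      ring
    have e2 : |∑ i ∈ A, (centeredLoss P H B (W i, W) ^ 2 - c (W i) ^ 2)| ≤ 10 * F₂ W := by
      rw [hF₂, Finset.mul_sum]
      refine (Finset.abs_sum_le_sum_abs _ _).trans (Finset.sum_le_sum fun i _ => ?_)
      have e3 : centeredLoss P H B (W i, W) ^ 2 - c (W i) ^ 2
          = (2 * c (W i) + residual P H c B (W i, W)) * residual P H c B (W i, W) := by
        simp only [centeredLoss, residual]; ring
      rw [e3, abs_mul]
      refine mul_le_mul_of_nonneg_right ?_ (abs_nonneg _)
      have h1 := _root_.abs_le.1 (hc2 (W i))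
      have h2 := _root_.abs_le.1 (hR.abs_le B (W i, W))
      rw [_root_.abs_le]
      constructor <;> linarith [h1.1, h1.2, h2.1, h2.2]
    rw [e1]
    refine (abs_sub _ _).trans (add_le_add ((abs_add_le _ _).trans (add_le_add ?_ ?_)) ?_)
    · rw [abs_mul, abs_of_pos (inv_pos.2 hm0)]
    · rw [abs_mul, abs_of_pos (inv_pos.2 hm0), mul_assoc]
      exact mul_le_mul_of_nonneg_left e2 (inv_pos.2 hm0).le
    · rw [abs_of_nonneg (by positivity)]
  have i₁ : ∫ W, |F₁ W| ∂(iid P (Fin n)) ≤ √(A.card : ℝ) * 4 := by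
    refine (integral_abs_le_l2 b₁).trans ?_
    have h := l2_sum_coord (P := P) (ι := Fin n) (A := A) (B := ∅) b₀ (fun W => by
      rw [integral_sub ((hcb.pow 2).integrable P) (integrable_const _)]
      simp [hs]) (fun w V V' _ => rfl) (Finset.disjoint_empty_right _)
    rw [h]
    refine mul_le_mul_of_nonneg_left (l2_le_of_abs_le fun p => ?_) (Real.sqrt_nonneg _)
    rw [_root_.abs_le]
    constructor <;> linarith [hc4 p.1, sq_nonneg (c p.1)]
  have i₂ : ∫ W, F₂ W ∂(iid P (Fin n))
      ≤ A.card * l2 (P.prod (iid P (Fin n))) (residual P H c B) := by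
    have hcoord : ∀ i, BddMeas fun W : Fin n → Ω => |residual P H c B (W i, W)| := fun i =>
      (hR.bddMeas B).abs.comp (measurable_coord_prod i)
    rw [hF₂, integral_finsetSum _ fun i _ => (hcoord i).integrable _]
    have h : ∀ i ∈ A, ∫ W, |residual P H c B (W i, W)| ∂(iid P (Fin n))
        ≤ l2 (P.prod (iid P (Fin n))) (residual P H c B) := fun i hi => by
      rw [integral_insert_coord P (hR.bddMeas B).abs (B := B)
        (fun w V V' h => congrArg abs (hR.dependsOn B w h)) (Finset.disjoint_left.1 hAB hi)]
      exact integral_abs_le_l2 (hR.bddMeas B)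
    refine (Finset.sum_le_sum h).trans (le_of_eq ?_)
    simp
  have i₃ : ∫ W, F₃ W ^ 2 ∂(iid P (Fin n)) ≤ A.card * 16 := by
    rw [← l2_sq, hF₃, l2_sum_coord (hV.bddMeas B) (hV.centered B) (hV.dependsOn B) hAB, mul_pow,
      Real.sq_sqrt hm0.le]
    refine mul_le_mul_of_nonneg_left ?_ hm0.le
    have := pow_le_pow_left₀ l2_nonneg
      (l2_le_of_abs_le (μ := P.prod (iid P (Fin n))) (hV.abs_le B)) 2
    linarith
  calc ∫ W, |evalVar H a r W - s| ∂(iid P (Fin n))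
      ≤ ∫ W, ((A.card : ℝ)⁻¹ * |F₁ W| + ((A.card : ℝ)⁻¹ * 10) * F₂ W
        + ((A.card : ℝ)⁻¹ ^ 2) * F₃ W ^ 2) ∂(iid P (Fin n)) :=
        integral_mono (((hH.bddMeas_evalVar a r).sub (BddMeas.const s)).abs.integrable _)
          ((((b₁.abs.const_mul _).add (b₂.const_mul _)).add ((b₃.pow 2).const_mul _)).integrable _)
          hpt
    _ = (A.card : ℝ)⁻¹ * ∫ W, |F₁ W| ∂(iid P (Fin n))
        + ((A.card : ℝ)⁻¹ * 10) * ∫ W, F₂ W ∂(iid P (Fin n))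
        + ((A.card : ℝ)⁻¹ ^ 2) * ∫ W, F₃ W ^ 2 ∂(iid P (Fin n)) := by
        rw [integral_add (((b₁.abs.const_mul _).add (b₂.const_mul _)).integrable _)
          (((b₃.pow 2).const_mul _).integrable _), integral_add ((b₁.abs.const_mul _).integrable _)
          ((b₂.const_mul _).integrable _), integral_const_mul, integral_const_mul,
          integral_const_mul]
    _ ≤ (A.card : ℝ)⁻¹ * (√(A.card : ℝ) * 4) + ((A.card : ℝ)⁻¹ * 10)
          * (A.card * l2 (P.prod (iid P (Fin n))) (residual P H c B))
        + ((A.card : ℝ)⁻¹ ^ 2) * (A.card * 16) := by gcongr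
    _ ≤ _ := by
        have e1 : (A.card : ℝ)⁻¹ * (√(A.card : ℝ) * 4) = 4 / √(A.card : ℝ) := by
          rw [inv_mul_eq_div, div_eq_div_iff hm0.ne' (by positivity)]
          linear_combination 4 * hsq
        have e2 : ((A.card : ℝ)⁻¹ ^ 2) * (A.card * 16) = 16 / A.card := by field_simp
        have e3 : ((A.card : ℝ)⁻¹ * 10)
          * (A.card * l2 (P.prod (iid P (Fin n))) (residual P H c B))
          = 10 * l2 (P.prod (iid P (Fin n))) (residual P H c B) := by field_simp
        have e4 : 16 / (A.card : ℝ) ≤ 16 / √(A.card : ℝ) := by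
          apply div_le_div_of_nonneg_left (by norm_num) (by linarith)
          nlinarith
        have e5 : 20 / √(A.card : ℝ) = 4 / √(A.card : ℝ) + 16 / √(A.card : ℝ) := by ring
        rw [e1, e2, e3, e5]
        linarith

lemma abs_sub_mul_card_fold_le (ha : a ∈ balanced n k) (r : Fin k) :
    |(n : ℝ) - k * (fold a r).card| ≤ k := by
  have h : (n : ℝ) = ∑ s, ((fold a s).card : ℝ) := by exact_mod_cast (sum_card_fold a).symm
  have h2 : (n : ℝ) - k * (fold a r).card = ∑ s, (((fold a s).card : ℝ) - (fold a r).card) := by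
    rw [Finset.sum_sub_distrib, ← h]; simp
  rw [h2]
  refine (Finset.abs_sum_le_sum_abs _ _).trans ?_
  calc ∑ s, |((fold a s).card : ℝ) - (fold a r).card| ≤ ∑ _s : Fin k, (1 : ℝ) :=
        Finset.sum_le_sum fun s _ => by
          have h3 : ((fold a s).card : ℝ) ≤ (fold a r).card + 1 := by exact_mod_cast ha s r
          have h4 : ((fold a r).card : ℝ) ≤ (fold a s).card + 1 := by exact_mod_cast ha r s
          rw [abs_le]
          constructor <;> linarith
    _ = k := by simp

/-- The deviation of the cross-validated risk estimate from the mean risk of the trained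
classifiers, multiplied by `√n`. -/
noncomputable def deviation (P : Measure Ω) (H : Finset (Fin n) → Ω × (Fin n → Ω) → ℝ)
    (a : Fin n → Fin k) (W : Fin n → Ω) : ℝ :=
  √(n : ℝ) * ((∑ r, evalMean H a r W) / k - (∑ r, risk P H (trainIdx a r) W) / k)

lemma LossFamily.bddMeas_deviation (hH : LossFamily H) (a : Fin n → Fin k) :
    BddMeas (deviation P H a) := by
  unfold deviation
  simp only [div_eq_inv_mul]
  exact (((BddMeas.sum _ fun r _ => hH.bddMeas_evalMean a r).const_mul _).sub
    ((BddMeas.sum _ fun r _ => hH.bddMeas_risk _).const_mul _)).const_mul _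

/-- The deviation of the cross-validated risk is a normalized i.i.d. sum plus the normalized
cross-validated sum of the residuals, up to the effect of unequal fold sizes. -/
lemma LossFamily.l2_deviation_sub_le (hH : LossFamily H) [NeZero k] (ha : a ∈ balanced n k)
    (hn : 2 * k ≤ n) :
    l2 (iid P (Fin n)) (fun W => deviation P H a W - (√(n : ℝ))⁻¹ * ∑ i, c (W i)
      - (√(n : ℝ))⁻¹ * cvSum (residual P H c) a W) ≤ 4 * k / √(n : ℝ) := by
  have hk0 : 0 < k := Nat.pos_of_ne_zero (NeZero.ne k)
  have hk : (0 : ℝ) < k := by exact_mod_cast hk0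
  have hn0 : (0 : ℝ) < n := by exact_mod_cast (by omega : 0 < n)
  have hm : ∀ r, (fold a r).card ≠ 0 := fun r h0 => by
    have := le_two_mul_card_fold ha hn r
    rw [h0] at this
    omega
  have hm1 : ∀ r, (1 : ℝ) ≤ (fold a r).card := fun r => by
    exact_mod_cast Nat.one_le_iff_ne_zero.2 (hm r)
  have hV := hH.centeredFamily_centeredLoss (P := P)
  set F : Fin k → (Fin n → Ω) → ℝ := fun r W =>
    ∑ i ∈ fold a r, centeredLoss P H (trainIdx a r) (W i, W) with hF
  have hFb : ∀ r, BddMeas (F r) := fun r => (hV.bddMeas _).sum_coord _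
  -- the weight `√n / (k m)` of an observation in a fold of size `m`, minus `1 / √n`
  set w : Fin k → ℝ := fun r =>
    ((n : ℝ) - k * (fold a r).card) / (k * (fold a r).card * √(n : ℝ)) with hw
  have hsq : √(n : ℝ) * √(n : ℝ) = n := Real.mul_self_sqrt hn0.le
  have e : (fun W => deviation P H a W - (√(n : ℝ))⁻¹ * ∑ i, c (W i)
      - (√(n : ℝ))⁻¹ * cvSum (residual P H c) a W) = fun W => ∑ r, w r * F r W := by
    ext W
    have h1 : ∑ i, c (W i) + cvSum (residual P H c) a W = ∑ r, F r W := by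
      have h2 : ∑ i, c (W i) = ∑ r, ∑ i ∈ fold a r, c (W i) :=
        (Finset.sum_fiberwise Finset.univ a (fun i => c (W i))).symm
      rw [h2, cvSum, ← Finset.sum_add_distrib]
      refine Finset.sum_congr rfl fun r _ => ?_
      rw [hF, ← Finset.sum_add_distrib]
      exact Finset.sum_congr rfl fun i _ => by simp [residual, centeredLoss]
    have h3 : deviation P H a W = ∑ r, √(n : ℝ) / (k * (fold a r).card) * F r W := by
      rw [deviation, ← sub_div, ← Finset.sum_sub_distrib, Finset.sum_div, Finset.mul_sum]
      refine Finset.sum_congr rfl fun r _ => ?_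
      have := hm1 r
      rw [evalMean_eq (P := P) r (hm r), hF]
      field_simp
      ring
    rw [sub_sub, ← mul_add, h1, h3, Finset.mul_sum, ← Finset.sum_sub_distrib]
    refine Finset.sum_congr rfl fun r _ => ?_
    have := hm1 r
    rw [hw, ← sub_mul]
    congr 1
    have hs0 : √(n : ℝ) ≠ 0 := by positivity
    simp only
    rw [eq_div_iff (by positivity), sub_mul]
    have e1 : √(n : ℝ) / (k * (fold a r).card) * (k * (fold a r).card * √(n : ℝ)) = n := by
      rw [div_mul_eq_mul_div, div_eq_iff (by positivity)]
      linear_combination ((k : ℝ) * (fold a r).card) * hsq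
    rw [e1]
    field_simp
  rw [e]
  refine (l2_sum_le _ fun r _ => (hFb r).const_mul _).trans ?_
  calc ∑ r, l2 (iid P (Fin n)) (fun W => w r * F r W)
      ≤ ∑ _r : Fin k, 4 / √(n : ℝ) := Finset.sum_le_sum fun r _ => by
        have h1 := hm1 r
        rw [l2_const_mul, hF, l2_sum_coord (hV.bddMeas _) (hV.centered _) (hV.dependsOn _)
          (disjoint_fold_trainIdx a r)]
        have h2 : |w r| ≤ 1 / ((fold a r).card * √(n : ℝ)) := by
          rw [hw]
          simp only
          rw [abs_div, abs_of_pos (a := (k : ℝ) * (fold a r).card * √(n : ℝ)) (by positivity),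
            div_le_div_iff₀ (by positivity) (by positivity)]
          have := abs_sub_mul_card_fold_le ha r
          have h3 : |(n : ℝ) - k * (fold a r).card| * ((fold a r).card * √(n : ℝ))
              ≤ k * ((fold a r).card * √(n : ℝ)) := mul_le_mul_of_nonneg_right this (by positivity)
          linarith
        have h4 : l2 (P.prod (iid P (Fin n))) (centeredLoss P H (trainIdx a r)) ≤ 4 :=
          l2_le_of_abs_le (hV.abs_le _)
        have h5 : √((fold a r).card : ℝ) ≤ (fold a r).card := by
          rw [Real.sqrt_le_left (by positivity)]
          nlinarith
        calc |w r| * (√((fold a r).card : ℝ)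
              * l2 (P.prod (iid P (Fin n))) (centeredLoss P H (trainIdx a r)))
            ≤ 1 / ((fold a r).card * √(n : ℝ)) * ((fold a r).card * 4) := by
              gcongr
              · exact mul_nonneg (Real.sqrt_nonneg _) l2_nonneg
              · exact l2_nonneg (μ := P.prod (iid P (Fin n)))
          _ = 4 / √(n : ℝ) := by field_simp
    _ = _ := by simp; ring

end Studentized

/-! ### Asymptotic normality of the studentized cross-validated risk -/

section Normality

variable {Ω : Type*} [MeasurableSpace Ω] {P : Measure Ω} [IsProbabilityMeasure P] {k : ℕ} [NeZero k]
  {H : ∀ n, Finset (Fin n) → Ω × (Fin n → Ω) → ℝ} {c : ℕ → Ω → ℝ}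

/-- The law of an i.i.d. sample together with an independent random balanced fold assignment. -/
noncomputable abbrev cvLaw (P : Measure Ω) (k n : ℕ) : Measure ((Fin n → Ω) × (Fin n → Fin k)) :=
  (iid P (Fin n)).prod (uniformOn (balanced n k))

lemma integral_cvLaw_le {n : ℕ} {G : (Fin n → Fin k) → (Fin n → Ω) → ℝ} (hG : ∀ a, BddMeas (G a))
    {K : (Fin n → Fin k) → ℝ} (hK : ∀ a ∈ balanced n k, ∫ W, G a W ∂(iid P (Fin n)) ≤ K a) :
    ∫ ω, G ω.2 ω.1 ∂(cvLaw P k n) ≤ ∫ a, K a ∂(uniformOn (balanced n k)) := by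
  rw [integral_prod_symm _ ((bddMeas_uncurry hG).integrable _)]
  refine integral_mono_ae ((bddMeas_of_finite _).integrable _)
    ((bddMeas_of_finite _).integrable _) ?_
  filter_upwards [ae_mem_balanced n k] with a ha
  exact hK a ha

lemma tendsto_const_div_sqrt_natCast (K : ℝ) :
    Tendsto (fun n : ℕ => K / √(n : ℝ)) atTop (𝓝 0) :=
  tendsto_const_nhds.div_atTop (Real.tendsto_sqrt_atTop.comp tendsto_natCast_atTop_atTop)

/-- Consistency of the cross-validated variance estimate. -/
lemma tendstoZeroInProb_evalVar (hH : ∀ n, LossFamily (H n)) (hc : ∀ n, Measurable (c n))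
    (hc2 : ∀ n w, |c n w| ≤ 2) (hc0 : ∀ n, ∫ w, c n w ∂P = 0)
    (hstab : ∀ r : Fin k, Tendsto (fun n => ∫ a, l2 (P.prod (iid P (Fin n)))
      (residual P (H n) (c n) (trainIdx a r)) ^ 2 ∂(uniformOn (balanced n k))) atTop (𝓝 0)) :
    TendstoZeroInProb (cvLaw P k) fun n ω =>
      (∑ r, evalVar (H n) ω.2 r ω.1) / k - ∫ w, c n w ^ 2 ∂P := by
  have hk0 : (0 : ℝ) < k := by exact_mod_cast Nat.pos_of_ne_zero (NeZero.ne k)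
  have hk1 : (1 : ℝ) ≤ k := by exact_mod_cast Nat.one_le_iff_ne_zero.2 (NeZero.ne k)
  have hb : ∀ n (a : Fin n → Fin k), BddMeas fun W =>
      (∑ r, evalVar (H n) a r W) / k - ∫ w, c n w ^ 2 ∂P := fun n a => by
    simp only [div_eq_inv_mul]
    exact ((BddMeas.sum _ fun r _ => (hH n).bddMeas_evalVar a r).const_mul _).sub (BddMeas.const _)
  refine TendstoZeroInProb.of_integral (fun n => bddMeas_uncurry (hb n)) ?_
  have hlim : Tendsto (fun n : ℕ => ∑ r : Fin k, (20 * √(2 * k) / √(n : ℝ)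
      + 10 * √(∫ a, l2 (P.prod (iid P (Fin n)))
        (residual P (H n) (c n) (trainIdx a r)) ^ 2 ∂(uniformOn (balanced n k))))) atTop (𝓝 0) := by
    have h0 : (0 : ℝ) = ∑ _r : Fin k, 0 := by simp
    rw [h0]
    refine tendsto_finsetSum _ fun r _ => ?_
    have h1 := (hstab r).sqrt.const_mul 10
    rw [Real.sqrt_zero, mul_zero] at h1
    simpa using (tendsto_const_div_sqrt_natCast (20 * √(2 * k))).add h1
  refine squeeze_zero' (Eventually.of_forall fun n => integral_nonneg fun _ => abs_nonneg _) ?_ hlim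
  filter_upwards [eventually_ge_atTop (2 * k), eventually_gt_atTop 0] with n hn hn0
  have hn0' : (0 : ℝ) < n := by exact_mod_cast hn0
  refine (integral_cvLaw_le (G := fun a W => |(∑ r, evalVar (H n) a r W) / k - ∫ w, c n w ^ 2 ∂P|)
    (fun a => (hb n a).abs) (K := fun a => ∑ r, (20 * √(2 * k) / √(n : ℝ)
      + 10 * l2 (P.prod (iid P (Fin n))) (residual P (H n) (c n) (trainIdx a r))))
      fun a ha => ?_).trans ?_
  · have hbr : ∀ r, BddMeas fun W => |evalVar (H n) a r W - ∫ w, c n w ^ 2 ∂P| := fun r =>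
      (((hH n).bddMeas_evalVar a r).sub (BddMeas.const _)).abs
    calc ∫ W, |(∑ r, evalVar (H n) a r W) / k - ∫ w, c n w ^ 2 ∂P| ∂(iid P (Fin n))
        ≤ ∫ W, ∑ r, |evalVar (H n) a r W - ∫ w, c n w ^ 2 ∂P| ∂(iid P (Fin n)) := by
          refine integral_mono ((hb n a).abs.integrable _)
            ((BddMeas.sum _ fun r _ => hbr r).integrable _) fun W => ?_
          have e : (∑ r, evalVar (H n) a r W) / k - ∫ w, c n w ^ 2 ∂P
              = (∑ r, (evalVar (H n) a r W - ∫ w, c n w ^ 2 ∂P)) / k := by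
            rw [Finset.sum_sub_distrib]
            simp
            field_simp
          simp only
          rw [e, abs_div, abs_of_pos hk0]
          exact (div_le_self (abs_nonneg _) hk1).trans (Finset.abs_sum_le_sum_abs _ _)
      _ = ∑ r, ∫ W, |evalVar (H n) a r W - ∫ w, c n w ^ 2 ∂P| ∂(iid P (Fin n)) :=
          integral_finsetSum _ fun r _ => (hbr r).integrable _
      _ ≤ _ := Finset.sum_le_sum fun r _ => by
          have hm : n ≤ 2 * k * (fold a r).card := le_two_mul_card_fold ha hn r
          have hm0 : (fold a r).card ≠ 0 := fun h => by rw [h] at hm; omega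
          refine ((hH n).integral_abs_evalVar_sub_le (hc n) (hc2 n) (hc0 n) r hm0).trans
            (add_le_add_left ?_ _)
          have hm1 : (0 : ℝ) < (fold a r).card := by exact_mod_cast Nat.pos_of_ne_zero hm0
          rw [div_le_div_iff₀ (by positivity) (by positivity), mul_assoc, ← Real.sqrt_mul (by positivity)]
          refine mul_le_mul_of_nonneg_left (Real.sqrt_le_sqrt ?_) (by norm_num)
          exact_mod_cast hm
  · rw [integral_finsetSum _ fun r _ => (bddMeas_of_finite _).integrable _]
    refine Finset.sum_le_sum fun r _ => ?_
    rw [integral_add (integrable_const _) ((bddMeas_of_finite _).integrable _), integral_const_mul]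
    simp only [integral_const, probReal_univ, one_smul]
    refine add_le_add_right (mul_le_mul_of_nonneg_left ?_ (by norm_num)) _
    have h := integral_abs_le_l2 (μ := uniformOn (balanced n k)) (bddMeas_of_finite
      fun a => l2 (P.prod (iid P (Fin n))) (residual P (H n) (c n) (trainIdx a r)))
    simp only [abs_of_nonneg l2_nonneg] at h
    exact h

/-- The deviation of the cross-validated risk is asymptotically the normalized i.i.d. sum plus the
normalized cross-validated sum of the residuals. -/
lemma tendstoZeroInProb_deviation_sub (hH : ∀ n, LossFamily (H n)) (hc : ∀ n, Measurable (c n))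
    (hc2 : ∀ n w, |c n w| ≤ 2) (hc0 : ∀ n, ∫ w, c n w ∂P = 0) :
    TendstoZeroInProb (cvLaw P k) fun n ω => deviation P (H n) ω.2 ω.1
      - (√(n : ℝ))⁻¹ * ∑ i, c n (ω.1 i) - (√(n : ℝ))⁻¹ * cvSum (residual P (H n) (c n)) ω.2 ω.1 := by
  have hb : ∀ n (a : Fin n → Fin k), BddMeas fun W => deviation P (H n) a W
      - (√(n : ℝ))⁻¹ * ∑ i, c n (W i) - (√(n : ℝ))⁻¹ * cvSum (residual P (H n) (c n)) a W :=
    fun n a => (((hH n).bddMeas_deviation a).sub ((BddMeas.sum _ fun i _ =>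
      BddMeas.comp ⟨hc n, 2, hc2 n⟩ (measurable_pi_apply i)).const_mul _)).sub
        ((((hH n).centeredFamily_residual (hc n) (hc2 n) (hc0 n)).bddMeas_cvSum a).const_mul _)
  refine TendstoZeroInProb.of_integral (fun n => bddMeas_uncurry (hb n)) ?_
  refine squeeze_zero' (Eventually.of_forall fun n => integral_nonneg fun _ => abs_nonneg _) ?_
    (tendsto_const_div_sqrt_natCast (4 * k))
  filter_upwards [eventually_ge_atTop (2 * k)] with n hn
  refine (integral_cvLaw_le (fun a => (hb n a).abs) (K := fun _ => 4 * k / √(n : ℝ))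
    fun a ha => (integral_abs_le_l2 (hb n a)).trans ((hH n).l2_deviation_sub_le ha hn)).trans ?_
  simp

/-- The square root is Lipschitz away from zero; this holds for negative arguments as well, where
the square root is zero. -/
lemma abs_sqrt_sub_mul_le {s : ℝ} (hs : 0 ≤ s) (x : ℝ) : |√x - s| * s ≤ |x - s ^ 2| := by
  rcases le_or_gt 0 x with hx | hx
  · have e : x - s ^ 2 = (√x - s) * (√x + s) := by
      linear_combination - Real.sq_sqrt hx
    rw [e, abs_mul]
    refine mul_le_mul_of_nonneg_left ?_ (abs_nonneg _)
    exact (le_add_of_nonneg_left (Real.sqrt_nonneg x)).trans (le_abs_self _)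
  · rw [Real.sqrt_eq_zero_of_nonpos hx.le, zero_sub, abs_neg, abs_of_nonneg hs,
      abs_of_neg (by nlinarith [sq_nonneg s])]
    nlinarith

/-- The studentized deviation of the cross-validated risk is asymptotically standard normal. -/
theorem tendsto_deviation_add_nonneg (hH : ∀ n, LossFamily (H n)) (hc : ∀ n, Measurable (c n))
    (hc2 : ∀ n w, |c n w| ≤ 2) (hc0 : ∀ n, ∫ w, c n w ∂P = 0) {δ : ℝ} (hδ : 0 < δ)
    (hσ : ∀ᶠ n in atTop, δ ≤ √(∫ w, c n w ^ 2 ∂P))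
    (hlin : TendstoZeroInProb (cvLaw P k) fun n ω =>
      (√(n : ℝ))⁻¹ * cvSum (residual P (H n) (c n)) ω.2 ω.1)
    (hstab : ∀ r : Fin k, Tendsto (fun n => ∫ a, l2 (P.prod (iid P (Fin n)))
      (residual P (H n) (c n) (trainIdx a r)) ^ 2 ∂(uniformOn (balanced n k))) atTop (𝓝 0))
    (z : ℝ) :
    Tendsto (fun n => (cvLaw P k n).real {ω | 0 ≤ deviation P (H n) ω.2 ω.1
      + z * √((∑ r, evalVar (H n) ω.2 r ω.1) / k)}) atTop (𝓝 (cdf (gaussianReal 0 1) z)) := by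
  set σ : ℕ → ℝ := fun n => √(∫ w, c n w ^ 2 ∂P) with hσdef
  have hσsq : ∀ n, σ n ^ 2 = ∫ w, c n w ^ 2 ∂P := fun n =>
    Real.sq_sqrt (integral_nonneg fun _ => sq_nonneg _)
  let Y : ∀ n, (Fin n → Ω) × (Fin n → Fin k) → ℝ := fun n ω =>
    (√(n : ℝ))⁻¹ * ∑ i, c n (ω.1 i) / σ n
  let V : ∀ n, (Fin n → Ω) × (Fin n → Fin k) → ℝ := fun n ω =>
    √((∑ r, evalVar (H n) ω.2 r ω.1) / k) - σ n
  let E : ∀ n, (Fin n → Ω) × (Fin n → Fin k) → ℝ := fun n ω =>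
    deviation P (H n) ω.2 ω.1 - (√(n : ℝ))⁻¹ * ∑ i, c n (ω.1 i)
  -- the central limit theorem for the standardized function `c n / σ n`
  have hY : ∀ x, Tendsto (fun n => (cvLaw P k n).real {ω | x ≤ Y n ω}) atTop
      (𝓝 (gaussianTail x)) := by
    intro x
    have h := tendsto_sumLaw (P := P) (U := fun n w => c n w / σ n) (M := 2 / δ)
      (fun n => (hc n).div_const _) (by
        filter_upwards [hσ] with n hn w
        have hσn : 0 < σ n := hδ.trans_le hn
        rw [abs_div, abs_of_pos hσn]
        exact div_le_div₀ (by norm_num) (hc2 n w) hδ hn)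
      (Eventually.of_forall fun n => by rw [integral_div, hc0, zero_div]) (by
        filter_upwards [hσ] with n hn
        have hσn : 0 < σ n := hδ.trans_le hn
        simp only [div_pow]
        rw [integral_div, ← hσsq, div_self (by positivity)]) x
    refine h.congr fun n => ?_
    have hmp : MeasurePreserving Prod.fst (cvLaw P k n) (iid P (Fin n)) := measurePreserving_fst
    refine (hmp.measureReal_preimage (MeasurableSet.nullMeasurableSet ?_)).symm
    exact measurableSet_le measurable_const
      (measurable_normalized_sum (U := fun w => c n w / σ n) ((hc n).div_const _) n)
  have hV : TendstoZeroInProb (cvLaw P k) V := by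
    refine (tendstoZeroInProb_evalVar hH hc hc2 hc0 hstab).of_abs_le (K := δ⁻¹) (inv_pos.2 hδ) ?_
    filter_upwards [hσ] with n hn ω
    have hσn : 0 < σ n := hδ.trans_le hn
    rw [← hσsq, ← div_eq_inv_mul]
    refine le_trans ?_ (div_le_div_of_nonneg_left (abs_nonneg _) hδ hn)
    rw [le_div_iff₀ hσn]
    exact abs_sqrt_sub_mul_le hσn.le _
  have hE : TendstoZeroInProb (cvLaw P k) E := by
    refine ((tendstoZeroInProb_deviation_sub hH hc hc2 hc0).add hlin).of_abs_le (K := 1) one_pos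
      (Eventually.of_forall fun n ω => ?_)
    simp only [E, sub_add_cancel, one_mul, le_refl]
  have hR : TendstoZeroInProb (cvLaw P k) fun n ω => E n ω / σ n + z * V n ω / σ n := by
    refine TendstoZeroInProb.add (hE.of_abs_le (K := δ⁻¹) (inv_pos.2 hδ) ?_)
      (hV.of_abs_le (K := (|z| + 1) * δ⁻¹) (by positivity) ?_)
    · filter_upwards [hσ] with n hn ω
      have hσn : 0 < σ n := hδ.trans_le hn
      rw [abs_div, abs_of_pos hσn, ← div_eq_inv_mul]
      exact div_le_div_of_nonneg_left (abs_nonneg _) hδ hn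
    · filter_upwards [hσ] with n hn ω
      have hσn : 0 < σ n := hδ.trans_le hn
      rw [abs_div, abs_of_pos hσn, abs_mul]
      calc |z| * |V n ω| / σ n ≤ (|z| + 1) * |V n ω| / δ :=
            div_le_div₀ (by positivity) (by gcongr; linarith) hδ hn
        _ = _ := by ring
  have hmain := tendsto_tail_add (cvLaw P k) continuous_gaussianTail hY hR (-z)
  rw [gaussianTail_neg] at hmain
  refine hmain.congr' ?_
  filter_upwards [hσ] with n hn
  have hσn : 0 < σ n := hδ.trans_le hn
  congr 1
  ext ω
  simp only [Set.mem_ofPred_eq]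
  have e : deviation P (H n) ω.2 ω.1 + z * √((∑ r, evalVar (H n) ω.2 r ω.1) / k)
      = σ n * (Y n ω + (E n ω / σ n + z * V n ω / σ n) + z) := by
    simp only [Y, E, V, ← Finset.sum_div]
    field_simp
    ring
  rw [e, mul_nonneg_iff_of_pos_left hσn]
  constructor <;> intro h <;> linarith

end Normality

/-! ### Uniform integrability bounds the standard deviation from below -/

/-- Uniform integrability of `c n / σ n ^ 2`, where `σ n` is the standard deviation of the bounded
variable `c n`, excludes `σ n → 0`: since `c n ^ 2 / σ n ^ 2` has mean one, the part of it on which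
`|c n| ≤ K * σ n ^ 2` has mean at least `1 / 2`, and this part is at most `K ^ 2 * σ n ^ 2`. -/
lemma exists_pos_le_of_uniformIntegrable {Ω : Type*} [MeasurableSpace Ω] {P : Measure Ω}
    [IsProbabilityMeasure P] {c : ℕ → Ω → ℝ} {σ : ℕ → ℝ} (hc : ∀ n, Measurable (c n))
    (hc2 : ∀ n w, |c n w| ≤ 2) (hσ : ∀ n, σ n ^ 2 = ∫ w, c n w ^ 2 ∂P)
    (hpos : ∀ᶠ n in atTop, 0 < σ n)
    (hUI : UniformIntegrable (fun n w => c n w / σ n ^ 2) 1 P) :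
    ∃ δ > 0, ∀ᶠ n in atTop, δ ≤ σ n := by
  obtain ⟨K, hK⟩ := hUI.spec one_ne_zero ENNReal.one_ne_top (ε := 1 / 4) (by norm_num)
  have hK0 : (0 : ℝ) ≤ K := K.coe_nonneg
  refine ⟨1 / (2 * (K + 1)), by positivity, ?_⟩
  filter_upwards [hpos] with n hn
  set G : Ω → ℝ := {w | K ≤ ‖c n w / σ n ^ 2‖₊}.indicator fun w => c n w / σ n ^ 2 with hG
  have hcb : BddMeas (c n) := ⟨hc n, 2, hc2 n⟩
  have hVm : Measurable fun w => c n w / σ n ^ 2 := (hc n).div_const _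
  have hGm : Measurable G := hVm.indicator (measurableSet_le measurable_const hVm.nnnorm)
  have hGb : BddMeas G := by
    refine ⟨hGm, 2 / σ n ^ 2, fun w => ?_⟩
    have h2 : |c n w / σ n ^ 2| ≤ 2 / σ n ^ 2 := by
      rw [abs_div, abs_of_pos (a := σ n ^ 2) (by positivity)]
      exact div_le_div_of_nonneg_right (hc2 n w) (by positivity)
    refine le_trans ?_ h2
    rw [hG]
    exact norm_indicator_le_norm_self (fun w => c n w / σ n ^ 2) w
  have hGi : ∫ w, |G w| ∂P ≤ 1 / 4 := by
    have h := hK n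
    rw [eLpNorm_one_eq_lintegral_enorm] at h
    have h2 := ofReal_integral_norm_eq_lintegral_enorm (hGb.integrable P)
    rw [← h2] at h
    exact (ENNReal.ofReal_le_ofReal_iff (by norm_num)).1 h
  have hpt : ∀ w, c n w ^ 2 / σ n ^ 2 ≤ 2 * |G w| + σ n ^ 2 * K ^ 2 := by
    intro w
    by_cases hw : K ≤ ‖c n w / σ n ^ 2‖₊
    · have e : G w = c n w / σ n ^ 2 := Set.indicator_of_mem (by exact hw) _
      have e2 : c n w ^ 2 / σ n ^ 2 = |c n w| * |c n w / σ n ^ 2| := by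
        rw [abs_div, abs_of_pos (a := σ n ^ 2) (by positivity), ← sq_abs (c n w)]
        ring
      rw [e, e2]
      have := mul_le_mul_of_nonneg_right (hc2 n w) (abs_nonneg (c n w / σ n ^ 2))
      have h3 : 0 ≤ σ n ^ 2 * (K : ℝ) ^ 2 := by positivity
      linarith
    · have h1 : |c n w / σ n ^ 2| ≤ K := by
        have := (not_le.1 hw).le
        rw [← Real.norm_eq_abs]
        exact_mod_cast this
      have e2 : c n w ^ 2 / σ n ^ 2 = σ n ^ 2 * |c n w / σ n ^ 2| ^ 2 := by
        rw [sq_abs]; field_simp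
      rw [e2]
      have h2 := mul_le_mul_of_nonneg_left (pow_le_pow_left₀ (abs_nonneg _) h1 2) (sq_nonneg (σ n))
      have h3 := abs_nonneg (G w)
      linarith
  have h1 : (1 : ℝ) ≤ 2 * (1 / 4) + σ n ^ 2 * K ^ 2 := by
    calc (1 : ℝ) = ∫ w, c n w ^ 2 / σ n ^ 2 ∂P := by
          rw [integral_div, ← hσ, div_self (by positivity)]
      _ ≤ ∫ w, (2 * |G w| + σ n ^ 2 * K ^ 2) ∂P := by
          refine integral_mono ?_ (((hGb.abs.const_mul _).add (BddMeas.const _)).integrable P) hpt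
          exact ((hcb.pow 2).integrable P).div_const _
      _ = 2 * ∫ w, |G w| ∂P + σ n ^ 2 * K ^ 2 := by
          rw [integral_add ((hGb.abs.const_mul _).integrable P) (integrable_const _),
            integral_const_mul]
          simp
      _ ≤ _ := by linarith
  by_contra! hlt
  have h2 : σ n * (K + 1) < 1 / 2 := by
    rw [lt_div_iff₀ (by positivity)] at hlt
    linarith
  have h3 : σ n * K ≤ σ n * (K + 1) := mul_le_mul_of_nonneg_left (by linarith) hn.le
  have h4 : 0 ≤ σ n * K := by positivity
  nlinarith

/-! ### The losses of a training rule -/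

section Rule

variable {𝒳 𝒴 𝒵 : Type*} [MeasurableSpace 𝒳] [MeasurableSpace 𝒴] [MeasurableSpace 𝒵]
  {μZ : Measure 𝒵} [IsProbabilityMeasure μZ] {Q : Kernel 𝒵 𝒳} [IsMarkovKernel Q]
  {R : Kernel (𝒵 × 𝒳) 𝒴} [IsMarkovKernel R] {J k : ℕ} [NeZero k] {f : Rule 𝒳 𝒴 𝒵 J}

/-- The loss at `p.1` of the classifier trained on the observations of `p.2` with indices in `B`. -/
noncomputable def ruleLoss (f : Rule 𝒳 𝒴 𝒵 J) (n : ℕ) (B : Finset (Fin n))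
    (p : Obs 𝒳 𝒴 𝒵 J × (Fin n → Obs 𝒳 𝒴 𝒵 J)) : ℝ :=
  loss (f B.card fun j => p.2 (B.orderEmbOfFin rfl j)) p.1

lemma loss_nonneg (g : 𝒳 × 𝒴 × 𝒵 → ℝ) (w : Obs 𝒳 𝒴 𝒵 J) : 0 ≤ loss g w := by
  unfold loss; positivity

lemma loss_le_two {g : 𝒳 × 𝒴 × 𝒵 → ℝ} (hg : ∀ t, g t ∈ Set.Icc (0 : ℝ) 1) (w : Obs 𝒳 𝒴 𝒵 J) :
    loss g w ≤ 2 := by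
  have h1 : |g (w.1, w.2.2.1, w.2.2.2) - 1| ≤ 1 := by
    have := hg (w.1, w.2.2.1, w.2.2.2)
    rw [abs_le]
    constructor <;> linarith [this.1, this.2]
  have h2 : ∑ j, |g (w.2.1 j, w.2.2.1, w.2.2.2)| ≤ J := by
    calc ∑ j, |g (w.2.1 j, w.2.2.1, w.2.2.2)| ≤ ∑ _j : Fin J, (1 : ℝ) :=
          Finset.sum_le_sum fun j _ => by
            have := hg (w.2.1 j, w.2.2.1, w.2.2.2)
            rw [abs_of_nonneg this.1]
            exact this.2
      _ = J := by simp
  have h3 : (1 / (J : ℝ)) * ∑ j, |g (w.2.1 j, w.2.2.1, w.2.2.2)| ≤ 1 := by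
    rw [one_div, ← div_eq_inv_mul]
    exact div_le_one_of_le₀ h2 (by positivity)
  unfold loss
  linarith

lemma IsRule.lossFamily (hf : IsRule f) (n : ℕ) : LossFamily (ruleLoss f n) where
  measurable B := by
    have hm := hf.measurable B.card
    have hW : Measurable fun p : Obs 𝒳 𝒴 𝒵 J × (Fin n → Obs 𝒳 𝒴 𝒵 J) =>
        fun j : Fin B.card => p.2 (B.orderEmbOfFin rfl j) :=
      measurable_pi_lambda _ fun j => (measurable_pi_apply _).comp measurable_snd
    have h1 : Measurable fun p : Obs 𝒳 𝒴 𝒵 J × (Fin n → Obs 𝒳 𝒴 𝒵 J) =>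
        f B.card (fun j => p.2 (B.orderEmbOfFin rfl j)) (p.1.1, p.1.2.2.1, p.1.2.2.2) :=
      hm.comp (hW.prodMk (by fun_prop))
    have h2 : ∀ i : Fin J, Measurable fun p : Obs 𝒳 𝒴 𝒵 J × (Fin n → Obs 𝒳 𝒴 𝒵 J) =>
        f B.card (fun j => p.2 (B.orderEmbOfFin rfl j)) (p.1.2.1 i, p.1.2.2.1, p.1.2.2.2) :=
      fun i => hm.comp (hW.prodMk (by fun_prop))
    have h3 := (h1.sub_const 1).norm.add ((Finset.measurable_sum Finset.univ
      fun i _ => (h2 i).norm).const_mul (1 / (J : ℝ)))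
    exact h3
  abs_le B p := by
    rw [ruleLoss, abs_of_nonneg (loss_nonneg _ _)]
    exact loss_le_two (hf.mem_Icc _ _) _
  dependsOn B w V W h := by
    simp only [ruleLoss]
    congr 2
    ext1 j
    exact h _ (Finset.orderEmbOfFin_mem B rfl j)

lemma IsRule.bddMeas_trained (hf : IsRule f) (n : ℕ) :
    BddMeas fun q : Obs 𝒳 𝒴 𝒵 J × Sample 𝒳 𝒴 𝒵 J n k =>
      ruleLoss f n (trainIdx q.2.2 0) (q.1, q.2.1) :=
  (bddMeas_uncurry (F := fun (a : Fin n → Fin k) => ruleLoss f n (trainIdx a 0))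
    fun a => (hf.lossFamily n).bddMeas _).comp
    (φ := fun q : Obs 𝒳 𝒴 𝒵 J × Sample 𝒳 𝒴 𝒵 J n k => ((q.1, q.2.1), q.2.2)) (by fun_prop)

instance (n : ℕ) : IsProbabilityMeasure (sampleLaw μZ Q R J k n) :=
  inferInstanceAs (IsProbabilityMeasure (cvLaw (obsLaw μZ Q R J) k n))

lemma IsRule.bddMeas_avgLoss (hf : IsRule f) (n : ℕ) : BddMeas (avgLoss μZ Q R k f n) :=
  (hf.bddMeas_trained (k := k) n).integral_right (sampleLaw μZ Q R J k n)

lemma IsRule.avgLoss_mem_Icc (hf : IsRule f) (n : ℕ) (w : Obs 𝒳 𝒴 𝒵 J) :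
    avgLoss μZ Q R k f n w ∈ Set.Icc (0 : ℝ) 2 := by
  constructor
  · exact integral_nonneg fun ω => loss_nonneg _ _
  · refine (le_abs_self _).trans (abs_integral_le_of_abs_le fun ω => ?_)
    rw [abs_of_nonneg (loss_nonneg _ _)]
    exact loss_le_two (hf.mem_Icc _ _) _

lemma IsRule.measurable_centeredAvgLoss (hf : IsRule f) (n : ℕ) :
    Measurable (centeredAvgLoss μZ Q R k f n) :=
  (hf.bddMeas_avgLoss n).measurable.sub_const _

lemma IsRule.abs_centeredAvgLoss_le (hf : IsRule f) (n : ℕ) (w : Obs 𝒳 𝒴 𝒵 J) :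
    |centeredAvgLoss μZ Q R k f n w| ≤ 2 := by
  have h1 := hf.avgLoss_mem_Icc (μZ := μZ) (Q := Q) (R := R) (k := k) n w
  have h2 : 0 ≤ ∫ w', avgLoss μZ Q R k f n w' ∂(obsLaw μZ Q R J) :=
    integral_nonneg fun w => (hf.avgLoss_mem_Icc n w).1
  have h3 : ∫ w', avgLoss μZ Q R k f n w' ∂(obsLaw μZ Q R J) ≤ 2 :=
    (le_abs_self _).trans (abs_integral_le_of_abs_le fun w => by
      have := hf.avgLoss_mem_Icc (μZ := μZ) (Q := Q) (R := R) (k := k) n w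
      rw [abs_of_nonneg this.1]
      exact this.2)
  rw [centeredAvgLoss, abs_le]
  constructor <;> linarith [h1.1, h1.2]

lemma IsRule.integral_centeredAvgLoss (hf : IsRule f) (n : ℕ) :
    ∫ w, centeredAvgLoss μZ Q R k f n w ∂(obsLaw μZ Q R J) = 0 := by
  unfold centeredAvgLoss
  rw [integral_sub ((hf.bddMeas_avgLoss n).integrable _) (integrable_const _)]
  simp

lemma IsRule.sigma_eq (hf : IsRule f) (n : ℕ) : sigma μZ Q R k f n
    = √(∫ w, centeredAvgLoss μZ Q R k f n w ^ 2 ∂(obsLaw μZ Q R J)) := by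
  rw [sigma, variance_eq_integral (hf.bddMeas_avgLoss n).measurable.aemeasurable]
  rfl

lemma IsRule.sigma_sq (hf : IsRule f) (n : ℕ) : sigma μZ Q R k f n ^ 2
    = ∫ w, centeredAvgLoss μZ Q R k f n w ^ 2 ∂(obsLaw μZ Q R J) := by
  rw [hf.sigma_eq, Real.sq_sqrt (integral_nonneg fun _ => sq_nonneg _)]

lemma IsRule.sigma_le_two (hf : IsRule f) (n : ℕ) : sigma μZ Q R k f n ≤ 2 := by
  rw [hf.sigma_eq]
  exact l2_le_of_abs_le (hf.abs_centeredAvgLoss_le n)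

variable (μZ Q R k) in
/-- The residuals of a training rule. -/
noncomputable abbrev ruleResidual (f : Rule 𝒳 𝒴 𝒵 J) (n : ℕ) :
    Finset (Fin n) → Obs 𝒳 𝒴 𝒵 J × (Fin n → Obs 𝒳 𝒴 𝒵 J) → ℝ :=
  residual (obsLaw μZ Q R J) (ruleLoss f n) (centeredAvgLoss μZ Q R k f n)

/-- If the losses do not depend on the data, there are no residuals. -/
lemma ruleResidual_eq_zero {n : ℕ} {h : Obs 𝒳 𝒴 𝒵 J → ℝ} (a : Fin n → Fin k) (r : Fin k)
    (hh : ∀ (b : Fin n → Fin k) s p, ruleLoss f n (trainIdx b s) p = h p.1) :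
    ruleResidual μZ Q R k f n (trainIdx a r) = 0 := by
  have h1 : ∀ w, avgLoss μZ Q R k f n w = h w := fun w => by
    have : ∀ ω : Sample 𝒳 𝒴 𝒵 J n k, loss (trained f ω 0) w = h w := fun ω => hh ω.2 0 (w, ω.1)
    simp [avgLoss, this]
  ext p
  simp [ruleResidual, residual, risk, centeredAvgLoss, hh, h1]

/-- With a single fold, the classifier is trained on no data at all. -/
lemma IsRule.ruleResidual_eq_zero_of_one (hf : IsRule f) {n : ℕ} (hk : k = 1) (a : Fin n → Fin k)
    (r : Fin k) : ruleResidual μZ Q R k f n (trainIdx a r) = 0 := by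
  subst hk
  ext p
  have h0 : ∀ (b : Fin n → Fin 1) s, trainIdx b s = ∅ := fun b s => by
    ext i
    simp [mem_trainIdx, Subsingleton.elim (b i) s]
  exact congrFun (ruleResidual_eq_zero (h := fun w => ruleLoss f n ∅ (w, p.2)) a r
    fun b s q => by
      rw [h0]
      exact (hf.lossFamily n).dependsOn ∅ q.1 fun i hi => absurd hi (by simp)) p

/-- Asymptotic coverage: the upper confidence bound for the risk that underlies the floodgate
bound exceeds the mean risk of the trained classifiers with probability tending to `Φ(z)`. -/
theorem IsRule.tendsto_deviation_add_nonneg (hf : IsRule f) {δ : ℝ} (hδ : 0 < δ)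
    (hσ : ∀ᶠ n in atTop, δ ≤ sigma μZ Q R k f n)
    (hlin : TendstoZeroInProb (sampleLaw μZ Q R J k) fun n ω =>
      (√(n : ℝ))⁻¹ * cvSum (ruleResidual μZ Q R k f n) ω.2 ω.1) (z : ℝ) :
    Tendsto (fun n => (sampleLaw μZ Q R J k n).real
      {ω | 0 ≤ deviation (obsLaw μZ Q R J) (ruleLoss f n) ω.2 ω.1
        + z * √((∑ r, foldVar f ω r) / k)}) atTop (𝓝 (cdf (gaussianReal 0 1) z)) := by
  refine Floodgate.tendsto_deviation_add_nonneg (P := obsLaw μZ Q R J) (hf.lossFamily)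
    (hf.measurable_centeredAvgLoss) (hf.abs_centeredAvgLoss_le) (hf.integral_centeredAvgLoss)
    hδ ?_ hlin (fun r => ?_) z
  · filter_upwards [hσ] with n hn
    rwa [← hf.sigma_eq]
  · by_cases hk : 2 ≤ k
    · exact tendsto_integral_sq_l2 hk (by norm_num) (fun n =>
        (hf.lossFamily n).centeredFamily_residual (hf.measurable_centeredAvgLoss n)
          (hf.abs_centeredAvgLoss_le n) (hf.integral_centeredAvgLoss n)) hlin r
    · have hk1 : k = 1 := by have := NeZero.ne k; omega
      have h0 : ∀ n (a : Fin n → Fin k), residual (obsLaw μZ Q R J) (ruleLoss f n)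
          (centeredAvgLoss μZ Q R k f n) (trainIdx a r) = 0 := fun n a =>
        hf.ruleResidual_eq_zero_of_one hk1 a r
      simp [h0, l2]

lemma one_sub_foldMean_le_iff {n : ℕ} (hn : 0 < n) {τ : ℝ} (z : ℝ) (ω : Sample 𝒳 𝒴 𝒵 J n k) :
    1 - (∑ r, foldMean f ω r) / k - z * √((∑ r, foldVar f ω r) / k) / √(n : ℝ) ≤ τ ↔
      √(n : ℝ) * ((1 - (∑ r, risk (obsLaw μZ Q R J) (ruleLoss f n) (trainIdx ω.2 r) ω.1) / k) - τ)
        ≤ deviation (obsLaw μZ Q R J) (ruleLoss f n) ω.2 ω.1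
          + z * √((∑ r, foldVar f ω r) / k) := by
  have hs : 0 < √(n : ℝ) := Real.sqrt_pos.2 (by exact_mod_cast hn)
  have e : deviation (obsLaw μZ Q R J) (ruleLoss f n) ω.2 ω.1 + z * √((∑ r, foldVar f ω r) / k)
      = √(n : ℝ) * ((∑ r, foldMean f ω r) / k
        - (∑ r, risk (obsLaw μZ Q R J) (ruleLoss f n) (trainIdx ω.2 r) ω.1) / k
        + z * √((∑ r, foldVar f ω r) / k) / √(n : ℝ)) := by
    rw [mul_add, mul_div_cancel₀ _ hs.ne']
    rfl
  rw [e, mul_le_mul_iff_right₀ hs]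
  constructor <;> intro h <;> linarith

end Rule

/-! ### Coverage of the lower confidence bound -/

section Coverage

variable {𝒳 𝒴 𝒵 : Type*} [MeasurableSpace 𝒳] [MeasurableSpace 𝒴] [MeasurableSpace 𝒵]
  [Countable 𝒴] [DiscreteMeasurableSpace 𝒴]
  {μZ : Measure 𝒵} [IsProbabilityMeasure μZ] {Q : Kernel 𝒵 𝒳} [IsMarkovKernel Q]
  {R : Kernel (𝒵 × 𝒳) 𝒴} [IsMarkovKernel R] {J k : ℕ} [NeZero k] {f : Rule 𝒳 𝒴 𝒵 J}

/-- The lower bound covers `ETV` whenever the upper confidence bound for the risk covers the mean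
risk of the trained classifiers, as the latter is at least `1 - E[TV]`. -/
lemma IsRule.lowerBound_le_ETV (hf : IsRule f) (hY : (supportY μZ Q R).Nontrivial) (hJ : 1 ≤ J)
    {n : ℕ} (hn : 0 < n) {z : ℝ} {ω : Sample 𝒳 𝒴 𝒵 J n k}
    (h : 0 ≤ deviation (obsLaw μZ Q R J) (ruleLoss f n) ω.2 ω.1
      + z * √((∑ r, foldVar f ω r) / k)) :
    lowerBound (normConst μZ Q R) z f ω ≤ ETV μZ Q R := by
  rw [lowerBound_le_ETV_iff μZ Q R hY, one_sub_foldMean_le_iff (μZ := μZ) (Q := Q) (R := R) hn]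
  refine le_trans ?_ h
  refine mul_nonpos_of_nonneg_of_nonpos (Real.sqrt_nonneg _) ?_
  have hk : (0 : ℝ) < k := by exact_mod_cast Nat.pos_of_ne_zero (NeZero.ne k)
  set τ := ∫ t, tvDist (R t) (condYZ Q R t.1) ∂(μZ ⊗ₘ Q) with hτ
  have h1 : ∀ r, 1 - τ ≤ risk (obsLaw μZ Q R J) (ruleLoss f n) (trainIdx ω.2 r) ω.1 := fun r => by
    have hm : Measurable (trained f ω r) := (hf.measurable _).comp measurable_prodMk_left
    have := one_sub_integral_loss_le μZ Q R hJ hm fun t => hf.mem_Icc _ _ t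
    have e : risk (obsLaw μZ Q R J) (ruleLoss f n) (trainIdx ω.2 r) ω.1
        = ∫ w : Obs 𝒳 𝒴 𝒵 J, loss (trained f ω r) w ∂(obsLaw μZ Q R J) := rfl
    rw [e]
    linarith
  have h2 : (k : ℝ) * (1 - τ) ≤ ∑ r, risk (obsLaw μZ Q R J) (ruleLoss f n) (trainIdx ω.2 r) ω.1 := by
    calc (k : ℝ) * (1 - τ) = ∑ _r : Fin k, (1 - τ) := by simp [mul_sub]
      _ ≤ _ := Finset.sum_le_sum fun r _ => h1 r
  have h3 := (le_div_iff₀' hk).2 h2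
  linarith

/-- The oracle classifier, as a training rule that ignores the data. -/
noncomputable abbrev oracleRule (Q : Kernel 𝒵 𝒳) (R : Kernel (𝒵 × 𝒳) 𝒴) (J : ℕ) :
    Rule 𝒳 𝒴 𝒵 J :=
  fun _ _ => oracle Q R

lemma isRule_oracleRule : IsRule (oracleRule Q R J) where
  measurable _ := (measurable_oracle Q R).comp measurable_snd
  mem_Icc _ _ t := oracle_mem_Icc Q R t

/-- The oracle classifier attains equality in the population bound, hence also the two coverage
events agree. -/
lemma lowerBound_oracleRule_le_ETV_iff (hY : (supportY μZ Q R).Nontrivial) (hJ : 1 ≤ J)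
    {n : ℕ} (hn : 0 < n) {z : ℝ} {ω : Sample 𝒳 𝒴 𝒵 J n k} :
    lowerBound (normConst μZ Q R) z (oracleRule Q R J) ω ≤ ETV μZ Q R ↔
      0 ≤ deviation (obsLaw μZ Q R J) (ruleLoss (oracleRule Q R J) n) ω.2 ω.1
        + z * √((∑ r, foldVar (oracleRule Q R J) ω r) / k) := by
  rw [lowerBound_le_ETV_iff μZ Q R hY, one_sub_foldMean_le_iff (μZ := μZ) (Q := Q) (R := R) hn]
  have hk : (k : ℝ) ≠ 0 := by exact_mod_cast NeZero.ne k
  have h1 : ∀ r, risk (obsLaw μZ Q R J) (ruleLoss (oracleRule Q R J) n) (trainIdx ω.2 r) ω.1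
      = 1 - ∫ t, tvDist (R t) (condYZ Q R t.1) ∂(μZ ⊗ₘ Q) := fun r => by
    rw [← one_sub_integral_loss_oracle μZ Q R hJ, sub_sub_cancel]
    rfl
  have h2 : 1 - (∑ r, risk (obsLaw μZ Q R J) (ruleLoss (oracleRule Q R J) n)
      (trainIdx ω.2 r) ω.1) / k - ∫ t, tvDist (R t) (condYZ Q R t.1) ∂(μZ ⊗ₘ Q) = 0 := by
    simp only [h1, Finset.sum_const, Finset.card_univ, Fintype.card_fin, nsmul_eq_mul]
    field_simp
    ring
  rw [h2, mul_zero]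

/-- Asymptotic coverage for a training rule that satisfies the two assumptions. -/
theorem IsRule.le_liminf_coverage (hf : IsRule f) (hY : (supportY μZ Q R).Nontrivial) (hJ : 1 ≤ J)
    (hpos : ∀ᶠ n in atTop, 0 < sigma μZ Q R k f n)
    (hUI : UniformIntegrable
      (fun n w => centeredAvgLoss μZ Q R k f n w / sigma μZ Q R k f n ^ 2) 1 (obsLaw μZ Q R J))
    (hlin : TendstoZeroInProb (sampleLaw μZ Q R J k) fun _ ω => linearityRemainder μZ Q R f ω)
    (z : ℝ) :
    cdf (gaussianReal 0 1) z ≤ liminf (fun n : ℕ => (sampleLaw μZ Q R J k n).real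
      {ω | lowerBound (normConst μZ Q R) z f ω ≤ ETV μZ Q R}) atTop := by
  obtain ⟨δ, hδ, hσ⟩ := exists_pos_le_of_uniformIntegrable (P := obsLaw μZ Q R J)
    hf.measurable_centeredAvgLoss hf.abs_centeredAvgLoss_le hf.sigma_sq hpos hUI
  have hS : TendstoZeroInProb (sampleLaw μZ Q R J k) fun n ω =>
      (√(n : ℝ))⁻¹ * cvSum (ruleResidual μZ Q R k f n) ω.2 ω.1 := by
    refine hlin.of_abs_le (K := 2) two_pos ?_
    filter_upwards [hpos] with n hn ω
    have e : (√(n : ℝ))⁻¹ * cvSum (ruleResidual μZ Q R k f n) ω.2 ω.1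
        = sigma μZ Q R k f n * linearityRemainder μZ Q R f ω := by
      have e1 : linearityRemainder μZ Q R f ω = 1 / (sigma μZ Q R k f n * √(n : ℝ))
          * cvSum (ruleResidual μZ Q R k f n) ω.2 ω.1 := rfl
      rw [e1, ← mul_assoc, one_div, mul_inv, mul_inv_cancel_left₀ hn.ne']
    rw [e, abs_mul, abs_of_pos hn]
    exact mul_le_mul_of_nonneg_right (hf.sigma_le_two n) (abs_nonneg _)
  have h := hf.tendsto_deviation_add_nonneg hδ hσ hS z
  rw [← h.liminf_eq]
  refine liminf_le_liminf ?_ h.isBoundedUnder_ge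
    (isBoundedUnder_of ⟨1, fun n => measureReal_le_one⟩).isCoboundedUnder_ge
  filter_upwards [eventually_gt_atTop 0] with n hn
  exact measureReal_mono fun ω hω => hf.lowerBound_le_ETV hY hJ hn hω

/-- The asymptotic coverage is exact for the oracle: its residuals vanish. -/
theorem tendsto_coverage_oracleRule (hY : (supportY μZ Q R).Nontrivial) (hJ : 1 ≤ J)
    (hvar : 0 < variance (loss (J := J) (oracle Q R)) (obsLaw μZ Q R J)) (z : ℝ) :
    Tendsto (fun n : ℕ => (sampleLaw μZ Q R J k n).real
      {ω | lowerBound (normConst μZ Q R) z (oracleRule Q R J) ω ≤ ETV μZ Q R}) atTop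
      (𝓝 (cdf (gaussianReal 0 1) z)) := by
  have hf : IsRule (oracleRule Q R J) := isRule_oracleRule
  have hσ : ∀ n, sigma μZ Q R k (oracleRule Q R J) n
      = √(variance (loss (J := J) (oracle Q R)) (obsLaw μZ Q R J)) := fun n => by
    have : avgLoss μZ Q R k (oracleRule Q R J) n = loss (oracle Q R) := by
      ext w
      have e : ∀ ω : Sample 𝒳 𝒴 𝒵 J n k,
          loss (trained (oracleRule Q R J) ω 0) w = loss (oracle Q R) w := fun _ => rfl
      simp only [avgLoss, e, integral_const, probReal_univ, one_smul]
    rw [sigma, this]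
  have hres : ∀ n (ω : Sample 𝒳 𝒴 𝒵 J n k),
      (√(n : ℝ))⁻¹ * cvSum (ruleResidual μZ Q R k (oracleRule Q R J) n) ω.2 ω.1 = 0 := by
    intro n ω
    have h0 : ∀ r, residual (obsLaw μZ Q R J) (ruleLoss (oracleRule Q R J) n)
        (centeredAvgLoss μZ Q R k (oracleRule Q R J) n) (trainIdx ω.2 r) = 0 := fun r =>
      ruleResidual_eq_zero (h := loss (oracle Q R)) ω.2 r fun _ _ _ => rfl
    simp [cvSum, h0]
  have h := hf.tendsto_deviation_add_nonneg (Real.sqrt_pos.2 hvar)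
    (Eventually.of_forall fun n => (hσ n).ge) (fun ε hε => by simp [hres, hε.not_ge]) z
  refine h.congr' ?_
  filter_upwards [eventually_gt_atTop 0] with n hn
  congr 1
  ext ω
  exact (lowerBound_oracleRule_le_ETV_iff hY hJ hn).symm

end Coverage

end Floodgate
theorem mainTheorem5
    {𝒳 𝒴 𝒵 : Type*} [MeasurableSpace 𝒳] [MeasurableSpace 𝒵]
    [MeasurableSpace 𝒴] [Countable 𝒴] [DiscreteMeasurableSpace 𝒴]
    (μZ : Measure 𝒵) [IsProbabilityMeasure μZ]
    (Q : Kernel 𝒵 𝒳) [IsMarkovKernel Q] (R : Kernel (𝒵 × 𝒳) 𝒴) [IsMarkovKernel R]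
    (hY : (Floodgate.supportY μZ Q R).Nontrivial)
    (J : ℕ) (hJ : 1 ≤ J) (k : ℕ) [NeZero k]
    (α : ℝ) (hα : α ∈ Set.Ioo (0 : ℝ) 1)
    (z : ℝ) (hz : 1 - cdf (gaussianReal 0 1) z = α) :
    (∀ f : Floodgate.Rule 𝒳 𝒴 𝒵 J, Floodgate.IsRule f →
      (∀ᶠ n in atTop, 0 < Floodgate.sigma μZ Q R k f n) →
      UniformIntegrable
        (fun n w => Floodgate.centeredAvgLoss μZ Q R k f n w / Floodgate.sigma μZ Q R k f n ^ 2)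
        1 (Floodgate.obsLaw μZ Q R J) →
      (∀ ε : ℝ, 0 < ε → Tendsto
        (fun n : ℕ => (Floodgate.sampleLaw μZ Q R J k n).real
          {ω | ε ≤ |Floodgate.linearityRemainder μZ Q R f ω|}) atTop (𝓝 0)) →
      1 - α ≤ liminf
        (fun n : ℕ => (Floodgate.sampleLaw μZ Q R J k n).real
          {ω | Floodgate.lowerBound (Floodgate.normConst μZ Q R) z f ω ≤ Floodgate.ETV μZ Q R})
        atTop) ∧
    (0 < variance (Floodgate.loss (Floodgate.oracle Q R)) (Floodgate.obsLaw μZ Q R J) →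
      Tendsto
        (fun n : ℕ => (Floodgate.sampleLaw μZ Q R J k n).real
          {ω | Floodgate.lowerBound (Floodgate.normConst μZ Q R) z
            (fun _ _ => Floodgate.oracle Q R) ω ≤ Floodgate.ETV μZ Q R})
        atTop (𝓝 (1 - α))) := by
  have hcdf : cdf (gaussianReal 0 1) z = 1 - α := by linarith
  rw [← hcdf]
  exact ⟨fun f hf hpos hUI hlin => hf.le_liminf_coverage hY hJ hpos hUI hlin z,
    fun hvar => Floodgate.tendsto_coverage_oracleRule hY hJ hvar z⟩
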